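/- **Setting.** Let $H$ be a $2$-dimensional complex Hilbert space and $A$ a linear operator on $H$. Its conformal range (real Davis--Wielandt shell) is, in the Beltrami--Cayley--Klein (BCK), parabolic Cayley--Klein (pCK) and Poincaré half-plane (Ph) models, the set $R_*(A)\subset\mathbb R^2$ of the points (for $x\in H$, $x\ne0$, $y=Ax$) $$\Big(\tfrac{2\operatorname{Re}\langle y,x\rangle}{|y|^2+|x|^2},\tfrac{|y|^2-|x|^2}{|y|^2+|x|^2}\Big)_{\mathrm{BCK}},\quad \Big(\tfrac{\operatorname{Re}\langle y,x\rangle}{|x|^2},\tfrac{|y|^2}{|x|^2}\Big)_{\mathrm{pCK}},\quad \Big(\tfrac{\operatorname{Re}\langle y,x\rangle}{|x|^2},\tfrac{\sqrt{|x|^2|y|^2-(\operatorname{Re}\langle y,x\rangle)^2}}{|x|^2}\Big)_{\mathrm{Ph}} .$$ For $\lambda\in\mathbb C$ let $\iota_*(\lambda)$ be, respectively, $\big(\frac{2\operatorname{Re}\lambda}{|\lambda|^2+1},\frac{|\lambda|^2-1}{|\lambda|^2+1}\big)$, $(\operatorname{Re}\lambda,|\lambda|^2)$, $(\operatorname{Re}\lambda,|\operatorname{Im}\lambda|)$;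 for eigenvalues $\lambda$ of $A$ these are the $h$-eigenpoints. The base sets are $\{u^2+v^2\le1\}$, $\{u^2\le v\}$, $\{v\ge0\}$ (for pCK and Ph up to one ideal point, corresponding to $(0,1)$ in BCK), and the models are identified through $(u,v)_{\mathrm{pCK}}\mapsto\big(\frac{2u}{v+1},\frac{v-1}{v+1}\big)_{\mathrm{BCK}}$ and $(u,v)_{\mathrm{Ph}}\mapsto\big(\frac{2u}{u^2+v^2+1},\frac{u^2+v^2-1}{u^2+v^2+1}\big)_{\mathrm{BCK}}$. **Terminology** (in the BCK model $\overline D=\{|p|\le1\}$, hence, by transcription, in all models). Points with $|p|<1$ are ordinary, those with $|p|=1$ asymptotic. The distance of ordinary points is $d(p,q)=\operatorname{arcosh}\frac{1-p\cdot q}{\sqrt{1-|p|^2}\sqrt{1-|q|^2}}$. An $h$-collineation is a bijection of $\overline D$ that is the restriction of a projective transformation. An asymptotically closed $h$-line is the intersection with $\overline D$ of a straight line meeting the interior; asymptotically closed $h$-half-lines and $h$-segments are the corresponding intersections of $\overline D$ with rays and the segments between ordinary points. * An $h$-disk (filled $h$-circle) is $\{X \text{ ordinary}: d(P,X)\le r\}$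 with $P$ ordinary and $r>0$. * An $h$-horocycle with asymptotic point $P_0$ is the orbit of an ordinary point under the group generated by the $h$-collineations whose fixed point set is an asymptotically closed $h$-line through $P_0$; an $h$-horodisk is the convex hull of an $h$-horocycle with $P_0$ added. * An $h$-distance band around the $h$-line $l$ with asymptotic points $P\ne Q$ is $\{X\text{ ordinary}: d(X,l)\le r\}\cup\{P,Q\}$ with $r>0$. * A proper $h$-elliptical disk is a non-degenerate Euclidean elliptical disk (circular ones allowed) consisting of ordinary points which is not an $h$-disk. * An $h$-elliptic parabolic disk with asymptotic point $P_0$ is a non-degenerate Euclidean elliptical disk in $\overline D$ whose only asymptotic point is $P_0$ and which is not an $h$-horodisk. **Theorem.** Let $\lambda_1,\lambda_2$ be the eigenvalues of $A$, listed with algebraic multiplicity. Up to the order of the eigenvalues exactly one of the following five spectral types occurs; so, together with normality or non-normality of $A$, exactly one of the ten cases below. In each of the three models $R_*(A)$ is contained in the base set, and the following hold. If $A$ is normal: (i) If $\lambda_1$ is non-real and $\lambda_2\in\{\lambda_1,\overline{\lambda_1}\}$, then $R_*(A)=\{\iota_*(\lambda_1)\}$, an ordinary $h$-point. (ii) If $\lambda_1,\lambda_2$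 are non-real, neither equal nor conjugate, then $R_*(A)$ is the $h$-segment connecting the distinct ordinary points $\iota_*(\lambda_1)$ and $\iota_*(\lambda_2)$. (iii) If $\lambda_1\ne\lambda_2$ are real, then $R_*(A)$ is the asymptotically closed $h$-line connecting the distinct asymptotic points $\iota_*(\lambda_1)$ and $\iota_*(\lambda_2)$. (iv) If $\lambda_1$ is non-real and $\lambda_2$ is real, then $R_*(A)$ is the asymptotically closed $h$-half-line from the ordinary point $\iota_*(\lambda_1)$ to the asymptotic point $\iota_*(\lambda_2)$. (v) If $\lambda_1=\lambda_2$ is real, then $R_*(A)=\{\iota_*(\lambda_1)\}$, an asymptotic $h$-point. If $A$ is not normal: (vi) If $\lambda_1$ is non-real and $\lambda_2\in\{\lambda_1,\overline{\lambda_1}\}$, then $R_*(A)$ is an $h$-disk, with $\iota_*(\lambda_1)$ in its interior. (vii) If $\lambda_1,\lambda_2$ are non-real, neither equal nor conjugate, then $R_*(A)$ is a proper $h$-elliptical disk, with $\iota_*(\lambda_1)$ and $\iota_*(\lambda_2)$ in its interior. (viii) If $\lambda_1\ne\lambda_2$ are real, then $R_*(A)$ is an $h$-distance band around the $h$-line connecting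 the distinct asymptotic points $\iota_*(\lambda_1)$ and $\iota_*(\lambda_2)$ (these two points included). (ix) If $\lambda_1$ is non-real and $\lambda_2$ is real, then $R_*(A)$ is an $h$-elliptic parabolic disk with asymptotic point $\iota_*(\lambda_2)$, with $\iota_*(\lambda_1)$ in its interior. (x) If $\lambda_1=\lambda_2$ is real, then $R_*(A)$ is an $h$-horodisk with asymptotic point $\iota_*(\lambda_1)$ (this point included). -/

import Mathlib

open scoped ComplexConjugate

noncomputable section

namespace ConformalRange

/-! ### The asymptotically closed hyperbolic plane (BCK model) and its other models -/

/-- The three models used: Beltrami-Cayley-Klein, parabolic Cayley-Klein, Poincare half-plane. -/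
inductive HModel : Type
  | BCK
  | pCK
  | Ph

/-- The base set of the asymptotically closed hyperbolic plane in each model. For `pCK` and `Ph`
the single ideal point (which corresponds to `(0, 1)` of the BCK model) is left out; it never
belongs to the conformal range of an operator. -/
def baseSet : HModel → Set (ℝ × ℝ)
  | .BCK => {p | p.1 ^ 2 + p.2 ^ 2 ≤ 1}
  | .pCK => {p | p.1 ^ 2 ≤ p.2}
  | .Ph => {p | 0 ≤ p.2}

/-- The canonical transcription from each model to the BCK model. -/
def toBCK : HModel → ℝ × ℝ → ℝ × ℝ
  | .BCK, p => p
  | .pCK, p => (2 * p.1 / (p.2 + 1), (p.2 - 1) / (p.2 + 1))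
  | .Ph, p => (2 * p.1 / (p.1 ^ 2 + p.2 ^ 2 + 1),
      (p.1 ^ 2 + p.2 ^ 2 - 1) / (p.1 ^ 2 + p.2 ^ 2 + 1))

/-- Ordinary `h`-points of the BCK model. -/
def IsOrdinary (p : ℝ × ℝ) : Prop := p.1 ^ 2 + p.2 ^ 2 < 1

/-- Asymptotic `h`-points of the BCK model. -/
def IsAsymptotic (p : ℝ × ℝ) : Prop := p.1 ^ 2 + p.2 ^ 2 = 1

/-- The asymptotically closed hyperbolic plane, in the BCK model, as a type. -/
abbrev HPlane : Type := {p : ℝ × ℝ // p ∈ baseSet .BCK}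

/-- The distance of two ordinary `h`-points in the BCK model. -/
def hDist (p q : ℝ × ℝ) : ℝ :=
  Real.arcosh ((1 - p.1 * q.1 - p.2 * q.2) /
    (√(1 - p.1 ^ 2 - p.2 ^ 2) * √(1 - q.1 ^ 2 - q.2 ^ 2)))

/-- `h`-collineations: restrictions to the base set of projective transformations (given by an
invertible matrix in homogeneous coordinates) which leave the base set invariant. -/
def IsHCollineation (g : Equiv.Perm HPlane) : Prop :=
  ∃ M : Matrix (Fin 3) (Fin 3) ℝ, M.det ≠ 0 ∧
    ∀ p : HPlane, ∃ w : ℝ, w ≠ 0 ∧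
      M.mulVec ![p.1.1, p.1.2, 1] = w • ![(g p).1.1, (g p).1.2, 1]

/-! ### Lineal objects, in the BCK model -/

/-- The intersection with the base set of the line through `P` and `Q`. -/
def closedLine (P Q : ℝ × ℝ) : Set (ℝ × ℝ) :=
  {p | p ∈ affineSpan ℝ {P, Q} ∧ p ∈ baseSet .BCK}

/-- `L` is an asymptotically closed `h`-line: the intersection with the base set of a line
meeting the interior. -/
def IsClosedHLine (L : Set (ℝ × ℝ)) : Prop :=
  ∃ P Q : ℝ × ℝ, IsOrdinary P ∧ P ≠ Q ∧ L = closedLine P Q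

/-- `S` is the asymptotically closed `h`-line connecting the asymptotic points `P ≠ Q`. -/
def IsClosedHLineConnecting (S : Set (ℝ × ℝ)) (P Q : ℝ × ℝ) : Prop :=
  IsAsymptotic P ∧ IsAsymptotic Q ∧ P ≠ Q ∧ S = closedLine P Q

/-- `S` is the `h`-segment connecting the ordinary points `P ≠ Q`. -/
def IsHSegmentConnecting (S : Set (ℝ × ℝ)) (P Q : ℝ × ℝ) : Prop :=
  IsOrdinary P ∧ IsOrdinary Q ∧ P ≠ Q ∧ S = segment ℝ P Q

/-- `S` is the asymptotically closed `h`-half-line from the ordinary point `P` to the asymptotic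
point `Q`: the part in the base set of the ray from `P` through `Q`. -/
def IsClosedHHalfLine (S : Set (ℝ × ℝ)) (P Q : ℝ × ℝ) : Prop :=
  IsOrdinary P ∧ IsAsymptotic Q ∧
    S = {p | (∃ t : ℝ, 0 ≤ t ∧ p = P + t • (Q - P)) ∧ p ∈ baseSet .BCK}

/-! ### Disks of cycles, in the BCK model -/

/-- `S` is an `h`-disk (filled `h`-circle). -/
def IsHDisk (S : Set (ℝ × ℝ)) : Prop :=
  ∃ (P : ℝ × ℝ) (r : ℝ), IsOrdinary P ∧ 0 < r ∧ S = {X | IsOrdinary X ∧ hDist P X ≤ r}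

/-- The group generated by the `h`-collineations whose fixed point set is an asymptotically closed
`h`-line passing through `P₀`. -/
def horocyclicGroup (P₀ : ℝ × ℝ) : Subgroup (Equiv.Perm HPlane) :=
  Subgroup.closure {g | IsHCollineation g ∧
    ∃ L : Set (ℝ × ℝ), IsClosedHLine L ∧ P₀ ∈ L ∧ ∀ p : HPlane, g p = p ↔ p.1 ∈ L}

/-- The `h`-horocycle with asymptotic point `P₀` passing through `E`. -/
def horocycle (P₀ : ℝ × ℝ) (E : HPlane) : Set (ℝ × ℝ) :=
  {X | ∃ g ∈ horocyclicGroup P₀, X = (g E).1}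

/-- `S` is an (asymptotically closed) `h`-horodisk with asymptotic point `P₀`: the convex closure of
an `h`-horocycle, with the asymptotic point added. -/
def IsHHorodisk (S : Set (ℝ × ℝ)) (P₀ : ℝ × ℝ) : Prop :=
  IsAsymptotic P₀ ∧ ∃ E : HPlane, IsOrdinary E.1 ∧
    S = convexHull ℝ (horocycle P₀ E) ∪ {P₀}

/-- The `h`-distance of the ordinary point `X` from the `h`-line connecting `P` and `Q`. -/
def hDistToLine (P Q X : ℝ × ℝ) : ℝ :=
  sInf {d | ∃ Y ∈ affineSpan ℝ {P, Q}, IsOrdinary Y ∧ d = hDist X Y}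

/-- `S` is an (asymptotically closed) `h`-distance band around the `h`-line connecting the
asymptotic points `P ≠ Q`. -/
def IsHDistanceBand (S : Set (ℝ × ℝ)) (P Q : ℝ × ℝ) : Prop :=
  IsAsymptotic P ∧ IsAsymptotic Q ∧ P ≠ Q ∧
    ∃ r : ℝ, 0 < r ∧ S = {X | IsOrdinary X ∧ hDistToLine P Q X ≤ r} ∪ {P, Q}

/-! ### Elliptical disks, in the BCK model -/

/-- `S` is a non-degenerate elliptical disk in the Euclidean sense (circular disks allowed). -/
def IsEllipticalDisk (S : Set (ℝ × ℝ)) : Prop :=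
  ∃ e : (ℝ × ℝ) ≃ᵃ[ℝ] (ℝ × ℝ), S = e '' {p | p.1 ^ 2 + p.2 ^ 2 ≤ 1}

/-- `S` is a proper `h`-elliptical disk: an elliptical disk consisting of ordinary points, but not
an `h`-disk. -/
def IsProperHEllipticalDisk (S : Set (ℝ × ℝ)) : Prop :=
  IsEllipticalDisk S ∧ (∀ p ∈ S, IsOrdinary p) ∧ ¬ IsHDisk S

/-- `S` is an (asymptotically closed) `h`-elliptic parabolic disk with asymptotic point `P₀`: an
elliptical disk in the base set having `P₀` as its only asymptotic point, but not an `h`-horodisk. -/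
def IsHEllipticParabolicDisk (S : Set (ℝ × ℝ)) (P₀ : ℝ × ℝ) : Prop :=
  IsEllipticalDisk S ∧ S ⊆ baseSet .BCK ∧ {p | p ∈ S ∧ IsAsymptotic p} = {P₀} ∧
    ¬ IsHHorodisk S P₀

/-! ### The conformal range -/

/-- The `h`-point `ι^[2](μ)` of a complex number, in each model. -/
def iota : HModel → ℂ → ℝ × ℝ
  | .BCK, μ => (2 * μ.re / (‖μ‖ ^ 2 + 1), (‖μ‖ ^ 2 - 1) / (‖μ‖ ^ 2 + 1))
  | .pCK, μ => (μ.re, ‖μ‖ ^ 2)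
  | .Ph, μ => (μ.re, |μ.im|)

section

variable {H : Type*} [NormedAddCommGroup H] [InnerProductSpace ℂ H]

/-- The conformal range (real Davis-Wielandt shell) of a linear operator, in each model. -/
def conformalRange (A : H →ₗ[ℂ] H) : HModel → Set (ℝ × ℝ)
  | .BCK => {p | ∃ x : H, x ≠ 0 ∧
      p = (2 * (inner ℂ x (A x)).re / (‖A x‖ ^ 2 + ‖x‖ ^ 2),
        (‖A x‖ ^ 2 - ‖x‖ ^ 2) / (‖A x‖ ^ 2 + ‖x‖ ^ 2))}
  | .pCK => {p | ∃ x : H, x ≠ 0 ∧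
      p = ((inner ℂ x (A x)).re / ‖x‖ ^ 2, ‖A x‖ ^ 2 / ‖x‖ ^ 2)}
  | .Ph => {p | ∃ x : H, x ≠ 0 ∧
      p = ((inner ℂ x (A x)).re / ‖x‖ ^ 2,
        √(‖x‖ ^ 2 * ‖A x‖ ^ 2 - (inner ℂ x (A x)).re ^ 2) / ‖x‖ ^ 2)}

end

/-- The five types of a pair of eigenvalues. -/
inductive SpectralType : Type
  | nonrealEqualOrConjugate
  | nonrealGeneric
  | realDistinct
  | nonrealAndReal
  | realDouble

/-- The pair `μ₁, μ₂` is of the given type. -/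
def IsOfType : SpectralType → ℂ → ℂ → Prop
  | .nonrealEqualOrConjugate, μ₁, μ₂ => μ₁.im ≠ 0 ∧ (μ₂ = μ₁ ∨ μ₂ = conj μ₁)
  | .nonrealGeneric, μ₁, μ₂ => μ₁.im ≠ 0 ∧ μ₂.im ≠ 0 ∧ μ₁ ≠ μ₂ ∧ μ₁ ≠ conj μ₂
  | .realDistinct, μ₁, μ₂ => μ₁.im = 0 ∧ μ₂.im = 0 ∧ μ₁ ≠ μ₂
  | .nonrealAndReal, μ₁, μ₂ => μ₁.im ≠ 0 ∧ μ₂.im = 0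
  | .realDouble, μ₁, μ₂ => μ₁.im = 0 ∧ μ₂ = μ₁

open Polynomial in
/-- `A` has spectral type `τ`, with eigenvalues `μ₁, μ₂` (listed with algebraic multiplicity). -/
def HasSpectralType {H : Type*} [NormedAddCommGroup H] [InnerProductSpace ℂ H]
    [FiniteDimensional ℂ H] (A : H →ₗ[ℂ] H) (τ : SpectralType) (μ₁ μ₂ : ℂ) : Prop :=
  LinearMap.charpoly A = (X - C μ₁) * (X - C μ₂) ∧ IsOfType τ μ₁ μ₂

end ConformalRange

end

/-!
The squared norms and the inner product that define the conformal range are three Hermitian forms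
`Re ⟨Ax, x⟩`, `|Ax|²`, `|x|²`. In an orthonormal basis in which `A` is upper triangular, with diagonal
`μ₁`, `μ₂` and off-diagonal entry `t` (`exists_triangular_basis`), they depend linearly on the squared
moduli `p`, `q` of the coordinates of `x` and on a complex number `z` with `|z|² = |t|² p q`
(`attains_iff`); and `A` is normal exactly if `t = 0`.

If `t = 0`, then `z = 0`, and the range consists of the convex combinations of the two eigenpoints:
it is the segment between them (`conformalRange_eq_segment`). As the absolute is strictly convex,
this is the closed half-line or line when one or both of the ends are asymptotic.

If `t ≠ 0`, then for fixed `|x|` the pair `(z, p - q)` runs through an ellipsoid, which is mapped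
affinely onto a region of the plane. So the range is the sublevel set of a quadratic form `rangeForm`
(`mem_conformalRange_BCK_iff_rangeForm`), and asymptotic points of the range come from real
eigenvalues, by the equality case of the Cauchy-Schwarz inequality.

* For equal or conjugate eigenvalues the form lies in the pencil of the absolute and the squared
  polar of the eigenpoint, which describes `h`-disks and `h`-horodisks with that center
  (`rangeForm_nonpos_iff_of_conj`); for two real eigenvalues it lies in the pencil of the absolute
  and the product of the tangents at the eigenpoints, which describes distance bands
  (`rangeForm_nonpos_iff_of_real`).
* If some eigenvalue is not real, the form is negative at its eigenpoint; a quadratic function with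
  a negative value and a bounded sublevel set describes an elliptical disk
  (`isEllipticalDisk_quadFun`).
* Non-real eigenpoints are foci of the range with respect to the absolute: along a line through such
  a point, the discriminant of the form is a fixed multiple of that of the absolute
  (`rangeForm_line`). An `h`-disk or `h`-horodisk has only its center as a focus
  (`center_eq_iota`). Hence the range is not an `h`-disk if there are two distinct ordinary
  eigenpoints, and not an `h`-horodisk if there is an ordinary one.

Distances translate into Lorentz products (`isHDisk_iff`, `hDistToLine_le_iff`). For horodisks one
needs the orbits of the group generated by the collineations fixing exactly an `h`-line through `P₀`.
Such a collineation is given by a matrix fixing the vectors of both ends of the line and preserving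
the tangents there; as it permutes the disk, it is a Lorentz transformation fixing the vector of `P₀`
(`horoRel_of_fixes_line`). Conversely, two points with the same invariants are exchanged by a
single reflection (`exists_mem_horocyclicGroup`).

All this takes place in the `BCK` model. The transcription from the other models is injective on
the base sets and maps range to range and eigenpoint to eigenpoint.
-/

noncomputable section

namespace ConformalRange

/-! ### The three Hermitian forms and triangularization -/

theorem sq_norm_eq (z : ℂ) : ‖z‖ ^ 2 = z.re ^ 2 + z.im ^ 2 := by
  rw [Complex.sq_norm, Complex.normSq_apply]; ring

section Forms

variable {H : Type*} [NormedAddCommGroup H] [InnerProductSpace ℂ H]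

/-- `(u, v, w)` is the triple of the Hermitian forms `Re ⟨Ax, x⟩`, `|Ax|²`, `|x|²` at some nonzero
vector: a point of the conformal range in homogeneous coordinates of the `pCK` model. -/
def Attains (A : H →ₗ[ℂ] H) (u v w : ℝ) : Prop :=
  ∃ x : H, x ≠ 0 ∧ (inner ℂ x (A x)).re = u ∧ ‖A x‖ ^ 2 = v ∧ ‖x‖ ^ 2 = w

theorem sq_norm_sub_smul (x y : H) (c : ℝ) :
    ‖y - (c : ℂ) • x‖ ^ 2 = ‖y‖ ^ 2 - 2 * c * (inner ℂ x y).re + c ^ 2 * ‖x‖ ^ 2 := by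
  have h : (inner ℂ y x).re = (inner ℂ x y).re := by
    rw [← inner_conj_symm, Complex.conj_re]
  rw [@norm_sub_sq ℂ, inner_smul_right, norm_smul, Complex.norm_real, Real.norm_eq_abs, mul_pow,
    sq_abs]
  simp only [RCLike.re_to_complex, Complex.re_ofReal_mul, h]
  ring

theorem Attains.pos {A : H →ₗ[ℂ] H} {u v w : ℝ} (h : Attains A u v w) : 0 < w := by
  obtain ⟨x, hx, -, -, rfl⟩ := h
  have := norm_pos_iff.mpr hx
  positivity

theorem Attains.nonneg {A : H →ₗ[ℂ] H} {u v w : ℝ} (h : Attains A u v w) : 0 ≤ v := by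
  obtain ⟨x, hx, -, rfl, -⟩ := h
  positivity

/-- The Cauchy-Schwarz inequality for the real inner product. -/
theorem Attains.sq_le {A : H →ₗ[ℂ] H} {u v w : ℝ} (h : Attains A u v w) : u ^ 2 ≤ v * w := by
  have hw := h.pos
  obtain ⟨x, hx, rfl, rfl, rfl⟩ := h
  have h1 := sq_norm_sub_smul x (A x) ((inner ℂ x (A x)).re / ‖x‖ ^ 2)
  have h2 : 0 ≤ ‖A x - (((inner ℂ x (A x)).re / ‖x‖ ^ 2 : ℝ) : ℂ) • x‖ ^ 2 := by positivity
  rw [h1] at h2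
  have h3 : ‖A x‖ ^ 2 - 2 * ((inner ℂ x (A x)).re / ‖x‖ ^ 2) * (inner ℂ x (A x)).re +
      ((inner ℂ x (A x)).re / ‖x‖ ^ 2) ^ 2 * ‖x‖ ^ 2 =
      (‖A x‖ ^ 2 * ‖x‖ ^ 2 - (inner ℂ x (A x)).re ^ 2) / ‖x‖ ^ 2 := by
    field_simp; ring
  rw [h3] at h2
  rw [le_div_iff₀ hw] at h2
  linarith

/-- Equality in the Cauchy-Schwarz inequality occurs only at eigenvectors with real eigenvalue. -/
theorem Attains.exists_real_eigenvalue {A : H →ₗ[ℂ] H} {u v w : ℝ} (h : Attains A u v w)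
    (heq : u ^ 2 = v * w) :
    ∃ c : ℝ, Module.End.HasEigenvalue A (c : ℂ) ∧ u = c * w ∧ v = c ^ 2 * w := by
  have hw := h.pos
  obtain ⟨x, hx, rfl, rfl, rfl⟩ := h
  have h1 := sq_norm_sub_smul x (A x) ((inner ℂ x (A x)).re / ‖x‖ ^ 2)
  have h3 : ‖A x‖ ^ 2 - 2 * ((inner ℂ x (A x)).re / ‖x‖ ^ 2) * (inner ℂ x (A x)).re +
      ((inner ℂ x (A x)).re / ‖x‖ ^ 2) ^ 2 * ‖x‖ ^ 2 = 0 := by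
    field_simp; linarith
  rw [h3] at h1
  have h4 : A x = (((inner ℂ x (A x)).re / ‖x‖ ^ 2 : ℝ) : ℂ) • x := by
    rw [← sub_eq_zero]; simpa using h1
  refine ⟨(inner ℂ x (A x)).re / ‖x‖ ^ 2,
    Module.End.hasEigenvalue_of_hasEigenvector ⟨Module.End.mem_eigenspace_iff.mpr h4, hx⟩, ?_, ?_⟩
  · field_simp
  · field_simp
    linarith

theorem Attains.smul {A : H →ₗ[ℂ] H} {u v w : ℝ} (h : Attains A u v w) {c : ℝ} (hc : 0 < c) :
    Attains A (c * u) (c * v) (c * w) := by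
  obtain ⟨x, hx, rfl, rfl, rfl⟩ := h
  refine ⟨((√c : ℝ) : ℂ) • x, ?_, ?_, ?_, ?_⟩
  · simpa [hx] using (Real.sqrt_pos.mpr hc).ne'
  · rw [map_smul, inner_smul_left, inner_smul_right, Complex.conj_ofReal, ← mul_assoc,
      ← Complex.ofReal_mul, Real.mul_self_sqrt hc.le, Complex.re_ofReal_mul]
  · rw [map_smul, norm_smul, mul_pow, Complex.norm_real, Real.norm_eq_abs, sq_abs,
      Real.sq_sqrt hc.le]
  · rw [norm_smul, mul_pow, Complex.norm_real, Real.norm_eq_abs, sq_abs, Real.sq_sqrt hc.le]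

theorem mem_conformalRange_BCK {A : H →ₗ[ℂ] H} {p : ℝ × ℝ} :
    p ∈ conformalRange A .BCK ↔ Attains A p.1 (1 + p.2) (1 - p.2) := by
  constructor
  · rintro ⟨x, hx, rfl⟩
    have hx' := norm_pos_iff.mpr hx
    have h : Attains A _ _ _ := ⟨x, hx, rfl, rfl, rfl⟩
    have hpos : 0 < ‖A x‖ ^ 2 + ‖x‖ ^ 2 := by positivity
    have h' := h.smul (c := 2 / (‖A x‖ ^ 2 + ‖x‖ ^ 2)) (by positivity)
    convert h' using 1
    · field_simp
    · field_simp; ring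
    · field_simp; ring
  · rintro ⟨x, hx, h1, h2, h3⟩
    refine ⟨x, hx, ?_⟩
    rw [h1, h2, h3]
    ext <;> simp <;> ring

/-- In a triangularizing orthonormal basis, the three forms depend on `x` only through the squared
moduli `p`, `q` of its coordinates and through `z`, which is `t` times their cross term. -/
theorem attains_iff {A : H →ₗ[ℂ] H} {μ₁ μ₂ t : ℂ}
    (b : OrthonormalBasis (Fin 2) ℂ H) (h0 : A (b 0) = μ₁ • b 0)
    (h1 : A (b 1) = t • b 0 + μ₂ • b 1) (u v w : ℝ) :
    Attains A u v w ↔ ∃ (p q : ℝ) (z : ℂ), 0 ≤ p ∧ 0 ≤ q ∧ 0 < p + q ∧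
      ‖z‖ ^ 2 = ‖t‖ ^ 2 * (p * q) ∧ u = μ₁.re * p + μ₂.re * q + z.re ∧
      v = ‖μ₁‖ ^ 2 * p + (‖μ₂‖ ^ 2 + ‖t‖ ^ 2) * q + 2 * (conj μ₁ * z).re ∧ w = p + q := by
  have hn : ∀ c d : ℂ, ‖c • b 0 + d • b 1‖ ^ 2 = ‖c‖ ^ 2 + ‖d‖ ^ 2 := by
    intro c d
    rw [← b.sum_sq_norm_inner_right, Fin.sum_univ_two]
    simp [inner_add_right, inner_smul_right, orthonormal_iff_ite.mp b.orthonormal]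
  have hAx : ∀ c d : ℂ, A (c • b 0 + d • b 1) = (μ₁ * c + t * d) • b 0 + (μ₂ * d) • b 1 := by
    intro c d
    rw [map_add, map_smul, map_smul, h0, h1]
    module
  have hi : ∀ c d : ℂ, (inner ℂ (c • b 0 + d • b 1) (A (c • b 0 + d • b 1))) =
      conj c * (μ₁ * c + t * d) + conj d * (μ₂ * d) := by
    intro c d
    rw [hAx]
    simp
    ring
  have main : ∀ c d : ℂ,
      (inner ℂ (c • b 0 + d • b 1) (A (c • b 0 + d • b 1))).re =
        μ₁.re * ‖c‖ ^ 2 + μ₂.re * ‖d‖ ^ 2 + (t * (conj c * d)).re ∧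
      ‖A (c • b 0 + d • b 1)‖ ^ 2 = ‖μ₁‖ ^ 2 * ‖c‖ ^ 2 + (‖μ₂‖ ^ 2 + ‖t‖ ^ 2) * ‖d‖ ^ 2 +
        2 * (conj μ₁ * (t * (conj c * d))).re := by
    intro c d
    constructor
    · rw [hi]; simp [sq_norm_eq]; ring
    · rw [hAx, hn, norm_mul, mul_pow]; simp only [sq_norm_eq]; simp; ring
  constructor
  · rintro ⟨x, hx, hu, hv, hw⟩
    obtain ⟨c, d, rfl⟩ : ∃ c d : ℂ, x = c • b 0 + d • b 1 :=
      ⟨inner ℂ (b 0) x, inner ℂ (b 1) x, by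
        conv_lhs => rw [← b.sum_repr' x, Fin.sum_univ_two]⟩
    refine ⟨‖c‖ ^ 2, ‖d‖ ^ 2, t * (conj c * d), by positivity, by positivity, ?_, ?_, ?_, ?_, ?_⟩
    · rw [← hn]
      have := norm_pos_iff.mpr hx
      positivity
    · simp; ring
    · rw [← hu]; exact (main c d).1
    · rw [← hv]; exact (main c d).2
    · rw [← hw, hn]
  · rintro ⟨p, q, z, hp, hq, hpq, hz, rfl, rfl, rfl⟩
    obtain ⟨c, d, hc, hd, hz'⟩ : ∃ c d : ℂ, ‖c‖ ^ 2 = p ∧ ‖d‖ ^ 2 = q ∧ t * (conj c * d) = z := by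
      by_cases hpz : t = 0 ∨ p = 0
      · have hz0 : z = 0 := by
          have : ‖z‖ ^ 2 = 0 := by rw [hz]; rcases hpz with h | h <;> simp [h]
          simpa using this
        refine ⟨(√p : ℝ), (√q : ℝ), ?_, ?_, ?_⟩
        · simp [Real.sq_sqrt hp]
        · simp [Real.sq_sqrt hq]
        · rcases hpz with h | h <;> simp [h, hz0]
      · push Not at hpz
        have hp' : 0 < p := lt_of_le_of_ne hp (Ne.symm hpz.2)
        have hs : (√p : ℂ) ≠ 0 := by
          exact_mod_cast (Real.sqrt_pos.mpr hp').ne'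
        have ht : ‖t‖ ≠ 0 := by simpa using hpz.1
        refine ⟨(√p : ℝ), z / (t * (√p : ℝ)), ?_, ?_, ?_⟩
        · simp [Real.sq_sqrt hp]
        · have : ‖z / (t * (√p : ℝ))‖ ^ 2 = ‖z‖ ^ 2 / (‖t‖ ^ 2 * p) := by
            simp [div_pow, mul_pow, Real.sq_sqrt hp]
          rw [this, hz]
          field_simp
        · have := hpz.1
          rw [Complex.conj_ofReal]
          field_simp
    have hx2 : ‖c • b 0 + d • b 1‖ ^ 2 = p + q := by rw [hn, hc, hd]
    refine ⟨c • b 0 + d • b 1, ?_, ?_, ?_, hx2⟩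
    · intro h
      rw [h] at hx2
      simp at hx2
      linarith
    · rw [(main c d).1, hc, hd, hz']
    · rw [(main c d).2, hc, hd, hz']

end Forms

section Triangular

variable {H : Type*} [NormedAddCommGroup H] [InnerProductSpace ℂ H] [FiniteDimensional ℂ H]

open Polynomial in
/-- Schur triangularization in dimension two, with the eigenvalues in a prescribed order. -/
theorem exists_triangular_basis (hH : Module.finrank ℂ H = 2) {A : H →ₗ[ℂ] H} {μ₁ μ₂ : ℂ}
    (hA : LinearMap.charpoly A = (X - C μ₁) * (X - C μ₂)) :
    ∃ (b : OrthonormalBasis (Fin 2) ℂ H) (t : ℂ),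
      A (b 0) = μ₁ • b 0 ∧ A (b 1) = t • b 0 + μ₂ • b 1 := by
  have hev : Module.End.HasEigenvalue A μ₁ := by
    rw [Module.End.hasEigenvalue_iff_isRoot_charpoly]
    simp [hA]
  obtain ⟨y, hy⟩ := hev.exists_hasEigenvector
  have hy0 : (‖y‖ : ℂ) ≠ 0 := by simpa using hy.2
  have hnorm : ‖(‖y‖ : ℂ)⁻¹ • y‖ = 1 := by
    rw [norm_smul, norm_inv, Complex.norm_real, norm_norm, inv_mul_cancel₀]
    simpa using hy.2
  have hon : Orthonormal ℂ (({0} : Set (Fin 2)).domRestrict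
      (fun _ : Fin 2 => (‖y‖ : ℂ)⁻¹ • y)) := by
    constructor
    · intro i; exact hnorm
    · intro i j hij
      exact absurd (Subsingleton.elim i j) hij
  obtain ⟨b, hb⟩ := hon.exists_orthonormalBasis_extension_of_card_eq (by simpa using hH)
  have hb0 : b 0 = (‖y‖ : ℂ)⁻¹ • y := hb 0 rfl
  have h0 : A (b 0) = μ₁ • b 0 := by
    rw [hb0, map_smul, hy.apply_eq_smul, smul_comm]
  obtain ⟨t, d, h1⟩ : ∃ t d : ℂ, A (b 1) = t • b 0 + d • b 1 :=
    ⟨inner ℂ (b 0) (A (b 1)), inner ℂ (b 1) (A (b 1)), by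
      conv_lhs => rw [← b.sum_repr' (A (b 1)), Fin.sum_univ_two]⟩
  have hM : LinearMap.toMatrix b.toBasis b.toBasis A = !![μ₁, t; 0, d] := by
    ext i j
    fin_cases i <;> fin_cases j <;>
      simp [LinearMap.toMatrix_apply, h0, h1]
  have hd : d = μ₂ := by
    have h := LinearMap.charpoly_toMatrix A b.toBasis
    rw [hM, hA, Matrix.charpoly_fin_two] at h
    have h' := congrArg (fun p => p.coeff 1) h
    simp only [Matrix.trace_fin_two_of, Matrix.det_fin_two_of] at h'
    have e : (X - C μ₁) * (X - C μ₂) = X ^ 2 - C (μ₁ + μ₂) * X + C (μ₁ * μ₂) := by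
      rw [map_add, map_mul]; ring
    rw [e] at h'
    simpa [coeff_X, coeff_C] using h'
  exact ⟨b, t, h0, hd ▸ h1⟩

theorem isStarNormal_iff_of_triangular {A : H →ₗ[ℂ] H} {μ₁ μ₂ t : ℂ}
    (b : OrthonormalBasis (Fin 2) ℂ H) (h0 : A (b 0) = μ₁ • b 0)
    (h1 : A (b 1) = t • b 0 + μ₂ • b 1) : IsStarNormal A ↔ t = 0 := by
  have hM : LinearMap.toMatrixOrthonormal b A = !![μ₁, t; 0, μ₂] := by
    ext i j
    fin_cases i <;> fin_cases j <;>
      simp [LinearMap.toMatrixOrthonormal, LinearMap.toMatrix_apply, h0, h1]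
  have key : IsStarNormal A ↔
      star !![μ₁, t; 0, μ₂] * !![μ₁, t; 0, μ₂] = !![μ₁, t; 0, μ₂] * star !![μ₁, t; 0, μ₂] := by
    rw [isStarNormal_iff, commute_iff_eq, ← hM, ← map_star, ← map_mul, ← map_mul]
    exact (LinearMap.toMatrixOrthonormal b).injective.eq_iff.symm
  rw [key]
  constructor
  · intro h
    have h00 := congrFun (congrFun h 0) 0
    simp [Matrix.mul_apply, Matrix.star_apply] at h00
    have h' : t * conj t = 0 := by
      linear_combination -h00
    simpa using h'
  · rintro rfl
    ext i j
    fin_cases i <;> fin_cases j <;> simp [Matrix.mul_apply, Matrix.star_apply, mul_comm]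

end Triangular

/-! ### The quadric bounding the conformal range -/

/-- The image of the sphere of radius `w` under a linear map of rank two into the plane, given by
the rows `x` and `y`, is the elliptical disk of the adjugate of the Gram matrix of the rows. -/
theorem exists_sphere_preimage_iff {x₁ x₂ x₃ y₁ y₂ y₃ d₁ d₂ w Δ : ℝ}
    (hΔ : Δ = (x₁ ^ 2 + x₂ ^ 2 + x₃ ^ 2) * (y₁ ^ 2 + y₂ ^ 2 + y₃ ^ 2) -
      (x₁ * y₁ + x₂ * y₂ + x₃ * y₃) ^ 2) (hpos : 0 < Δ) :
    (∃ n₁ n₂ n₃ : ℝ, n₁ ^ 2 + n₂ ^ 2 + n₃ ^ 2 = w ^ 2 ∧ d₁ = x₁ * n₁ + x₂ * n₂ + x₃ * n₃ ∧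
      d₂ = y₁ * n₁ + y₂ * n₂ + y₃ * n₃) ↔
    (y₁ ^ 2 + y₂ ^ 2 + y₃ ^ 2) * d₁ ^ 2 - 2 * (x₁ * y₁ + x₂ * y₂ + x₃ * y₃) * (d₁ * d₂) +
      (x₁ ^ 2 + x₂ ^ 2 + x₃ ^ 2) * d₂ ^ 2 ≤ Δ * w ^ 2 := by
  constructor
  · rintro ⟨n₁, n₂, n₃, hn, rfl, rfl⟩
    -- the difference of the two sides is the square of the triple product of `n`, `x` and `y`
    have : 0 ≤ (n₁ * (x₂ * y₃ - x₃ * y₂) + n₂ * (x₃ * y₁ - x₁ * y₃) +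
      n₃ * (x₁ * y₂ - x₂ * y₁)) ^ 2 := by positivity
    rw [← hn, hΔ]
    linarith
  · intro h
    set E := (y₁ ^ 2 + y₂ ^ 2 + y₃ ^ 2) * d₁ ^ 2 - 2 * (x₁ * y₁ + x₂ * y₂ + x₃ * y₃) * (d₁ * d₂) +
      (x₁ ^ 2 + x₂ ^ 2 + x₃ ^ 2) * d₂ ^ 2 with hE
    -- the shortest preimage is a combination of the rows; a multiple of their cross product
    -- corrects its length
    obtain ⟨σ, hσ⟩ : ∃ σ : ℝ, σ ^ 2 * Δ ^ 2 = Δ * w ^ 2 - E :=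
      ⟨√(Δ * w ^ 2 - E) / Δ, by
        rw [div_pow, Real.sq_sqrt (by linarith)]; field_simp⟩
    obtain ⟨α, hα⟩ : ∃ α : ℝ, α * Δ =
        (y₁ ^ 2 + y₂ ^ 2 + y₃ ^ 2) * d₁ - (x₁ * y₁ + x₂ * y₂ + x₃ * y₃) * d₂ :=
      ⟨_, div_mul_cancel₀ _ hpos.ne'⟩
    obtain ⟨β, hβ⟩ : ∃ β : ℝ, β * Δ =
        (x₁ ^ 2 + x₂ ^ 2 + x₃ ^ 2) * d₂ - (x₁ * y₁ + x₂ * y₂ + x₃ * y₃) * d₁ :=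
      ⟨_, div_mul_cancel₀ _ hpos.ne'⟩
    have e₁ : d₁ = (x₁ ^ 2 + x₂ ^ 2 + x₃ ^ 2) * α + (x₁ * y₁ + x₂ * y₂ + x₃ * y₃) * β := by
      apply mul_right_cancel₀ hpos.ne'
      linear_combination (x₁ ^ 2 + x₂ ^ 2 + x₃ ^ 2) * (-hα) +
        (x₁ * y₁ + x₂ * y₂ + x₃ * y₃) * (-hβ) + d₁ * hΔ
    have e₂ : d₂ = (x₁ * y₁ + x₂ * y₂ + x₃ * y₃) * α + (y₁ ^ 2 + y₂ ^ 2 + y₃ ^ 2) * β := by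
      apply mul_right_cancel₀ hpos.ne'
      linear_combination (y₁ ^ 2 + y₂ ^ 2 + y₃ ^ 2) * (-hβ) +
        (x₁ * y₁ + x₂ * y₂ + x₃ * y₃) * (-hα) + d₂ * hΔ
    have e₃ : E = (α * d₁ + β * d₂) * Δ := by
      rw [hE]; linear_combination -d₁ * hα - d₂ * hβ
    refine ⟨α * x₁ + β * y₁ + σ * (x₂ * y₃ - x₃ * y₂), α * x₂ + β * y₂ + σ * (x₃ * y₁ - x₁ * y₃),
      α * x₃ + β * y₃ + σ * (x₁ * y₂ - x₂ * y₁), ?_, ?_, ?_⟩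
    · apply mul_right_cancel₀ hpos.ne'
      have : (α * x₁ + β * y₁ + σ * (x₂ * y₃ - x₃ * y₂)) ^ 2 +
          (α * x₂ + β * y₂ + σ * (x₃ * y₁ - x₁ * y₃)) ^ 2 +
          (α * x₃ + β * y₃ + σ * (x₁ * y₂ - x₂ * y₁)) ^ 2 = α * d₁ + β * d₂ + σ ^ 2 * Δ := by
        rw [hΔ, e₁, e₂]; ring
      rw [this]
      linear_combination hσ - e₃
    · rw [e₁]; ring
    · rw [e₂]; ring

/-- The quadratic form whose nonpositivity describes the conformal range, in homogeneous
coordinates of the `pCK` model, for the triangular matrix with diagonal `a₁ + i b₁`, `a₂ + i b₂`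
and off-diagonal entry of squared modulus `s`. Up to a factor it is adjoint to the dual form
`P₁ P₂ + s Q*`, where `P₁`, `P₂` are the evaluations at the eigenpoints and `Q*` is the dual of
the absolute. -/
def rangeForm (a₁ b₁ a₂ b₂ s u v w : ℝ) : ℝ :=
  (u * ((a₁ ^ 2 + b₁ ^ 2) - (a₂ ^ 2 + b₂ ^ 2)) - v * (a₁ - a₂) +
    w * (a₁ * (a₂ ^ 2 + b₂ ^ 2) - a₂ * (a₁ ^ 2 + b₁ ^ 2))) ^ 2 +
  s * ((v - 2 * a₁ * u + (a₁ ^ 2 + b₁ ^ 2) * w) * (v - 2 * a₂ * u + (a₂ ^ 2 + b₂ ^ 2) * w)) -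
  s * (s + 2 * ((a₁ - a₂) ^ 2 + b₁ ^ 2 + b₂ ^ 2)) * (v * w - u ^ 2)

/-- For fixed `w` the pairs `(u, v)` are the image of a sphere of radius `w`, with coordinates
`(2 Re z / √s, 2 Im z / √s, p - q)` in the notation of `attains_iff`, under an affine map. -/
theorem exists_bloch_iff {a₁ b₁ a₂ b₂ s u v w : ℝ} (hs : 0 < s) :
    (∃ n₁ n₂ n₃ : ℝ, n₁ ^ 2 + n₂ ^ 2 + n₃ ^ 2 = w ^ 2 ∧
      u - (a₁ + a₂) / 2 * w = √s / 2 * n₁ + 0 * n₂ + (a₁ - a₂) / 2 * n₃ ∧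
      v - ((a₁ ^ 2 + b₁ ^ 2) + (a₂ ^ 2 + b₂ ^ 2) + s) / 2 * w = √s * a₁ * n₁ + √s * b₁ * n₂ +
        ((a₁ ^ 2 + b₁ ^ 2) - (a₂ ^ 2 + b₂ ^ 2) - s) / 2 * n₃) ↔
    rangeForm a₁ b₁ a₂ b₂ s u v w ≤ 0 := by
  obtain ⟨T, hT, rfl⟩ : ∃ T : ℝ, 0 < T ∧ s = T ^ 2 :=
    ⟨√s, Real.sqrt_pos.mpr hs, (Real.sq_sqrt hs.le).symm⟩
  rw [Real.sqrt_sq hT.le]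
  rw [exists_sphere_preimage_iff (w := w) rfl]
  · rw [← sub_nonpos, ← mul_le_mul_iff_right₀ (a := 4) (by norm_num), mul_zero]
    unfold rangeForm
    apply iff_of_eq
    congr 1
    ring
  · -- the squared length of the cross product of the rows
    have h : 0 < (T * b₁ * (a₁ - a₂) / 2) ^ 2 + (T ^ 2 * b₁ / 2) ^ 2 +
        (T / 4 * (b₁ ^ 2 - (a₁ - a₂) ^ 2 - b₂ ^ 2 - T ^ 2)) ^ 2 := by
      rcases eq_or_ne b₁ 0 with rfl | hb
      · have : 0 < T ^ 2 + (a₁ - a₂) ^ 2 + b₂ ^ 2 := by positivity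
        have h2 : (T / 4 * (0 ^ 2 - (a₁ - a₂) ^ 2 - b₂ ^ 2 - T ^ 2)) ^ 2 =
          (T / 4 * (T ^ 2 + (a₁ - a₂) ^ 2 + b₂ ^ 2)) ^ 2 := by ring
        rw [h2]
        positivity
      · have : 0 < (T ^ 2 * b₁ / 2) ^ 2 := by positivity
        positivity
    refine lt_of_lt_of_eq h ?_
    ring

section

variable {H : Type*} [NormedAddCommGroup H] [InnerProductSpace ℂ H]

theorem attains_iff_rangeForm_nonpos {A : H →ₗ[ℂ] H} {μ₁ μ₂ t : ℂ}
    (b : OrthonormalBasis (Fin 2) ℂ H) (h0 : A (b 0) = μ₁ • b 0)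
    (h1 : A (b 1) = t • b 0 + μ₂ • b 1) (ht : t ≠ 0) {u v w : ℝ} (hw : 0 < w) :
    Attains A u v w ↔ rangeForm μ₁.re μ₁.im μ₂.re μ₂.im (‖t‖ ^ 2) u v w ≤ 0 := by
  have hs : 0 < ‖t‖ ^ 2 := by positivity
  rw [attains_iff b h0 h1, ← exists_bloch_iff hs, Real.sqrt_sq (norm_nonneg t), sq_norm_eq μ₁, sq_norm_eq μ₂]
  set T := ‖t‖
  have hT : T ≠ 0 := by simpa [T] using ht
  constructor
  · rintro ⟨p, q, z, hp, hq, -, hz, rfl, rfl, rfl⟩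
    refine ⟨2 * z.re / T, 2 * z.im / T, p - q, ?_, ?_, ?_⟩
    · rw [sq_norm_eq] at hz
      field_simp
      linear_combination 4 * hz
    · field_simp; ring
    · simp; field_simp; ring
  · rintro ⟨n₁, n₂, n₃, hn, hu, hv⟩
    have h3 : n₃ ^ 2 ≤ w ^ 2 := by nlinarith [sq_nonneg n₁, sq_nonneg n₂]
    have h3' := abs_le_of_sq_le_sq' h3 hw.le
    refine ⟨(w + n₃) / 2, (w - n₃) / 2, ⟨T * n₁ / 2, T * n₂ / 2⟩, by linarith, by linarith,
      by linarith, ?_, ?_, ?_, by ring⟩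
    · rw [sq_norm_eq]; linear_combination T ^ 2 / 4 * hn
    · linear_combination hu
    · simp
      linear_combination hv

theorem mem_conformalRange_BCK_iff_rangeForm {A : H →ₗ[ℂ] H} {μ₁ μ₂ t : ℂ}
    (b : OrthonormalBasis (Fin 2) ℂ H) (h0 : A (b 0) = μ₁ • b 0)
    (h1 : A (b 1) = t • b 0 + μ₂ • b 1) (ht : t ≠ 0) {p : ℝ × ℝ} :
    p ∈ conformalRange A .BCK ↔
      rangeForm μ₁.re μ₁.im μ₂.re μ₂.im (‖t‖ ^ 2) p.1 (1 + p.2) (1 - p.2) ≤ 0 := by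
  rw [mem_conformalRange_BCK]
  rcases lt_trichotomy 0 (1 - p.2) with hw | hw | hw
  · exact attains_iff_rangeForm_nonpos b h0 h1 ht hw
  · have hs : 0 < ‖t‖ ^ 2 := by positivity
    refine ⟨fun h => absurd h.pos hw.symm.not_gt, fun h => ?_⟩
    -- only the origin lies over the zero vector, and `(p.1, 2, 0)` is not the origin
    rw [← hw, ← exists_bloch_iff hs] at h
    obtain ⟨n₁, n₂, n₃, hn, -, hv⟩ := h
    have e₁ : n₁ = 0 := by nlinarith [sq_nonneg n₁, sq_nonneg n₂, sq_nonneg n₃]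
    have e₂ : n₂ = 0 := by nlinarith [sq_nonneg n₁, sq_nonneg n₂, sq_nonneg n₃]
    have e₃ : n₃ = 0 := by nlinarith [sq_nonneg n₁, sq_nonneg n₂, sq_nonneg n₃]
    rw [e₁, e₂, e₃] at hv
    linarith
  · refine ⟨fun h => absurd h.pos hw.le.not_gt, fun h => ?_⟩
    have h' : rangeForm μ₁.re μ₁.im μ₂.re μ₂.im (‖t‖ ^ 2) (-p.1) (-(1 + p.2)) (-(1 - p.2)) ≤ 0 := by
      refine le_of_eq_of_le ?_ h
      unfold rangeForm
      ring
    have h2 := ((attains_iff_rangeForm_nonpos b h0 h1 ht (by linarith)).mpr h').nonneg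
    linarith

end

/-! ### Transcription between the models -/

theorem toBCK_injOn (m : HModel) : Set.InjOn (toBCK m) (baseSet m) := by
  rintro ⟨u, v⟩ hp ⟨u', v'⟩ hq h
  cases m with
  | BCK => exact h
  | pCK =>
    simp only [baseSet, Set.mem_ofPred_eq] at hp hq
    simp only [toBCK, Prod.mk.injEq] at h
    have h1 : 0 < v + 1 := by nlinarith [sq_nonneg u]
    have h2 : 0 < v' + 1 := by nlinarith [sq_nonneg u']
    obtain ⟨e1, e2⟩ := h
    rw [div_eq_div_iff h1.ne' h2.ne'] at e1 e2
    have hv : v = v' := by linarith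
    subst hv
    have hu : u = u' := by
      have := mul_right_cancel₀ h1.ne' e1
      linarith
    rw [hu]
  | Ph =>
    simp only [baseSet, Set.mem_ofPred_eq] at hp hq
    simp only [toBCK, Prod.mk.injEq] at h
    have h1 : 0 < u ^ 2 + v ^ 2 + 1 := by positivity
    have h2 : 0 < u' ^ 2 + v' ^ 2 + 1 := by positivity
    obtain ⟨e1, e2⟩ := h
    rw [div_eq_div_iff h1.ne' h2.ne'] at e1 e2
    have hn : u ^ 2 + v ^ 2 = u' ^ 2 + v' ^ 2 := by linarith
    rw [← hn] at e1
    have hu : u = u' := by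
      have := mul_right_cancel₀ h1.ne' e1
      linarith
    subst hu
    have hv : v = v' := (sq_eq_sq₀ hp hq).mp (by linarith)
    rw [hv]

theorem toBCK_iota (m : HModel) (μ : ℂ) : toBCK m (iota m μ) = iota .BCK μ := by
  cases m <;> simp [toBCK, iota, sq_norm_eq]

theorem iota_mem_baseSet (m : HModel) (μ : ℂ) : iota m μ ∈ baseSet m := by
  cases m with
  | BCK =>
    have h : 0 < μ.re ^ 2 + μ.im ^ 2 + 1 := by positivity
    simp only [baseSet, iota, sq_norm_eq, Set.mem_ofPred_eq]
    rw [div_pow, div_pow, ← add_div, div_le_one (by positivity)]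
    nlinarith [sq_nonneg μ.im]
  | pCK =>
    simp only [baseSet, iota, sq_norm_eq, Set.mem_ofPred_eq]
    nlinarith [sq_nonneg μ.im]
  | Ph => exact abs_nonneg μ.im

section

variable {H : Type*} [NormedAddCommGroup H] [InnerProductSpace ℂ H]

theorem conformalRange_subset_baseSet (A : H →ₗ[ℂ] H) (m : HModel) :
    conformalRange A m ⊆ baseSet m := by
  intro p hp
  cases m with
  | BCK =>
    have := (mem_conformalRange_BCK.mp hp).sq_le
    simp only [baseSet, Set.mem_ofPred_eq]
    linarith
  | pCK =>
    obtain ⟨x, hx, rfl⟩ := hp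
    have hx' : 0 < ‖x‖ ^ 2 := pow_pos (norm_pos_iff.mpr hx) 2
    have h := Attains.sq_le (A := A) ⟨x, hx, rfl, rfl, rfl⟩
    simp only [baseSet, Set.mem_ofPred_eq]
    rw [div_pow, div_le_div_iff₀ (by positivity) hx']
    nlinarith
  | Ph =>
    obtain ⟨x, hx, rfl⟩ := hp
    simp only [baseSet, Set.mem_ofPred_eq]
    positivity

theorem toBCK_image_conformalRange (A : H →ₗ[ℂ] H) (m : HModel) :
    toBCK m '' conformalRange A m = conformalRange A .BCK := by
  cases m with
  | BCK =>
    have : toBCK .BCK = id := by ext p <;> rfl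
    rw [this, Set.image_id]
  | pCK =>
    have e : ∀ x : H, x ≠ 0 → toBCK .pCK ((inner ℂ x (A x)).re / ‖x‖ ^ 2, ‖A x‖ ^ 2 / ‖x‖ ^ 2) =
        (2 * (inner ℂ x (A x)).re / (‖A x‖ ^ 2 + ‖x‖ ^ 2),
          (‖A x‖ ^ 2 - ‖x‖ ^ 2) / (‖A x‖ ^ 2 + ‖x‖ ^ 2)) := by
      intro x hx
      have hx' : 0 < ‖x‖ := norm_pos_iff.mpr hx
      simp only [toBCK]
      ext
      · field_simp
      · field_simp
    ext p
    constructor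
    · rintro ⟨-, ⟨x, hx, rfl⟩, rfl⟩
      exact ⟨x, hx, e x hx⟩
    · rintro ⟨x, hx, rfl⟩
      exact ⟨_, ⟨x, hx, rfl⟩, e x hx⟩
  | Ph =>
    have e : ∀ x : H, x ≠ 0 → toBCK .Ph ((inner ℂ x (A x)).re / ‖x‖ ^ 2,
        √(‖x‖ ^ 2 * ‖A x‖ ^ 2 - (inner ℂ x (A x)).re ^ 2) / ‖x‖ ^ 2) =
        (2 * (inner ℂ x (A x)).re / (‖A x‖ ^ 2 + ‖x‖ ^ 2),
          (‖A x‖ ^ 2 - ‖x‖ ^ 2) / (‖A x‖ ^ 2 + ‖x‖ ^ 2)) := by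
      intro x hx
      have hx' : 0 < ‖x‖ := norm_pos_iff.mpr hx
      have h := Attains.sq_le (A := A) ⟨x, hx, rfl, rfl, rfl⟩
      have hn : ((inner ℂ x (A x)).re / ‖x‖ ^ 2) ^ 2 +
          (√(‖x‖ ^ 2 * ‖A x‖ ^ 2 - (inner ℂ x (A x)).re ^ 2) / ‖x‖ ^ 2) ^ 2 =
          ‖A x‖ ^ 2 / ‖x‖ ^ 2 := by
        rw [div_pow, div_pow, Real.sq_sqrt (by linarith)]
        field_simp
        ring
      simp only [toBCK, hn]
      ext
      · field_simp
      · field_simp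
    ext p
    constructor
    · rintro ⟨-, ⟨x, hx, rfl⟩, rfl⟩
      exact ⟨x, hx, e x hx⟩
    · rintro ⟨x, hx, rfl⟩
      exact ⟨_, ⟨x, hx, rfl⟩, e x hx⟩

theorem conformalRange_eq_singleton {A : H →ₗ[ℂ] H} {μ : ℂ}
    (h : conformalRange A .BCK = {iota .BCK μ}) (m : HModel) :
    conformalRange A m = {iota m μ} := by
  rw [← toBCK_image_conformalRange A m, ← toBCK_iota m] at h
  ext p
  constructor
  · intro hp
    have h1 : toBCK m p ∈ ({toBCK m (iota m μ)} : Set (ℝ × ℝ)) := h ▸ Set.mem_image_of_mem _ hp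
    exact toBCK_injOn m (conformalRange_subset_baseSet A m hp) (iota_mem_baseSet m μ) h1
  · rintro rfl
    obtain ⟨q, hq, hqe⟩ : toBCK m (iota m μ) ∈ toBCK m '' conformalRange A m := by
      rw [h]; rfl
    rwa [← toBCK_injOn m (conformalRange_subset_baseSet A m hq) (iota_mem_baseSet m μ) hqe]

/-- An ordinary point is interior to the base set, where `toBCK` is injective, and `toBCK` is
continuous there; hence interiority may be checked in the `BCK` model. -/
theorem iota_mem_interior {A : H →ₗ[ℂ] H} {μ : ℂ} (hμ : μ.im ≠ 0)
    (h : iota .BCK μ ∈ interior (conformalRange A .BCK)) (m : HModel) :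
    iota m μ ∈ interior (conformalRange A m) := by
  have hb : ∀ᶠ p in nhds (iota m μ), p ∈ baseSet m := by
    cases m with
    | BCK =>
      filter_upwards [mem_interior_iff_mem_nhds.mp h] with p hp
      exact conformalRange_subset_baseSet A .BCK hp
    | pCK =>
      have : IsOpen {p : ℝ × ℝ | p.1 ^ 2 < p.2} := isOpen_lt (by fun_prop) (by fun_prop)
      filter_upwards [this.mem_nhds (show μ.re ^ 2 < ‖μ‖ ^ 2 by
        rw [sq_norm_eq]
        have : 0 < μ.im ^ 2 := by positivity
        linarith)] with p hp
      exact le_of_lt hp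
    | Ph =>
      have : IsOpen {p : ℝ × ℝ | 0 < p.2} := isOpen_lt (by fun_prop) (by fun_prop)
      filter_upwards [this.mem_nhds (show 0 < |μ.im| from abs_pos.mpr hμ)] with p hp
      exact le_of_lt hp
  have hc : ContinuousAt (toBCK m) (iota m μ) := by
    cases m with
    | BCK => exact continuousAt_id
    | pCK =>
      have : (iota .pCK μ).2 + 1 ≠ 0 := by
        simp only [iota]; positivity
      unfold toBCK
      fun_prop (disch := assumption)
    | Ph =>
      have : (iota .Ph μ).1 ^ 2 + (iota .Ph μ).2 ^ 2 + 1 ≠ 0 := by positivity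
      unfold toBCK
      fun_prop (disch := assumption)
  rw [mem_interior_iff_mem_nhds] at h ⊢
  rw [← toBCK_iota m] at h
  filter_upwards [hb, hc.eventually_mem h] with p hp1 hp2
  rw [← toBCK_image_conformalRange A m] at hp2
  obtain ⟨q, hq, hqp⟩ := hp2
  rwa [← toBCK_injOn m (conformalRange_subset_baseSet A m hq) hp1 hqp]

end

theorem isOrdinary_iota {μ : ℂ} (h : μ.im ≠ 0) : IsOrdinary (iota .BCK μ) := by
  have h1 : 0 < μ.re ^ 2 + μ.im ^ 2 + 1 := by positivity
  have h2 : 0 < μ.im ^ 2 := by positivity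
  simp only [IsOrdinary, iota, sq_norm_eq]
  rw [div_pow, div_pow, ← add_div, div_lt_one (by positivity)]
  nlinarith

theorem isAsymptotic_iota {μ : ℂ} (h : μ.im = 0) : IsAsymptotic (iota .BCK μ) := by
  have h1 : 0 < μ.re ^ 2 + 1 := by positivity
  simp only [IsAsymptotic, iota, sq_norm_eq, h]
  field_simp
  ring

theorem iota_BCK_eq_iff {μ ν : ℂ} : iota .BCK μ = iota .BCK ν ↔ μ = ν ∨ μ = conj ν := by
  rw [← toBCK_iota .Ph μ, ← toBCK_iota .Ph ν,
    (toBCK_injOn .Ph).eq_iff (iota_mem_baseSet _ _) (iota_mem_baseSet _ _)]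
  simp only [iota, Prod.mk.injEq, Complex.ext_iff, Complex.conj_re, Complex.conj_im, abs_eq_abs]
  tauto

/-! ### Elliptical disks as sublevel sets of quadratic functions -/

/-- The quadratic function on the plane with the given coefficients. -/
def quadFun (A B C D E F : ℝ) (p : ℝ × ℝ) : ℝ :=
  A * p.1 ^ 2 + 2 * B * (p.1 * p.2) + C * p.2 ^ 2 + 2 * D * p.1 + 2 * E * p.2 + F

/-- If the sublevel set contains an interior point, boundedness makes the leading part positive:
in a direction where it is not, the function stays negative on a half-line. -/
theorem quadFun_leading_pos {A B C D E F : ℝ} {p : ℝ × ℝ} (hp : quadFun A B C D E F p < 0)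
    (hb : ∀ q, quadFun A B C D E F q ≤ 0 → q.1 ^ 2 + q.2 ^ 2 ≤ 1) {x y : ℝ}
    (hd : 0 < x ^ 2 + y ^ 2) : 0 < A * x ^ 2 + 2 * B * (x * y) + C * y ^ 2 := by
  by_contra! hneg
  obtain ⟨x', y', hd', hneg', hlin⟩ : ∃ x' y' : ℝ, 0 < x' ^ 2 + y' ^ 2 ∧
      A * x' ^ 2 + 2 * B * (x' * y') + C * y' ^ 2 ≤ 0 ∧
      A * p.1 * x' + B * (p.1 * y' + p.2 * x') + C * p.2 * y' + D * x' + E * y' ≤ 0 := by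
    rcases le_total (A * p.1 * x + B * (p.1 * y + p.2 * x) + C * p.2 * y + D * x + E * y) 0
      with h | h
    · exact ⟨x, y, hd, hneg, h⟩
    · exact ⟨-x, -y, by linarith, by linarith, by linarith⟩
  set s := √(5 / (x' ^ 2 + y' ^ 2)) with hs
  have hs0 : 0 ≤ s := Real.sqrt_nonneg _
  have hs2 : s ^ 2 * (x' ^ 2 + y' ^ 2) = 5 := by
    rw [hs, Real.sq_sqrt (by positivity)]; field_simp
  have h1 := hb p hp.le
  have h2 := hb (p.1 + s * x', p.2 + s * y') (by
    have e : quadFun A B C D E F (p.1 + s * x', p.2 + s * y') = quadFun A B C D E F p +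
      2 * (s * (A * p.1 * x' + B * (p.1 * y' + p.2 * x') + C * p.2 * y' + D * x' + E * y')) +
      s ^ 2 * (A * x' ^ 2 + 2 * B * (x' * y') + C * y' ^ 2) := by
      simp only [quadFun]; ring
    rw [e]
    have := mul_nonpos_of_nonneg_of_nonpos hs0 hlin
    have := mul_nonpos_of_nonneg_of_nonpos (sq_nonneg s) hneg'
    linarith)
  simp only at h2
  -- two points of the unit disk at distance greater than two
  nlinarith [sq_nonneg (2 * p.1 + s * x'), sq_nonneg (2 * p.2 + s * y')]

theorem isEllipticalDisk_quadFun {A B C D E F : ℝ} {p : ℝ × ℝ} (hp : quadFun A B C D E F p < 0)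
    (hb : ∀ q, quadFun A B C D E F q ≤ 0 → q.1 ^ 2 + q.2 ^ 2 ≤ 1) :
    IsEllipticalDisk {q | quadFun A B C D E F q ≤ 0} := by
  have hA : 0 < A := by
    have := quadFun_leading_pos hp hb (x := 1) (y := 0) (by norm_num)
    linarith
  have hdet : 0 < A * C - B ^ 2 := by
    have := quadFun_leading_pos hp hb (x := -B) (y := A) (by positivity)
    have h2 : 0 < A * (A * C - B ^ 2) := by linarith
    exact (mul_pos_iff_of_pos_left hA).mp h2
  -- the center `m` of the ellipse, and minus the value there
  obtain ⟨m₁, hm₁⟩ : ∃ m₁, m₁ * (A * C - B ^ 2) = B * E - C * D :=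
    ⟨_, div_mul_cancel₀ _ hdet.ne'⟩
  obtain ⟨m₂, hm₂⟩ : ∃ m₂, m₂ * (A * C - B ^ 2) = B * D - A * E :=
    ⟨_, div_mul_cancel₀ _ hdet.ne'⟩
  have c1 : A * m₁ + B * m₂ = -D := by
    apply mul_right_cancel₀ hdet.ne'
    linear_combination A * hm₁ + B * hm₂
  have c2 : B * m₁ + C * m₂ = -E := by
    apply mul_right_cancel₀ hdet.ne'
    linear_combination B * hm₁ + C * hm₂
  set κ := -quadFun A B C D E F (m₁, m₂) with hκ
  have key : ∀ q : ℝ × ℝ, quadFun A B C D E F q = A * (q.1 - m₁) ^ 2 +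
      2 * B * ((q.1 - m₁) * (q.2 - m₂)) + C * (q.2 - m₂) ^ 2 - κ := by
    intro q
    rw [hκ]
    simp only [quadFun]
    linear_combination (2 * (q.1 - m₁)) * c1 + (2 * (q.2 - m₂)) * c2
  have hκ0 : 0 < κ := by
    have h1 : 0 ≤ A * (A * (p.1 - m₁) ^ 2 + 2 * B * ((p.1 - m₁) * (p.2 - m₂)) +
        C * (p.2 - m₂) ^ 2) := by
      have : 0 ≤ (A * (p.1 - m₁) + B * (p.2 - m₂)) ^ 2 + (A * C - B ^ 2) * (p.2 - m₂) ^ 2 := by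
        positivity
      linarith
    have h2 := nonneg_of_mul_nonneg_right h1 hA
    have := key p
    linarith
  obtain ⟨α, hα, hα2⟩ : ∃ α : ℝ, 0 < α ∧ A * α ^ 2 = κ :=
    ⟨√(κ / A), Real.sqrt_pos.mpr (by positivity), by
      rw [Real.sq_sqrt (by positivity)]; field_simp⟩
  obtain ⟨γ, hγ, hγ2⟩ : ∃ γ : ℝ, 0 < γ ∧ (A * C - B ^ 2) * γ ^ 2 = κ * A :=
    ⟨√(κ * A / (A * C - B ^ 2)), Real.sqrt_pos.mpr (by positivity), by
      rw [Real.sq_sqrt (by positivity)]; field_simp⟩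
  set β := -(B * γ / A) with hβ
  have hβA : A * β = -(B * γ) := by rw [hβ]; field_simp
  let L : (ℝ × ℝ) ≃ₗ[ℝ] (ℝ × ℝ) :=
    { toFun := fun z => (α * z.1 + β * z.2, γ * z.2)
      map_add' := by intro x y; ext <;> simp <;> ring
      map_smul' := by intro c x; ext <;> simp <;> ring
      invFun := fun z => ((z.1 - β * (z.2 / γ)) / α, z.2 / γ)
      left_inv := by intro z; ext <;> simp <;> field_simp; ring
      right_inv := by intro z; ext <;> simp <;> field_simp; ring }
  have hval : ∀ z : ℝ × ℝ, quadFun A B C D E F ((m₁, m₂) + L z) =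
      κ * (z.1 ^ 2 + z.2 ^ 2 - 1) := by
    intro z
    rw [key]
    have : ((m₁, m₂) + L z).1 - m₁ = α * z.1 + β * z.2 := by simp [L]
    rw [this]
    have : ((m₁, m₂) + L z).2 - m₂ = γ * z.2 := by simp [L]
    rw [this]
    have h3 : A * β ^ 2 + 2 * B * (β * γ) + C * γ ^ 2 = κ := by
      apply mul_left_cancel₀ hA.ne'
      linear_combination (A * β + B * γ) * hβA + hγ2
    linear_combination z.1 ^ 2 * hα2 + (2 * α * z.1 * z.2) * hβA + z.2 ^ 2 * h3
  refine ⟨L.toAffineEquiv.trans (AffineEquiv.constVAdd ℝ (ℝ × ℝ) (m₁, m₂)), ?_⟩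
  ext q
  simp only [Set.mem_ofPred_eq, Set.mem_image, AffineEquiv.trans_apply,
    LinearEquiv.coe_toAffineEquiv, AffineEquiv.constVAdd_apply, vadd_eq_add]
  constructor
  · intro hq
    refine ⟨L.symm (q - (m₁, m₂)), ?_, by simp⟩
    have h := hval (L.symm (q - (m₁, m₂)))
    rw [LinearEquiv.apply_symm_apply, add_sub_cancel] at h
    rw [h] at hq
    have := nonpos_of_mul_nonpos_right hq hκ0
    linarith
  · rintro ⟨z, hz, rfl⟩
    rw [hval]
    exact mul_nonpos_of_nonneg_of_nonpos hκ0.le (by linarith)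

/-- A quadratic polynomial in one variable with two real zeros is determined by its sublevel set
up to a positive factor. -/
theorem exists_eq_smul_of_sublevel_eq {a b c a' b' c' : ℝ} (ha : 0 < a) (ha' : 0 < a')
    (hc : c < 0) (h : ∀ s : ℝ, a * s ^ 2 + 2 * b * s + c ≤ 0 ↔ a' * s ^ 2 + 2 * b' * s + c' ≤ 0) :
    ∃ k : ℝ, 0 < k ∧ a' = k * a ∧ b' = k * b ∧ c' = k * c := by
  -- the sublevel set is the interval between the two zeros
  have roots : ∀ {a b c : ℝ}, 0 < a → c ≤ 0 → ∃ x y : ℝ, x ≤ y ∧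
      ∀ s, a * s ^ 2 + 2 * b * s + c = a * ((s - x) * (s - y)) := by
    intro a b c ha hc
    have hd : 0 ≤ b ^ 2 - a * c := by nlinarith [sq_nonneg b]
    refine ⟨(-b - √(b ^ 2 - a * c)) / a, (-b + √(b ^ 2 - a * c)) / a, ?_, fun s => ?_⟩
    · have := Real.sqrt_nonneg (b ^ 2 - a * c)
      gcongr
      linarith
    · have := Real.sq_sqrt hd
      field_simp
      linear_combination this
  have sub : ∀ {a x y : ℝ}, 0 < a → x ≤ y → ∀ s, a * ((s - x) * (s - y)) ≤ 0 ↔ x ≤ s ∧ s ≤ y := by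
    intro a x y ha hxy s
    constructor
    · intro h
      have h' := nonpos_of_mul_nonpos_right h ha
      constructor <;> nlinarith
    · rintro ⟨h1, h2⟩
      have := mul_nonneg (sub_nonneg.mpr h1) (sub_nonneg.mpr h2)
      exact mul_nonpos_of_nonneg_of_nonpos ha.le (by linarith)
  have hc' : c' ≤ 0 := by simpa using (h 0).mp (by simpa using hc.le)
  obtain ⟨x, y, hxy, e⟩ := roots (b := b) ha hc.le
  obtain ⟨x', y', hxy', e'⟩ := roots (b := b') ha' hc'
  have h' : ∀ s, (x ≤ s ∧ s ≤ y) ↔ (x' ≤ s ∧ s ≤ y') := by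
    intro s
    rw [← sub ha hxy, ← sub ha' hxy', ← e, ← e', h]
  have hx : x = x' := le_antisymm ((h' x').mpr ⟨le_rfl, hxy'⟩).1 ((h' x).mp ⟨le_rfl, hxy⟩).1
  have hy : y = y' := le_antisymm ((h' y).mp ⟨hxy, le_rfl⟩).2 ((h' y').mpr ⟨hxy', le_rfl⟩).2
  subst hx hy
  have e0 := e 0
  have e1 := e 1
  have e0' := e' 0
  have e1' := e' 1
  refine ⟨a' / a, by positivity, by field_simp, ?_, ?_⟩ <;> field_simp <;> nlinarith

/-! ### The conformal range as an elliptical disk, and its foci -/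

theorem rangeForm_eq_quadFun (a₁ b₁ a₂ b₂ s : ℝ) : ∃ A B C D E F : ℝ, ∀ p : ℝ × ℝ,
    rangeForm a₁ b₁ a₂ b₂ s p.1 (1 + p.2) (1 - p.2) = quadFun A B C D E F p := by
  let f : ℝ → ℝ → ℝ := fun x y => rangeForm a₁ b₁ a₂ b₂ s x (1 + y) (1 - y)
  refine ⟨(f 1 0 + f (-1) 0) / 2 - f 0 0, (f 1 1 - f 1 0 - f 0 1 + f 0 0) / 2,
    (f 0 1 + f 0 (-1)) / 2 - f 0 0, (f 1 0 - f (-1) 0) / 4, (f 0 1 - f 0 (-1)) / 4, f 0 0, ?_⟩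
  intro p
  simp only [f, quadFun, rangeForm]
  ring

/-- At the first eigenpoint the form equals `-s² b₁²`, up to the square of the scaling factor from
homogeneous to `BCK` coordinates. -/
theorem rangeForm_iota_left (μ₁ μ₂ : ℂ) (s : ℝ) :
    rangeForm μ₁.re μ₁.im μ₂.re μ₂.im s (iota .BCK μ₁).1 (1 + (iota .BCK μ₁).2)
      (1 - (iota .BCK μ₁).2) = -(2 * s * μ₁.im / (‖μ₁‖ ^ 2 + 1)) ^ 2 := by
  have h : 0 < μ₁.re ^ 2 + μ₁.im ^ 2 + 1 := by positivity
  simp only [iota, sq_norm_eq, rangeForm]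
  field_simp
  ring

theorem rangeForm_iota_left_neg {μ₁ : ℂ} (μ₂ : ℂ) {s : ℝ} (hμ : μ₁.im ≠ 0) (hs : 0 < s) :
    rangeForm μ₁.re μ₁.im μ₂.re μ₂.im s (iota .BCK μ₁).1 (1 + (iota .BCK μ₁).2)
      (1 - (iota .BCK μ₁).2) < 0 := by
  rw [rangeForm_iota_left]
  have : 2 * s * μ₁.im ≠ 0 := by simp; exact ⟨hs.ne', hμ⟩
  have : 0 < (2 * s * μ₁.im / (‖μ₁‖ ^ 2 + 1)) ^ 2 := by positivity
  linarith

/-- The quadratic polynomial obtained by restricting the form to the line through the first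
eigenpoint `(x, y)` in direction `(d, e)`: its discriminant is, up to a factor independent of the
line, that of the absolute. -/
theorem rangeForm_line {a₁ b₁ a₂ b₂ s l x y : ℝ} (hx : x = l * a₁)
    (hy1 : 1 + y = l * (a₁ ^ 2 + b₁ ^ 2)) (hy2 : 1 - y = l) (d e : ℝ) : ∃ f₁ : ℝ,
    (∀ σ : ℝ, rangeForm a₁ b₁ a₂ b₂ s (x + σ * d) (1 + (y + σ * e)) (1 - (y + σ * e)) =
      rangeForm a₁ b₁ a₂ b₂ s d e (-e) * σ ^ 2 + 2 * f₁ * σ +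
        rangeForm a₁ b₁ a₂ b₂ s x (1 + y) (1 - y)) ∧
    f₁ ^ 2 - rangeForm a₁ b₁ a₂ b₂ s d e (-e) * rangeForm a₁ b₁ a₂ b₂ s x (1 + y) (1 - y) =
      s ^ 2 * ((s + ((a₁ - a₂) ^ 2 + b₁ ^ 2 + b₂ ^ 2)) ^ 2 - 4 * b₁ ^ 2 * b₂ ^ 2) *
        ((x * d + y * e) ^ 2 + (1 - x ^ 2 - y ^ 2) * (d ^ 2 + e ^ 2)) := by
  refine ⟨l * s * (b₁ ^ 2 * (e - 2 * a₂ * d - (a₂ ^ 2 + b₂ ^ 2) * e) -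
      (s + ((a₁ - a₂) ^ 2 + b₁ ^ 2 + b₂ ^ 2)) * (e - 2 * a₁ * d - (a₁ ^ 2 + b₁ ^ 2) * e) / 2),
      ?_, ?_⟩
  · intro σ
    have e1 : 1 + (y + σ * e) = l * (a₁ ^ 2 + b₁ ^ 2) + σ * e := by rw [← hy1]; ring
    have e2 : 1 - (y + σ * e) = l - σ * e := by rw [← hy2]; ring
    rw [e1, e2, hy1, hy2, hx]
    simp only [rangeForm]
    ring
  · have hB : x * d + y * e = -(l * (e - 2 * a₁ * d - (a₁ ^ 2 + b₁ ^ 2) * e) / 2) := by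
      rw [hx]; linear_combination (e / 2) * (hy1 - hy2)
    have hQ : 1 - x ^ 2 - y ^ 2 = l ^ 2 * b₁ ^ 2 := by
      have : 1 - x ^ 2 - y ^ 2 = (1 + y) * (1 - y) - x ^ 2 := by ring
      rw [this, hy1, hy2, hx]; ring
    rw [hB, hQ, hy1, hy2, hx]
    simp only [rangeForm]
    ring

theorem rangeForm_leading_pos {a₁ b₁ a₂ b₂ s : ℝ}
    (hb : ∀ X : ℝ × ℝ, rangeForm a₁ b₁ a₂ b₂ s X.1 (1 + X.2) (1 - X.2) ≤ 0 →
      X.1 ^ 2 + X.2 ^ 2 ≤ 1) {x y : ℝ}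
    (hneg : rangeForm a₁ b₁ a₂ b₂ s x (1 + y) (1 - y) < 0) {d e : ℝ} (hde : d ^ 2 + e ^ 2 = 1) :
    0 < rangeForm a₁ b₁ a₂ b₂ s d e (-e) := by
  obtain ⟨A, B, C, D, E, F, hF⟩ := rangeForm_eq_quadFun a₁ b₁ a₂ b₂ s
  have h1 : quadFun A B C D E F (x, y) < 0 := by rwa [← hF]
  have h2 := quadFun_leading_pos h1 (fun X hX => hb X (by rw [hF]; exact hX)) (x := d) (y := e)
    (by rw [hde]; norm_num)
  have h3 := hF (d, e)
  have h4 := hF (-d, -e)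
  have h5 := hF (0, 0)
  have h6 : rangeForm a₁ b₁ a₂ b₂ s d (1 + e) (1 - e) +
    rangeForm a₁ b₁ a₂ b₂ s (-d) (1 + -e) (1 - -e) -
    2 * rangeForm a₁ b₁ a₂ b₂ s 0 (1 + 0) (1 - 0) = 2 * rangeForm a₁ b₁ a₂ b₂ s d e (-e) := by
    simp only [rangeForm]; ring
  rw [h3, h4, h5] at h6
  have h7 : quadFun A B C D E F (d, e) + quadFun A B C D E F (-d, -e) -
      2 * quadFun A B C D E F (0, 0) = 2 * (A * d ^ 2 + 2 * B * (d * e) + C * e ^ 2) := by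
    simp only [quadFun]; ring
  linarith

/-- A definite binary quadratic form is not proportional to the square of a nonzero linear form. -/
theorem eq_zero_of_sq_eq_mul_definite {W₁ W₂ c k x y Q : ℝ} (hc : 0 < c) (hQ : 0 < Q)
    (h : ∀ d e : ℝ, d ^ 2 + e ^ 2 = 1 →
      c * (W₁ * d + W₂ * e) ^ 2 = k * ((x * d + y * e) ^ 2 + Q)) : W₁ = 0 ∧ W₂ = 0 := by
  by_contra hne
  have hpos : 0 < W₁ ^ 2 + W₂ ^ 2 := by
    rcases not_and_or.mp hne with h | h <;> positivity
  set n := √(W₁ ^ 2 + W₂ ^ 2) with hn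
  have hn0 : 0 < n := Real.sqrt_pos.mpr hpos
  have hn2 : n ^ 2 = W₁ ^ 2 + W₂ ^ 2 := Real.sq_sqrt hpos.le
  have h1 := h (-W₂ / n) (W₁ / n) (by field_simp; linarith)
  have h2 := h (W₁ / n) (W₂ / n) (by field_simp; linarith)
  have h3 : W₁ * (-W₂ / n) + W₂ * (W₁ / n) = 0 := by ring
  have h4 : W₁ * (W₁ / n) + W₂ * (W₂ / n) = n := by field_simp; linarith
  have h5 : k = 0 := by
    have h6 : 0 < (x * (-W₂ / n) + y * (W₁ / n)) ^ 2 + Q := by positivity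
    rw [h3, zero_pow two_ne_zero, mul_zero, eq_comm] at h1
    exact (mul_eq_zero.mp h1).resolve_right h6.ne'
  rw [h4, h5, zero_mul] at h2
  have : 0 < c * n ^ 2 := by positivity
  linarith

/-- The eigenpoints are foci of the conformal range with respect to the absolute: if the range
coincides with an `h`-disk or an `h`-horodisk with center `P`, then `P` is the eigenpoint. The
discriminants of the two quadratic functions along the lines through the eigenpoint `X₁` agree up
to a constant; by `rangeForm_line` this makes the square of the linear form given by
`(1 - |X₁|²) P - (1 - P ⬝ X₁) X₁`, evaluated at the direction of the line, proportional to a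
definite form. -/
theorem center_eq_iota {μ₁ μ₂ : ℂ} {s c : ℝ} {P : ℝ × ℝ} (hμ : μ₁.im ≠ 0) (hs : 0 < s)
    (hc : 0 < c)
    (hb : ∀ X : ℝ × ℝ, rangeForm μ₁.re μ₁.im μ₂.re μ₂.im s X.1 (1 + X.2) (1 - X.2) ≤ 0 →
      X.1 ^ 2 + X.2 ^ 2 ≤ 1)
    (h : ∀ X : ℝ × ℝ, rangeForm μ₁.re μ₁.im μ₂.re μ₂.im s X.1 (1 + X.2) (1 - X.2) ≤ 0 ↔
      (1 - P.1 * X.1 - P.2 * X.2) ^ 2 ≤ c * (1 - X.1 ^ 2 - X.2 ^ 2)) :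
    P = iota .BCK μ₁ := by
  have hord := isOrdinary_iota hμ
  have hneg : rangeForm μ₁.re μ₁.im μ₂.re μ₂.im s (iota .BCK μ₁).1 (1 + (iota .BCK μ₁).2)
      (1 - (iota .BCK μ₁).2) < 0 := rangeForm_iota_left_neg μ₂ hμ hs
  obtain ⟨l, hx, hy1, hy2⟩ : ∃ l : ℝ, (iota .BCK μ₁).1 = l * μ₁.re ∧
      1 + (iota .BCK μ₁).2 = l * (μ₁.re ^ 2 + μ₁.im ^ 2) ∧ 1 - (iota .BCK μ₁).2 = l := by
    have h0 : 0 < μ₁.re ^ 2 + μ₁.im ^ 2 + 1 := by positivity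
    refine ⟨2 / (μ₁.re ^ 2 + μ₁.im ^ 2 + 1), ?_, ?_, ?_⟩ <;>
      simp only [iota, sq_norm_eq] <;> field_simp <;> ring
  generalize iota .BCK μ₁ = X₁ at *
  generalize μ₁.re = a₁ at *
  generalize μ₁.im = b₁ at *
  generalize μ₂.re = a₂ at *
  generalize μ₂.im = b₂ at *
  obtain ⟨x, y⟩ := X₁
  obtain ⟨p, q⟩ := P
  simp only [IsOrdinary] at hord hx hy1 hy2 hneg h
  have hQ : 0 < 1 - x ^ 2 - y ^ 2 := by linarith
  set f₀ := rangeForm a₁ b₁ a₂ b₂ s x (1 + y) (1 - y) with hf₀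
  obtain ⟨M, hM⟩ : ∃ M, M = s ^ 2 *
    ((s + ((a₁ - a₂) ^ 2 + b₁ ^ 2 + b₂ ^ 2)) ^ 2 - 4 * b₁ ^ 2 * b₂ ^ 2) := ⟨_, rfl⟩
  obtain ⟨g₀, hg₀⟩ : ∃ g₀, g₀ = (1 - p * x - q * y) ^ 2 - c * (1 - x ^ 2 - y ^ 2) := ⟨_, rfl⟩
  obtain ⟨L, hL⟩ : ∃ L, L = 1 - p * x - q * y := ⟨_, rfl⟩
  obtain ⟨Q, hQ'⟩ : ∃ Q, Q = 1 - x ^ 2 - y ^ 2 := ⟨_, rfl⟩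
  -- comparison of the two discriminants along the line in direction `(d, e)`
  have key : ∀ d e : ℝ, d ^ 2 + e ^ 2 = 1 →
      c * f₀ ^ 2 * ((Q * p - L * x) * d + (Q * q - L * y) * e) ^ 2 =
      (Q * (M * g₀ ^ 2) - Q * (c ^ 2 * f₀ ^ 2) + c * L ^ 2 * f₀ ^ 2) *
        ((x * d + y * e) ^ 2 + Q) := by
    intro d e hde
    obtain ⟨f₁, hexp, hdisc⟩ := rangeForm_line (a₂ := a₂) (b₂ := b₂) (s := s) hx hy1 hy2 d e
    have hpos := rangeForm_leading_pos hb hneg hde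
    rw [← hf₀, ← hM, hde, mul_one, ← hQ'] at hdisc
    generalize rangeForm a₁ b₁ a₂ b₂ s d e (-e) = f₂ at *
    have hgexp : ∀ σ : ℝ, (1 - p * (x + σ * d) - q * (y + σ * e)) ^ 2 -
        c * (1 - (x + σ * d) ^ 2 - (y + σ * e) ^ 2) = ((p * d + q * e) ^ 2 + c) * σ ^ 2 +
          2 * (-L * (p * d + q * e) + c * (x * d + y * e)) * σ + g₀ := by
      intro σ
      rw [hg₀, hL]
      linear_combination (c * σ ^ 2) * hde
    obtain ⟨k, hk, k₂, k₁, k₀⟩ := exists_eq_smul_of_sublevel_eq hpos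
      (a' := (p * d + q * e) ^ 2 + c) (by positivity) hneg (b := f₁)
      (b' := -L * (p * d + q * e) + c * (x * d + y * e)) (c' := g₀) (by
        intro σ
        rw [← hexp, ← hgexp, sub_nonpos]
        exact h (x + σ * d, y + σ * e))
    have e1 : (-L * (p * d + q * e) + c * (x * d + y * e)) ^ 2 -
        ((p * d + q * e) ^ 2 + c) * g₀ = k ^ 2 * (M * ((x * d + y * e) ^ 2 + Q)) := by
      rw [← hdisc, k₂, k₁, k₀]; ring
    have e2 : g₀ = L ^ 2 - c * Q := by rw [hg₀, hL, hQ']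
    rw [k₀]
    have e3 : k * f₀ = L ^ 2 - c * Q := by rw [← k₀, e2]
    rw [e2] at e1
    linear_combination (Q * f₀ ^ 2) * e1
  obtain ⟨hW1, hW2⟩ := eq_zero_of_sq_eq_mul_definite (c := c * f₀ ^ 2)
    (by have := hneg.ne; positivity) (hQ' ▸ hQ) key
  -- `Q P = L X₁` forces `L = Q`
  have hLQ : L = Q := by
    linear_combination Q * hL - x * hW1 - y * hW2 - L * hQ'
  rw [hLQ] at hW1 hW2
  have hQ0 : Q ≠ 0 := by rw [hQ']; exact hQ.ne'
  ext
  · apply mul_left_cancel₀ hQ0; simp only; linarith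
  · apply mul_left_cancel₀ hQ0; simp only; linarith

/-! ### `h`-disks and `h`-distance bands in terms of the absolute -/

/-- The reverse Cauchy-Schwarz inequality for the Lorentz form, in affine coordinates. -/
theorem lorentz_cauchy_schwarz {p q : ℝ × ℝ} (hp : IsOrdinary p) (hq : q.1 ^ 2 + q.2 ^ 2 ≤ 1) :
    0 < 1 - p.1 * q.1 - p.2 * q.2 ∧
    (1 - p.1 ^ 2 - p.2 ^ 2) * (1 - q.1 ^ 2 - q.2 ^ 2) ≤ (1 - p.1 * q.1 - p.2 * q.2) ^ 2 := by
  unfold IsOrdinary at hp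
  constructor
  · nlinarith [sq_nonneg (p.1 - q.1), sq_nonneg (p.2 - q.2)]
  · have h : (1 - p.1 * q.1 - p.2 * q.2) ^ 2 -
      (1 - p.1 ^ 2 - p.2 ^ 2) * (1 - q.1 ^ 2 - q.2 ^ 2) =
      (p.1 - q.1) ^ 2 + (p.2 - q.2) ^ 2 - (p.1 * q.2 - p.2 * q.1) ^ 2 := by ring
    have h2 : (p.1 * q.2 - p.2 * q.1) ^ 2 = (p.1 * (q.2 - p.2) - p.2 * (q.1 - p.1)) ^ 2 := by ring
    have h3 : (p.1 * (q.2 - p.2) - p.2 * (q.1 - p.1)) ^ 2 ≤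
      (p.1 ^ 2 + p.2 ^ 2) * ((p.1 - q.1) ^ 2 + (p.2 - q.2) ^ 2) := by
      nlinarith [sq_nonneg (p.1 * (q.1 - p.1) + p.2 * (q.2 - p.2))]
    have h4 : (p.1 ^ 2 + p.2 ^ 2) * ((p.1 - q.1) ^ 2 + (p.2 - q.2) ^ 2) ≤
      1 * ((p.1 - q.1) ^ 2 + (p.2 - q.2) ^ 2) :=
      mul_le_mul_of_nonneg_right hp.le (by positivity)
    linarith

theorem hDist_nonneg_and_cosh_sq {p q : ℝ × ℝ} (hp : IsOrdinary p) (hq : IsOrdinary q) : 0 ≤ hDist p q ∧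
    Real.cosh (hDist p q) ^ 2 * ((1 - p.1 ^ 2 - p.2 ^ 2) * (1 - q.1 ^ 2 - q.2 ^ 2)) =
      (1 - p.1 * q.1 - p.2 * q.2) ^ 2 := by
  obtain ⟨h1, h2⟩ := lorentz_cauchy_schwarz hp (le_of_lt hq)
  have hp' : 0 < 1 - p.1 ^ 2 - p.2 ^ 2 := by unfold IsOrdinary at hp; linarith
  have hq' : 0 < 1 - q.1 ^ 2 - q.2 ^ 2 := by unfold IsOrdinary at hq; linarith
  have hd : 0 < √(1 - p.1 ^ 2 - p.2 ^ 2) * √(1 - q.1 ^ 2 - q.2 ^ 2) :=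
    mul_pos (Real.sqrt_pos.mpr hp') (Real.sqrt_pos.mpr hq')
  have h3 : 1 ≤ (1 - p.1 * q.1 - p.2 * q.2) /
      (√(1 - p.1 ^ 2 - p.2 ^ 2) * √(1 - q.1 ^ 2 - q.2 ^ 2)) := by
    rw [one_le_div hd, ← Real.sqrt_mul hp'.le]
    exact Real.sqrt_le_iff.mpr ⟨h1.le, h2⟩
  refine ⟨Real.arcosh_nonneg h3, ?_⟩
  rw [hDist, Real.cosh_arcosh h3, div_pow, mul_pow, Real.sq_sqrt hp'.le, Real.sq_sqrt hq'.le]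
  field_simp

theorem hDist_le_iff {p q : ℝ × ℝ} (hp : IsOrdinary p) (hq : IsOrdinary q) {r : ℝ} (hr : 0 ≤ r) :
    hDist p q ≤ r ↔ (1 - p.1 * q.1 - p.2 * q.2) ^ 2 ≤
      Real.cosh r ^ 2 * ((1 - p.1 ^ 2 - p.2 ^ 2) * (1 - q.1 ^ 2 - q.2 ^ 2)) := by
  obtain ⟨h1, h2⟩ := hDist_nonneg_and_cosh_sq hp hq
  have hp' : 0 < 1 - p.1 ^ 2 - p.2 ^ 2 := by unfold IsOrdinary at hp; linarith
  have hq' : 0 < 1 - q.1 ^ 2 - q.2 ^ 2 := by unfold IsOrdinary at hq; linarith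
  rw [← h2, mul_le_mul_iff_left₀ (by positivity), sq_le_sq₀ (Real.cosh_pos _).le
    (Real.cosh_pos _).le, Real.cosh_le_cosh, abs_of_nonneg h1, abs_of_nonneg hr]

theorem exists_cosh_eq {c : ℝ} (hc : 1 < c) : ∃ r : ℝ, 0 < r ∧ Real.cosh r = c :=
  ⟨Real.arcosh c, Real.arcosh_pos hc, Real.cosh_arcosh hc.le⟩

theorem isOrdinary_of_sq_le {P X : ℝ × ℝ} (hP : IsOrdinary P) {c : ℝ} (hc : 0 < c)
    (h : (1 - P.1 * X.1 - P.2 * X.2) ^ 2 ≤ c * (1 - X.1 ^ 2 - X.2 ^ 2)) : IsOrdinary X := by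
  have h0 : 0 ≤ 1 - X.1 ^ 2 - X.2 ^ 2 :=
    nonneg_of_mul_nonneg_right ((sq_nonneg _).trans h) hc
  have h1 := (lorentz_cauchy_schwarz hP (q := X) (by linarith)).1
  have h2 : 0 < c * (1 - X.1 ^ 2 - X.2 ^ 2) := lt_of_lt_of_le (by positivity) h
  have h3 := (mul_pos_iff_of_pos_left hc).mp h2
  unfold IsOrdinary
  linarith

/-- An `h`-disk is given by a quadratic function in the pencil of the absolute and the squared
polar of the center. -/
theorem isHDisk_iff {S : Set (ℝ × ℝ)} : IsHDisk S ↔ ∃ (P : ℝ × ℝ) (c : ℝ), IsOrdinary P ∧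
    1 - P.1 ^ 2 - P.2 ^ 2 < c ∧
    S = {X | (1 - P.1 * X.1 - P.2 * X.2) ^ 2 ≤ c * (1 - X.1 ^ 2 - X.2 ^ 2)} := by
  constructor
  · rintro ⟨P, r, hP, hr, rfl⟩
    have hP' : 0 < 1 - P.1 ^ 2 - P.2 ^ 2 := by unfold IsOrdinary at hP; linarith
    have hc : 1 < Real.cosh r := Real.one_lt_cosh.mpr hr.ne'
    have hc2 : 1 < Real.cosh r ^ 2 := by nlinarith
    refine ⟨P, Real.cosh r ^ 2 * (1 - P.1 ^ 2 - P.2 ^ 2), hP, by nlinarith, ?_⟩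
    ext X
    simp only [Set.mem_ofPred_eq]
    rw [mul_assoc]
    constructor
    · rintro ⟨hX, h⟩
      exact (hDist_le_iff hP hX hr.le).mp h
    · intro h
      have hX : IsOrdinary X := isOrdinary_of_sq_le hP
        (c := Real.cosh r ^ 2 * (1 - P.1 ^ 2 - P.2 ^ 2)) (mul_pos (by positivity) hP')
        (by rw [mul_assoc]; exact h)
      exact ⟨hX, (hDist_le_iff hP hX hr.le).mpr h⟩
  · rintro ⟨P, c, hP, hc, rfl⟩
    have hP' : 0 < 1 - P.1 ^ 2 - P.2 ^ 2 := by unfold IsOrdinary at hP; linarith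
    obtain ⟨r, hr, hrc⟩ := exists_cosh_eq (c := √(c / (1 - P.1 ^ 2 - P.2 ^ 2)))
      (by rw [Real.lt_sqrt zero_le_one, one_pow, one_lt_div hP']; exact hc)
    have hc2 : Real.cosh r ^ 2 * (1 - P.1 ^ 2 - P.2 ^ 2) = c := by
      rw [hrc, Real.sq_sqrt (div_nonneg (hP'.le.trans hc.le) hP'.le)]
      field_simp
    refine ⟨P, r, hP, hr, ?_⟩
    ext X
    simp only [Set.mem_ofPred_eq]
    constructor
    · intro h
      have hX := isOrdinary_of_sq_le hP (hP'.trans hc) h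
      exact ⟨hX, (hDist_le_iff hP hX hr.le).mpr (by rw [← mul_assoc, hc2]; exact h)⟩
    · rintro ⟨hX, h⟩
      have := (hDist_le_iff hP hX hr.le).mp h
      rwa [← mul_assoc, hc2] at this

theorem mem_affineSpan_pair_iff {P Q Y : ℝ × ℝ} : Y ∈ affineSpan ℝ {P, Q} ↔
    ∃ σ : ℝ, Y = (P.1 + σ * (Q.1 - P.1), P.2 + σ * (Q.2 - P.2)) := by
  rw [mem_affineSpan_pair_iff_exists_lineMap_eq]
  constructor
  · rintro ⟨σ, rfl⟩
    exact ⟨σ, by ext <;> simp [AffineMap.lineMap_apply] <;> ring⟩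
  · rintro ⟨σ, rfl⟩
    exact ⟨σ, by ext <;> simp [AffineMap.lineMap_apply] <;> ring⟩

theorem one_sub_inner_pos_of_asymptotic {P Q : ℝ × ℝ} (hP : IsAsymptotic P) (hQ : IsAsymptotic Q)
    (hPQ : P ≠ Q) : 0 < 1 - P.1 * Q.1 - P.2 * Q.2 := by
  unfold IsAsymptotic at hP hQ
  have h : 2 * (1 - P.1 * Q.1 - P.2 * Q.2) = (P.1 - Q.1) ^ 2 + (P.2 - Q.2) ^ 2 := by
    linear_combination -hP - hQ
  have h2 : 0 < (P.1 - Q.1) ^ 2 + (P.2 - Q.2) ^ 2 := by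
    have : P.1 - Q.1 ≠ 0 ∨ P.2 - Q.2 ≠ 0 := by
      by_contra! hc
      exact hPQ (Prod.ext (sub_eq_zero.mp hc.1) (sub_eq_zero.mp hc.2))
    rcases this with h | h <;> positivity
  linarith

/-- With `P`, `Q` on the absolute, the distance of `X` from the point `(1 - σ) P + σ Q` is given by
`cosh² d = ((1 - σ) a + σ b)² / (2 σ (1 - σ) g (1 - |X|²))`, where `a = 1 - X ⬝ P`, `b = 1 - X ⬝ Q`,
`g = 1 - P ⬝ Q`. By the inequality between arithmetic and geometric means, the minimum over `σ` is
`2 a b / (g (1 - |X|²))`. -/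
theorem hDistToLine_le_iff {P Q X : ℝ × ℝ} (hP : IsAsymptotic P) (hQ : IsAsymptotic Q)
    (hPQ : P ≠ Q) (hX : IsOrdinary X) {r : ℝ} (hr : 0 ≤ r) :
    hDistToLine P Q X ≤ r ↔
      2 * ((1 - X.1 * P.1 - X.2 * P.2) * (1 - X.1 * Q.1 - X.2 * Q.2)) ≤
        Real.cosh r ^ 2 * ((1 - P.1 * Q.1 - P.2 * Q.2) * (1 - X.1 ^ 2 - X.2 ^ 2)) := by
  have hg := one_sub_inner_pos_of_asymptotic hP hQ hPQ
  have ha := (lorentz_cauchy_schwarz hX (le_of_eq hP)).1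
  have hb := (lorentz_cauchy_schwarz hX (le_of_eq hQ)).1
  have hX' : 0 < 1 - X.1 ^ 2 - X.2 ^ 2 := by unfold IsOrdinary at hX; linarith
  obtain ⟨a, ha'⟩ : ∃ a, a = 1 - X.1 * P.1 - X.2 * P.2 := ⟨_, rfl⟩
  obtain ⟨b, hb'⟩ : ∃ b, b = 1 - X.1 * Q.1 - X.2 * Q.2 := ⟨_, rfl⟩
  obtain ⟨g, hg'⟩ : ∃ g, g = 1 - P.1 * Q.1 - P.2 * Q.2 := ⟨_, rfl⟩
  obtain ⟨q, hq'⟩ : ∃ q, q = 1 - X.1 ^ 2 - X.2 ^ 2 := ⟨_, rfl⟩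
  rw [← ha', ← hb', ← hg', ← hq']
  rw [← ha'] at ha
  rw [← hb'] at hb
  rw [← hg'] at hg
  rw [← hq'] at hX'
  have hYn : ∀ σ : ℝ, 1 - (P.1 + σ * (Q.1 - P.1)) ^ 2 - (P.2 + σ * (Q.2 - P.2)) ^ 2 =
      2 * (σ * (1 - σ)) * g := by
    intro σ
    unfold IsAsymptotic at hP hQ
    rw [hg']
    linear_combination -(1 - σ) ^ 2 * hP - σ ^ 2 * hQ
  have hYX : ∀ σ : ℝ, 1 - X.1 * (P.1 + σ * (Q.1 - P.1)) - X.2 * (P.2 + σ * (Q.2 - P.2)) =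
      (1 - σ) * a + σ * b := by
    intro σ; rw [ha', hb']; ring
  -- the foot of the perpendicular
  obtain ⟨σ₀, hσ₀⟩ : ∃ σ₀ : ℝ, σ₀ = a / (a + b) := ⟨_, rfl⟩
  have hσ1 : σ₀ * (1 - σ₀) = a * b / (a + b) ^ 2 := by rw [hσ₀]; field_simp; ring
  have hσ2 : (1 - σ₀) * a + σ₀ * b = 2 * a * b / (a + b) := by rw [hσ₀]; field_simp; ring
  have hfoot : IsOrdinary (P.1 + σ₀ * (Q.1 - P.1), P.2 + σ₀ * (Q.2 - P.2)) := by
    have h := hYn σ₀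
    rw [hσ1] at h
    have : 0 < 2 * (a * b / (a + b) ^ 2) * g := by positivity
    simp only [IsOrdinary]
    linarith
  have hle_foot : ∀ {ρ : ℝ}, 0 ≤ ρ →
      (hDist X (P.1 + σ₀ * (Q.1 - P.1), P.2 + σ₀ * (Q.2 - P.2)) ≤ ρ ↔
        2 * (a * b) ≤ Real.cosh ρ ^ 2 * (g * q)) := by
    intro ρ hρ
    rw [hDist_le_iff hX hfoot hρ]
    simp only
    rw [hYX, hYn, hσ1, hσ2, ← hq']
    have e1 : (2 * a * b / (a + b)) ^ 2 = (2 * a * b / (a + b) ^ 2) * (2 * (a * b)) := by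
      field_simp
    have e2 : Real.cosh ρ ^ 2 * (q * (2 * (a * b / (a + b) ^ 2) * g)) =
      (2 * a * b / (a + b) ^ 2) * (Real.cosh ρ ^ 2 * (g * q)) := by
      field_simp
    rw [e1, e2, mul_le_mul_iff_right₀ (by positivity)]
  have hmin : hDistToLine P Q X =
      hDist X (P.1 + σ₀ * (Q.1 - P.1), P.2 + σ₀ * (Q.2 - P.2)) := by
    apply IsLeast.csInf_eq
    refine ⟨⟨_, mem_affineSpan_pair_iff.mpr ⟨σ₀, rfl⟩, hfoot, rfl⟩, ?_⟩
    rintro d ⟨Y, hY, hYo, rfl⟩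
    obtain ⟨σ, rfl⟩ := mem_affineSpan_pair_iff.mp hY
    rw [hle_foot (hDist_nonneg_and_cosh_sq hX hYo).1]
    have h := (hDist_nonneg_and_cosh_sq hX hYo).2
    simp only at h
    rw [hYX, hYn, ← hq'] at h
    have hσ : 0 < σ * (1 - σ) := by
      have h1 := hYn σ
      simp only [IsOrdinary] at hYo
      have h2 : 0 < g * (σ * (1 - σ)) := by linarith
      exact (mul_pos_iff_of_pos_left hg).mp h2
    have h3 : (2 * (σ * (1 - σ))) * (2 * (a * b)) ≤ (2 * (σ * (1 - σ))) *
        (Real.cosh (hDist X (P.1 + σ * (Q.1 - P.1), P.2 + σ * (Q.2 - P.2))) ^ 2 * (g * q)) := by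
      have h4 : 0 ≤ ((1 - σ) * a - σ * b) ^ 2 := sq_nonneg _
      linarith
    exact (mul_le_mul_iff_right₀ (by positivity)).mp h3
  rw [hmin, hle_foot hr]

theorem isHDistanceBand_of_eq {S : Set (ℝ × ℝ)} {P Q : ℝ × ℝ} (hP : IsAsymptotic P)
    (hQ : IsAsymptotic Q) (hPQ : P ≠ Q) {c : ℝ} (hc : 1 < c)
    (hS : S = {X | 2 * ((1 - X.1 * P.1 - X.2 * P.2) * (1 - X.1 * Q.1 - X.2 * Q.2)) ≤
        c * ((1 - P.1 * Q.1 - P.2 * Q.2) * (1 - X.1 ^ 2 - X.2 ^ 2))})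
    (hsub : S ⊆ baseSet .BCK) : IsHDistanceBand S P Q := by
  have hg := one_sub_inner_pos_of_asymptotic hP hQ hPQ
  obtain ⟨r, hr, hrc⟩ := exists_cosh_eq (c := √c)
    (by rw [Real.lt_sqrt zero_le_one, one_pow]; exact hc)
  have hc2 : Real.cosh r ^ 2 = c := by rw [hrc, Real.sq_sqrt (by linarith)]
  refine ⟨hP, hQ, hPQ, r, hr, ?_⟩
  ext X
  simp only [Set.mem_union, Set.mem_ofPred_eq, Set.mem_insert_iff, Set.mem_singleton_iff]
  constructor
  · intro h
    have hb := hsub h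
    rw [hS] at h
    simp only [baseSet, Set.mem_ofPred_eq] at hb h
    rcases lt_or_eq_of_le hb with hX | hX
    · exact Or.inl ⟨hX, (hDistToLine_le_iff hP hQ hPQ hX hr.le).mpr (hc2 ▸ h)⟩
    · right
      by_contra! hne
      have h1 := one_sub_inner_pos_of_asymptotic hX hP hne.1
      have h2 := one_sub_inner_pos_of_asymptotic hX hQ hne.2
      have h3 : 1 - X.1 ^ 2 - X.2 ^ 2 = 0 := by linarith
      rw [h3] at h
      have := mul_pos h1 h2
      linarith
  · rw [hS]
    unfold IsAsymptotic at hP hQ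
    rintro (⟨hX, h⟩ | rfl | rfl)
    · exact hc2 ▸ (hDistToLine_le_iff hP hQ hPQ hX hr.le).mp h
    · have e1 : 1 - X.1 * X.1 - X.2 * X.2 = 0 := by linarith
      have e2 : 1 - X.1 ^ 2 - X.2 ^ 2 = 0 := by linarith
      simp [e1, e2]
    · have e1 : 1 - X.1 * X.1 - X.2 * X.2 = 0 := by linarith
      have e2 : 1 - X.1 ^ 2 - X.2 ^ 2 = 0 := by linarith
      simp [e1, e2]

/-! ### Reflections in `h`-lines -/

/-- The reflection in the `h`-line `z₁ x + z₂ y = z₃`, for a vector `z` which is spacelike for the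
Lorentz form. It is the Lorentz reflection along `z` in homogeneous coordinates. -/
theorem exists_reflection {z₁ z₂ z₃ N : ℝ} (hN : N = z₁ ^ 2 + z₂ ^ 2 - z₃ ^ 2) (hpos : 0 < N) :
    ∃ g : Equiv.Perm HPlane, IsHCollineation g ∧
      (∀ p : HPlane, g p = p ↔ z₁ * p.1.1 + z₂ * p.1.2 = z₃) ∧
      ∀ (p : HPlane) (s : ℝ), N * s = z₁ * p.1.1 + z₂ * p.1.2 - z₃ → 1 - 2 * s * z₃ ≠ 0 ∧
        (g p).1 = ((p.1.1 - 2 * s * z₁) / (1 - 2 * s * z₃),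
          (p.1.2 - 2 * s * z₂) / (1 - 2 * s * z₃)) := by
  -- the image lies in the closed disk since the reflection preserves the Lorentz form
  have hform : ∀ {x y s : ℝ}, N * s = z₁ * x + z₂ * y - z₃ →
      (1 - 2 * s * z₃) ^ 2 - (x - 2 * s * z₁) ^ 2 - (y - 2 * s * z₂) ^ 2 = 1 - x ^ 2 - y ^ 2 := by
    intro x y s hs
    linear_combination (-4 * s) * hs + 4 * s ^ 2 * hN
  have hne : ∀ {x y s : ℝ}, x ^ 2 + y ^ 2 ≤ 1 → N * s = z₁ * x + z₂ * y - z₃ →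
      1 - 2 * s * z₃ ≠ 0 := by
    intro x y s hxy hs h0
    have h1 := hform hs
    rw [h0] at h1
    have h2 : x = 2 * s * z₁ := by nlinarith [sq_nonneg (y - 2 * s * z₂)]
    have h3 : y = 2 * s * z₂ := by nlinarith [sq_nonneg (x - 2 * s * z₁)]
    have h4 : N * s ^ 2 ≤ 0 := by
      rw [h2, h3] at hxy
      have : (2 * s * z₃) ^ 2 = 1 := by
        rw [show 2 * s * z₃ = 1 by linarith]; norm_num
      rw [hN]; nlinarith
    have h5 : s = 0 := by
      by_contra hs0
      have : 0 < N * s ^ 2 := by positivity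
      linarith
    rw [h5] at h0
    norm_num at h0
  let σ : HPlane → ℝ := fun p => (z₁ * p.1.1 + z₂ * p.1.2 - z₃) / N
  have hσ : ∀ p, N * σ p = z₁ * p.1.1 + z₂ * p.1.2 - z₃ := fun p =>
    mul_div_cancel₀ _ hpos.ne'
  have hd : ∀ p, 1 - 2 * σ p * z₃ ≠ 0 := fun p => hne p.2 (hσ p)
  let f : HPlane → HPlane := fun p =>
    ⟨((p.1.1 - 2 * σ p * z₁) / (1 - 2 * σ p * z₃), (p.1.2 - 2 * σ p * z₂) / (1 - 2 * σ p * z₃)), by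
      have h1 := hform (hσ p)
      have h2 : p.1.1 ^ 2 + p.1.2 ^ 2 ≤ 1 := p.2
      have h3 : 0 < (1 - 2 * σ p * z₃) ^ 2 := by have := hd p; positivity
      simp only [baseSet, Set.mem_ofPred_eq]
      rw [div_pow, div_pow, ← add_div, div_le_one h3]
      linarith⟩
  have hσf : ∀ p, σ (f p) = -σ p / (1 - 2 * σ p * z₃) := by
    intro p
    have h0 := hd p
    apply mul_left_cancel₀ hpos.ne'
    rw [hσ]
    simp only [f]
    field_simp
    linear_combination -hσ p + 2 * σ p * hN
  have hinv : ∀ p, f (f p) = p := by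
    intro p
    have h0 := hd p
    have h1 : 1 - 2 * σ (f p) * z₃ = 1 / (1 - 2 * σ p * z₃) := by
      rw [hσf]; field_simp; ring
    apply Subtype.ext
    ext
    · change ((f p).1.1 - 2 * σ (f p) * z₁) / (1 - 2 * σ (f p) * z₃) = p.1.1
      rw [h1, hσf]
      simp only [f]
      field_simp; ring
    · change ((f p).1.2 - 2 * σ (f p) * z₂) / (1 - 2 * σ (f p) * z₃) = p.1.2
      rw [h1, hσf]
      simp only [f]
      field_simp; ring
  refine ⟨⟨f, f, hinv, hinv⟩, ?_, ?_, ?_⟩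
  · refine ⟨!![1 - 2 * z₁ * z₁ / N, -2 * z₁ * z₂ / N, 2 * z₁ * z₃ / N;
      -2 * z₂ * z₁ / N, 1 - 2 * z₂ * z₂ / N, 2 * z₂ * z₃ / N;
      -2 * z₃ * z₁ / N, -2 * z₃ * z₂ / N, 1 + 2 * z₃ * z₃ / N], ?_, ?_⟩
    · have : (!![1 - 2 * z₁ * z₁ / N, -2 * z₁ * z₂ / N, 2 * z₁ * z₃ / N;
        -2 * z₂ * z₁ / N, 1 - 2 * z₂ * z₂ / N, 2 * z₂ * z₃ / N;
        -2 * z₃ * z₁ / N, -2 * z₃ * z₂ / N, 1 + 2 * z₃ * z₃ / N] :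
          Matrix (Fin 3) (Fin 3) ℝ).det = -1 := by
        rw [Matrix.det_fin_three]
        simp
        field_simp
        rw [hN]
        ring
      rw [this]
      norm_num
    · intro p
      have h0 := hd p
      refine ⟨1 - 2 * σ p * z₃, h0, ?_⟩
      have hs : σ p = (z₁ * p.1.1 + z₂ * p.1.2 - z₃) / N := rfl
      ext i
      fin_cases i
      · simp [Matrix.mulVec, dotProduct, Fin.sum_univ_three, f]
        rw [mul_div_cancel₀ _ h0, hs]; field_simp; ring
      · simp [Matrix.mulVec, dotProduct, Fin.sum_univ_three, f]
        rw [mul_div_cancel₀ _ h0, hs]; field_simp; ring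
      · simp [Matrix.mulVec, dotProduct, Fin.sum_univ_three, f]
        rw [hs]; field_simp; ring
  · intro p
    have h0 := hd p
    constructor
    · intro h
      have h1 : f p = p := h
      have h2 := hσf p
      rw [h1, eq_div_iff h0] at h2
      by_contra hne'
      have hs0 : σ p ≠ 0 := by
        intro hs
        have := hσ p
        rw [hs] at this
        apply hne'
        linarith
      -- otherwise `p` would be the pole `z`, which lies outside the disk
      have h3 : σ p * z₃ = 1 := by
        apply mul_left_cancel₀ hs0
        linarith
      have h4 : 1 - 2 * σ p * z₃ = -1 := by linarith
      have h5 := congrArg (fun q : HPlane => q.1.1) h1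
      have h6 := congrArg (fun q : HPlane => q.1.2) h1
      simp only [f] at h5 h6
      rw [h4] at h5 h6
      have h7 : p.1.1 = σ p * z₁ := by linarith
      have h8 : p.1.2 = σ p * z₂ := by linarith
      have h9 : p.1.1 ^ 2 + p.1.2 ^ 2 ≤ 1 := p.2
      rw [h7, h8] at h9
      have : 0 < N * σ p ^ 2 := by positivity
      have h10 : (σ p * z₃) ^ 2 = 1 := by rw [h3]; norm_num
      rw [hN] at this
      linarith
    · intro h
      have hs : σ p = 0 := by
        simp only [σ]; rw [h]; simp
      apply Subtype.ext
      ext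
      · change (p.1.1 - 2 * σ p * z₁) / (1 - 2 * σ p * z₃) = p.1.1
        rw [hs]; simp
      · change (p.1.2 - 2 * σ p * z₂) / (1 - 2 * σ p * z₃) = p.1.2
        rw [hs]; simp
  · intro p s hs
    have : s = σ p := mul_left_cancel₀ hpos.ne' (hs.trans (hσ p).symm)
    subst this
    exact ⟨hd p, rfl⟩

theorem isClosedHLine_of_spacelike {z₁ z₂ z₃ : ℝ} (h : z₃ ^ 2 < z₁ ^ 2 + z₂ ^ 2) :
    IsClosedHLine {p | z₁ * p.1 + z₂ * p.2 = z₃ ∧ p ∈ baseSet .BCK} := by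
  have hn : 0 < z₁ ^ 2 + z₂ ^ 2 := (sq_nonneg _).trans_lt h
  obtain ⟨c, hc⟩ : ∃ c, c * (z₁ ^ 2 + z₂ ^ 2) = z₃ := ⟨_, div_mul_cancel₀ _ hn.ne'⟩
  refine ⟨(c * z₁, c * z₂), (c * z₁ - z₂, c * z₂ + z₁), ?_, ?_, ?_⟩
  · simp only [IsOrdinary]
    rw [← hc] at h
    have h2 : c ^ 2 * (z₁ ^ 2 + z₂ ^ 2) * (z₁ ^ 2 + z₂ ^ 2) < 1 * (z₁ ^ 2 + z₂ ^ 2) := by linarith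
    have := lt_of_mul_lt_mul_right h2 hn.le
    linarith
  · intro he
    simp only [Prod.mk.injEq] at he
    have h1 : z₂ = 0 := by linarith [he.1]
    have h2 : z₁ = 0 := by linarith [he.2]
    rw [h1, h2] at hn
    norm_num at hn
  · ext p
    simp only [closedLine, Set.mem_ofPred_eq, mem_affineSpan_pair_iff]
    refine and_congr_left fun _ => ?_
    constructor
    · intro hp
      refine ⟨(-z₂ * p.1 + z₁ * p.2) / (z₁ ^ 2 + z₂ ^ 2), ?_⟩
      ext
      · simp only
        field_simp
        linear_combination z₁ * hp - z₁ * hc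
      · simp only
        field_simp
        linear_combination z₂ * hp - z₂ * hc
    · rintro ⟨σ, rfl⟩
      linear_combination hc

/-! ### `h`-horocycles and `h`-horodisks -/

/-- An affine function which is nonnegative on the disk and vanishes at a point of the circle is a
multiple of the one defining the tangent there. -/
theorem affine_eq_of_tangent {α β γ : ℝ} {R : ℝ × ℝ} (hR : IsAsymptotic R)
    (h0 : α + β * R.1 + γ * R.2 = 0)
    (h : ∀ X : ℝ × ℝ, X ∈ baseSet .BCK → 0 ≤ α + β * X.1 + γ * X.2) :
    β = -α * R.1 ∧ γ = -α * R.2 := by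
  unfold IsAsymptotic at hR
  have hsq : β ^ 2 + γ ^ 2 ≤ α ^ 2 := by
    rcases eq_or_ne (β ^ 2 + γ ^ 2) 0 with hz | hz
    · rw [hz]; positivity
    · have hpos : 0 < β ^ 2 + γ ^ 2 := lt_of_le_of_ne (by positivity) hz.symm
      set n := √(β ^ 2 + γ ^ 2) with hn
      have hn0 : 0 < n := Real.sqrt_pos.mpr hpos
      have hn2 : n ^ 2 = β ^ 2 + γ ^ 2 := Real.sq_sqrt hpos.le
      have h1 := h (-β / n, -γ / n) (by
        simp only [baseSet, Set.mem_ofPred_eq]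
        rw [div_pow, div_pow, ← add_div, div_le_one (by positivity)]
        linarith)
      have h2 : α + β * (-β / n) + γ * (-γ / n) = α - n := by
        field_simp
        linarith
      simp only at h1
      rw [h2] at h1
      nlinarith
  have hdet : (β * R.2 - γ * R.1) ^ 2 ≤ 0 := by
    have : (β * R.2 - γ * R.1) ^ 2 = (β ^ 2 + γ ^ 2) * (R.1 ^ 2 + R.2 ^ 2) -
      (β * R.1 + γ * R.2) ^ 2 := by ring
    rw [this, hR, show β * R.1 + γ * R.2 = -α by linarith]
    linarith
  have hdet0 : β * R.2 - γ * R.1 = 0 := by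
    have := le_antisymm hdet (sq_nonneg _)
    simpa using this
  constructor
  · linear_combination -β * hR + R.1 * h0 + R.2 * hdet0
  · linear_combination -γ * hR + R.2 * h0 - R.1 * hdet0

/-- `Y` is the image of `X` under a Lorentz transformation (up to the scalar `ω`) that fixes the
isotropic vector `(P₀, 1)`: this is what the elements of the horocyclic group preserve. -/
def HoroRel (P₀ X Y : ℝ × ℝ) : Prop :=
  ∃ ω : ℝ, ω ≠ 0 ∧ ω * (1 - P₀.1 * Y.1 - P₀.2 * Y.2) = 1 - P₀.1 * X.1 - P₀.2 * X.2 ∧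
    ω ^ 2 * (1 - Y.1 ^ 2 - Y.2 ^ 2) = 1 - X.1 ^ 2 - X.2 ^ 2

/-- The second end of the `h`-line through the ordinary point `P` and the asymptotic point `P₀`. -/
theorem exists_second_end {P₀ P : ℝ × ℝ} (hP₀ : IsAsymptotic P₀) (hP : IsOrdinary P) :
    ∃ (P₁ : ℝ × ℝ) (τ : ℝ), IsAsymptotic P₁ ∧ P₀ ≠ P₁ ∧ τ ≠ 0 ∧ τ ≠ 1 ∧
      P₁.1 = P₀.1 + τ * (P.1 - P₀.1) ∧ P₁.2 = P₀.2 + τ * (P.2 - P₀.2) := by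
  have hBP := (lorentz_cauchy_schwarz hP (le_of_eq hP₀)).1
  unfold IsAsymptotic at hP₀
  unfold IsOrdinary at hP
  have hδ : 0 < (P.1 - P₀.1) ^ 2 + (P.2 - P₀.2) ^ 2 := by
    by_contra! hle
    have h1 : P.1 - P₀.1 = 0 := by
      nlinarith [sq_nonneg (P.1 - P₀.1), sq_nonneg (P.2 - P₀.2)]
    have h2 : P.2 - P₀.2 = 0 := by
      nlinarith [sq_nonneg (P.1 - P₀.1), sq_nonneg (P.2 - P₀.2)]
    rw [sub_eq_zero.mp h1, sub_eq_zero.mp h2] at hP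
    linarith
  obtain ⟨τ, hτ⟩ : ∃ τ, τ * ((P.1 - P₀.1) ^ 2 + (P.2 - P₀.2) ^ 2) =
      2 * (1 - P₀.1 * P.1 - P₀.2 * P.2) := ⟨_, div_mul_cancel₀ _ hδ.ne'⟩
  have hτ0 : τ ≠ 0 := by
    rintro rfl
    linarith
  have hP₁ : (P₀.1 + τ * (P.1 - P₀.1)) ^ 2 + (P₀.2 + τ * (P.2 - P₀.2)) ^ 2 = 1 := by
    linear_combination τ * hτ + (1 - 2 * τ) * hP₀
  refine ⟨(P₀.1 + τ * (P.1 - P₀.1), P₀.2 + τ * (P.2 - P₀.2)), τ, hP₁, ?_, hτ0, ?_, rfl, rfl⟩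
  · intro h
    have h1 := congrArg Prod.fst h
    have h2 := congrArg Prod.snd h
    simp only [left_eq_add, mul_eq_zero, hτ0, false_or] at h1 h2
    rw [h1, h2] at hδ
    norm_num at hδ
  · rintro rfl
    have : P.1 ^ 2 + P.2 ^ 2 = 1 := by rw [← hP₁]; ring
    linarith

/-- The homogeneous coordinates of the image of the point `Y` under a matrix. -/
def affRow (N : Matrix (Fin 3) (Fin 3) ℝ) (i : Fin 3) (Y : ℝ × ℝ) : ℝ :=
  N i 0 * Y.1 + N i 1 * Y.2 + N i 2

/-- The matrix `N` fixes the vector `(R, 1)`. -/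
def FixesVec (N : Matrix (Fin 3) (Fin 3) ℝ) (R : ℝ × ℝ) : Prop :=
  affRow N 0 R = R.1 ∧ affRow N 1 R = R.2 ∧ affRow N 2 R = 1

/-- The permutation `g` is the projective transformation of the disk given by the matrix `N`. -/
def Represents (N : Matrix (Fin 3) (Fin 3) ℝ) (g : Equiv.Perm HPlane) : Prop :=
  ∀ Y : HPlane, affRow N 2 Y.1 ≠ 0 ∧ affRow N 0 Y.1 = affRow N 2 Y.1 * (g Y).1.1 ∧
    affRow N 1 Y.1 = affRow N 2 Y.1 * (g Y).1.2

/-- The matrix of an `h`-collineation fixing an `h`-line pointwise may be scaled so that it fixes the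
vectors representing both ends of the line. -/
theorem exists_normalized_matrix {P₀ : ℝ × ℝ} (hP₀ : IsAsymptotic P₀) {g : Equiv.Perm HPlane}
    (hg : IsHCollineation g) {L : Set (ℝ × ℝ)} (hL : IsClosedHLine L) (hPL : P₀ ∈ L)
    (hfix : ∀ p : HPlane, g p = p ↔ p.1 ∈ L) :
    ∃ (P₁ : ℝ × ℝ) (N : Matrix (Fin 3) (Fin 3) ℝ), IsAsymptotic P₁ ∧ P₀ ≠ P₁ ∧
      FixesVec N P₀ ∧ FixesVec N P₁ ∧ Represents N g := by
  obtain ⟨M, -, hM⟩ := hg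
  obtain ⟨P, P', hP, hPP', rfl⟩ := hL
  obtain ⟨P₁, τ, hP₁, hne, hτ0, hτ1, hP₁1, hP₁2⟩ := exists_second_end hP₀ hP
  have hPmem : P ∈ closedLine P P' := ⟨left_mem_affineSpan_pair ℝ _ _, le_of_lt hP⟩
  have hP₁mem : P₁ ∈ closedLine P P' := by
    refine ⟨?_, le_of_eq hP₁⟩
    obtain ⟨σ, hσ⟩ := mem_affineSpan_pair_iff.mp hPL.1
    have h1 := congrArg Prod.fst hσ
    have h2 := congrArg Prod.snd hσ
    simp only at h1 h2
    refine mem_affineSpan_pair_iff.mpr ⟨σ * (1 - τ), ?_⟩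
    ext
    · simp only; rw [hP₁1]; linear_combination (1 - τ) * h1
    · simp only; rw [hP₁2]; linear_combination (1 - τ) * h2
  have hMc : ∀ p : HPlane, ∃ w : ℝ, w ≠ 0 ∧ affRow M 0 p.1 = w * (g p).1.1 ∧
      affRow M 1 p.1 = w * (g p).1.2 ∧ affRow M 2 p.1 = w := by
    intro p
    obtain ⟨w, hw, h⟩ := hM p
    have h0 := congrFun h 0
    have h1 := congrFun h 1
    have h2 := congrFun h 2
    simp [Matrix.mulVec, dotProduct, Fin.sum_univ_three] at h0 h1 h2
    exact ⟨w, hw, h0, h1, h2⟩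
  have hMfix : ∀ Y : ℝ × ℝ, Y ∈ closedLine P P' → ∃ w : ℝ, w ≠ 0 ∧
      affRow M 0 Y = w * Y.1 ∧ affRow M 1 Y = w * Y.2 ∧ affRow M 2 Y = w := by
    intro Y hY
    obtain ⟨w, hw, h⟩ := hMc ⟨Y, hY.2⟩
    rw [(hfix ⟨Y, hY.2⟩).mpr hY] at h
    exact ⟨w, hw, h⟩
  -- the matrix acts on `P₀`, `P` and `P₁` by the same scalar, as the three points are collinear
  obtain ⟨k, hk, a0, a1, a2⟩ := hMfix P₀ hPL
  obtain ⟨kP, -, b0, b1, b2⟩ := hMfix P hPmem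
  obtain ⟨k₁, -, c0, c1, c2⟩ := hMfix P₁ hP₁mem
  have hline : ∀ i, affRow M i P₁ = (1 - τ) * affRow M i P₀ + τ * affRow M i P := by
    intro i
    simp only [affRow]
    rw [hP₁1, hP₁2]; ring
  rw [hline, a0, b0, hP₁1] at c0
  rw [hline, a1, b1, hP₁2] at c1
  rw [hline, a2, b2] at c2
  have hkk : k₁ = k := by
    by_contra hne'
    have d1 : (1 - τ) * (k₁ - k) * (P.1 - P₀.1) = 0 := by
      linear_combination c0 - P.1 * c2
    have d2 : (1 - τ) * (k₁ - k) * (P.2 - P₀.2) = 0 := by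
      linear_combination c1 - P.2 * c2
    have d0 : (1 - τ) * (k₁ - k) ≠ 0 :=
      mul_ne_zero (sub_ne_zero.mpr hτ1.symm) (sub_ne_zero.mpr hne')
    have d3 := (mul_eq_zero.mp d1).resolve_left d0
    have d4 := (mul_eq_zero.mp d2).resolve_left d0
    rw [d3, mul_zero, add_zero] at hP₁1
    rw [d4, mul_zero, add_zero] at hP₁2
    exact hne (Prod.ext hP₁1.symm hP₁2.symm)
  have hrow : ∀ i Y, affRow (k⁻¹ • M) i Y = k⁻¹ * affRow M i Y := by
    intro i Y
    simp only [affRow, Matrix.smul_apply, smul_eq_mul]; ring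
  refine ⟨P₁, k⁻¹ • M, hP₁, hne, ⟨?_, ?_, ?_⟩, ⟨?_, ?_, ?_⟩, fun Y => ?_⟩
  · rw [hrow, a0]; field_simp
  · rw [hrow, a1]; field_simp
  · rw [hrow, a2]; field_simp
  · rw [hrow, hline, a0, b0, c0, hkk, ← hP₁1]; field_simp
  · rw [hrow, hline, a1, b1, c1, hkk, ← hP₁2]; field_simp
  · rw [hrow, hline, a2, b2, c2, hkk]; field_simp
  · obtain ⟨w, hw, h0, h1, h2⟩ := hMc Y
    rw [hrow, hrow, hrow, h0, h1, h2]
    exact ⟨mul_ne_zero (inv_ne_zero hk) hw, by ring, by ring⟩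

/-- The homogenizing coordinate has no zero on the disk, which is connected. -/
theorem Represents.pos {N : Matrix (Fin 3) (Fin 3) ℝ} {g : Equiv.Perm HPlane}
    (hN : Represents N g) {P₀ : ℝ × ℝ} (hP₀ : IsAsymptotic P₀) (h₀ : FixesVec N P₀)
    (Y : HPlane) : 0 < affRow N 2 Y.1 := by
  -- otherwise the third coordinate vanishes somewhere between `P₀` and `Y`
  by_contra! hle
  have hY : Y.1.1 ^ 2 + Y.1.2 ^ 2 ≤ 1 := Y.2
  unfold IsAsymptotic at hP₀
  have hpos : 0 < 1 - affRow N 2 Y.1 := by linarith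
  obtain ⟨t, ht⟩ : ∃ t, t = 1 / (1 - affRow N 2 Y.1) := ⟨_, rfl⟩
  have ht0 : 0 ≤ t := by rw [ht]; positivity
  have ht1 : 0 ≤ 1 - t := by
    rw [ht, sub_nonneg, div_le_one hpos]; linarith
  have htω : t * (1 - affRow N 2 Y.1) = 1 := by
    rw [ht]; exact div_mul_cancel₀ _ hpos.ne'
  have hZ : (P₀.1 + t * (Y.1.1 - P₀.1), P₀.2 + t * (Y.1.2 - P₀.2)) ∈ baseSet .BCK := by
    simp only [baseSet, Set.mem_ofPred_eq]
    have h1 : 0 ≤ t * (1 - (Y.1.1 ^ 2 + Y.1.2 ^ 2)) := mul_nonneg ht0 (sub_nonneg.mpr hY)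
    have h2 : 0 ≤ t * (1 - t) * ((Y.1.1 - P₀.1) ^ 2 + (Y.1.2 - P₀.2) ^ 2) := by positivity
    have h3 : (P₀.1 + t * (Y.1.1 - P₀.1)) ^ 2 + (P₀.2 + t * (Y.1.2 - P₀.2)) ^ 2 =
        1 - t * (1 - (Y.1.1 ^ 2 + Y.1.2 ^ 2)) -
          t * (1 - t) * ((Y.1.1 - P₀.1) ^ 2 + (Y.1.2 - P₀.2) ^ 2) := by
      linear_combination (1 - t) * hP₀
    linarith
  apply (hN ⟨_, hZ⟩).1
  have h4 : affRow N 2 (P₀.1 + t * (Y.1.1 - P₀.1), P₀.2 + t * (Y.1.2 - P₀.2)) =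
      (1 - t) * affRow N 2 P₀ + t * affRow N 2 Y.1 := by
    simp only [affRow]; ring
  simp only
  rw [h4, h₀.2.2]
  linarith

/-- The tangent of the circle at a fixed point is preserved. -/
theorem Represents.tangent {N : Matrix (Fin 3) (Fin 3) ℝ} {g : Equiv.Perm HPlane}
    (hN : Represents N g) {R : ℝ × ℝ} (hR : IsAsymptotic R) (hfix : FixesVec N R) :
    ∃ κ : ℝ, ∀ Y : ℝ × ℝ, affRow N 2 Y - R.1 * affRow N 0 Y - R.2 * affRow N 1 Y =
      κ * (1 - R.1 * Y.1 - R.2 * Y.2) := by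
  obtain ⟨α, hα⟩ : ∃ α, α = N 2 2 - R.1 * N 0 2 - R.2 * N 1 2 := ⟨_, rfl⟩
  obtain ⟨β, hβ⟩ : ∃ β, β = N 2 0 - R.1 * N 0 0 - R.2 * N 1 0 := ⟨_, rfl⟩
  obtain ⟨γ, hγ⟩ : ∃ γ, γ = N 2 1 - R.1 * N 0 1 - R.2 * N 1 1 := ⟨_, rfl⟩
  have hφ : ∀ Y : ℝ × ℝ, affRow N 2 Y - R.1 * affRow N 0 Y - R.2 * affRow N 1 Y =
      α + β * Y.1 + γ * Y.2 := by
    intro Y; simp only [affRow, hα, hβ, hγ]; ring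
  have hzero : α + β * R.1 + γ * R.2 = 0 := by
    rw [← hφ, hfix.1, hfix.2.1, hfix.2.2]
    unfold IsAsymptotic at hR
    linarith
  obtain ⟨e1, e2⟩ := affine_eq_of_tangent hR hzero (by
    intro Y hY
    obtain ⟨-, h0, h1⟩ := hN ⟨Y, hY⟩
    have hpos := hN.pos hR hfix ⟨Y, hY⟩
    have hZ : (g ⟨Y, hY⟩).1.1 ^ 2 + (g ⟨Y, hY⟩).1.2 ^ 2 ≤ 1 := (g ⟨Y, hY⟩).2
    rw [← hφ, h0, h1]
    simp only at hpos ⊢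
    generalize (g ⟨Y, hY⟩).1 = Z at *
    unfold IsAsymptotic at hR
    have h3 : 0 ≤ 1 - R.1 * Z.1 - R.2 * Z.2 := by
      have h5 := sq_nonneg (R.1 - Z.1)
      have h6 := sq_nonneg (R.2 - Z.2)
      linarith
    have h4 := mul_nonneg hpos.le h3
    linarith)
  refine ⟨α, fun Y => ?_⟩
  rw [hφ, e1, e2]; ring

/-- A linear form on homogeneous coordinates that vanishes at two points is a multiple of the
equation of the line through them. -/
theorem exists_smul_lineEq {P₀ P₁ : ℝ × ℝ} (hne : 0 < (P₀.2 - P₁.2) ^ 2 + (P₁.1 - P₀.1) ^ 2)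
    {E₁ E₂ E₃ : ℝ} (h₀ : E₁ * P₀.1 + E₂ * P₀.2 + E₃ = 0) (h₁ : E₁ * P₁.1 + E₂ * P₁.2 + E₃ = 0) :
    ∃ c : ℝ, E₁ = c * (P₀.2 - P₁.2) ∧ E₂ = c * (P₁.1 - P₀.1) ∧
      E₃ = c * (P₀.1 * P₁.2 - P₀.2 * P₁.1) := by
  obtain ⟨c, hc⟩ : ∃ c, c * ((P₀.2 - P₁.2) ^ 2 + (P₁.1 - P₀.1) ^ 2) =
      E₁ * (P₀.2 - P₁.2) + E₂ * (P₁.1 - P₀.1) := ⟨_, div_mul_cancel₀ _ hne.ne'⟩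
  have f1 : E₁ = c * (P₀.2 - P₁.2) := by
    apply mul_right_cancel₀ hne.ne'
    linear_combination -(P₀.2 - P₁.2) * hc + (P₁.1 - P₀.1) * (h₁ - h₀)
  have f2 : E₂ = c * (P₁.1 - P₀.1) := by
    apply mul_right_cancel₀ hne.ne'
    linear_combination -(P₁.1 - P₀.1) * hc - (P₀.2 - P₁.2) * (h₁ - h₀)
  refine ⟨c, f1, f2, ?_⟩
  rw [f1, f2] at h₀
  linear_combination h₀

/-- The Lorentz form in terms of the tangents at two asymptotic points and the line through them. -/
theorem sq_lineEq {P₀ P₁ : ℝ × ℝ} (hP₀ : IsAsymptotic P₀) (hP₁ : IsAsymptotic P₁) (x y z : ℝ) :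
    ((P₀.2 - P₁.2) * x + (P₁.1 - P₀.1) * y + (P₀.1 * P₁.2 - P₀.2 * P₁.1) * z) ^ 2 =
      2 * (1 - P₀.1 * P₁.1 - P₀.2 * P₁.2) *
        ((z - P₀.1 * x - P₀.2 * y) * (z - P₁.1 * x - P₁.2 * y)) -
      (1 - P₀.1 * P₁.1 - P₀.2 * P₁.2) ^ 2 * (z ^ 2 - x ^ 2 - y ^ 2) := by
  unfold IsAsymptotic at hP₀ hP₁
  linear_combination ((z - P₁.1 * x - P₁.2 * y) ^ 2 -
    (1 - P₁.1 ^ 2 - P₁.2 ^ 2) * (z ^ 2 - x ^ 2 - y ^ 2)) * hP₀ +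
    (z - P₀.1 * x - P₀.2 * y) ^ 2 * hP₁

theorem exists_third_asymptotic (P₀ P₁ : ℝ × ℝ) :
    ∃ Z : ℝ × ℝ, IsAsymptotic Z ∧ P₀ ≠ Z ∧ P₁ ≠ Z := by
  by_contra! h
  have hZ : ∀ Z, IsAsymptotic Z → P₀ = Z ∨ P₁ = Z := fun Z hZ => by
    by_contra! hc
    exact hc.2 (h Z hZ hc.1)
  obtain ⟨a, b⟩ := P₀
  obtain ⟨c, d⟩ := P₁
  have e1 := hZ (1, 0) (by norm_num [IsAsymptotic])
  have e2 := hZ (0, 1) (by norm_num [IsAsymptotic])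
  have e3 := hZ (-1, 0) (by norm_num [IsAsymptotic])
  simp only [Prod.mk.injEq] at e1 e2 e3
  rcases e1 with ⟨_, _⟩ | ⟨_, _⟩ <;> rcases e2 with ⟨_, _⟩ | ⟨_, _⟩ <;>
    rcases e3 with ⟨_, _⟩ | ⟨_, _⟩ <;> linarith

/-- The key step for reflections: a projective transformation of the disk that fixes the points of
an `h`-line through `P₀` pointwise is given by a matrix which, after normalization, preserves
the tangents at both ends of the line; as it maps the disk onto itself, it acts by `± 1` on the
remaining linear form (the equation of the line), hence preserves the Lorentz form. -/
theorem horoRel_of_fixes_line {P₀ : ℝ × ℝ} (hP₀ : IsAsymptotic P₀) {g : Equiv.Perm HPlane}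
    (hg : IsHCollineation g) {L : Set (ℝ × ℝ)} (hL : IsClosedHLine L) (hPL : P₀ ∈ L)
    (hfix : ∀ p : HPlane, g p = p ↔ p.1 ∈ L) (X : HPlane) : HoroRel P₀ X.1 (g X).1 := by
  obtain ⟨P₁, N, hP₁, hne, hf₀, hf₁, hN⟩ := exists_normalized_matrix hP₀ hg hL hPL hfix
  have hD := sq_lineEq hP₀ hP₁
  have hGpos := one_sub_inner_pos_of_asymptotic hP₀ hP₁ hne
  have hDpos : 0 < (P₀.2 - P₁.2) ^ 2 + (P₁.1 - P₀.1) ^ 2 := by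
    unfold IsAsymptotic at hP₀ hP₁
    linarith
  have htan₀ : ∀ Y : ℝ × ℝ, affRow N 2 Y - P₀.1 * affRow N 0 Y - P₀.2 * affRow N 1 Y =
      1 - P₀.1 * Y.1 - P₀.2 * Y.2 := by
    obtain ⟨κ, hκ⟩ := hN.tangent hP₀ hf₀
    have h1 := hκ P₁
    rw [hf₁.1, hf₁.2.1, hf₁.2.2] at h1
    have : κ = 1 := by
      apply mul_right_cancel₀ hGpos.ne'
      linarith
    intro Y; rw [hκ, this, one_mul]
  have htan₁ : ∀ Y : ℝ × ℝ, affRow N 2 Y - P₁.1 * affRow N 0 Y - P₁.2 * affRow N 1 Y =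
      1 - P₁.1 * Y.1 - P₁.2 * Y.2 := by
    obtain ⟨κ, hκ⟩ := hN.tangent hP₁ hf₁
    have h1 := hκ P₀
    rw [hf₀.1, hf₀.2.1, hf₀.2.2] at h1
    have : κ = 1 := by
      apply mul_right_cancel₀ hGpos.ne'
      linarith
    intro Y; rw [hκ, this, one_mul]
  obtain ⟨G, hG⟩ : ∃ G, G = 1 - P₀.1 * P₁.1 - P₀.2 * P₁.2 := ⟨_, rfl⟩
  obtain ⟨D₁, hD₁⟩ : ∃ D₁, D₁ = P₀.2 - P₁.2 := ⟨_, rfl⟩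
  obtain ⟨D₂, hD₂⟩ : ∃ D₂, D₂ = P₁.1 - P₀.1 := ⟨_, rfl⟩
  obtain ⟨D₃, hD₃⟩ : ∃ D₃, D₃ = P₀.1 * P₁.2 - P₀.2 * P₁.1 := ⟨_, rfl⟩
  rw [← hG] at hGpos
  rw [← hD₁, ← hD₂, ← hD₃, ← hG] at hD
  -- the equation `D` of the line is preserved up to a factor `c`
  obtain ⟨c, hc⟩ : ∃ c : ℝ, ∀ Y : ℝ × ℝ, D₁ * affRow N 0 Y + D₂ * affRow N 1 Y +
      D₃ * affRow N 2 Y = c * (D₁ * Y.1 + D₂ * Y.2 + D₃) := by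
    have hE : ∀ Y : ℝ × ℝ, D₁ * affRow N 0 Y + D₂ * affRow N 1 Y + D₃ * affRow N 2 Y =
        (D₁ * N 0 0 + D₂ * N 1 0 + D₃ * N 2 0) * Y.1 +
        (D₁ * N 0 1 + D₂ * N 1 1 + D₃ * N 2 1) * Y.2 +
        (D₁ * N 0 2 + D₂ * N 1 2 + D₃ * N 2 2) := by
      intro Y; simp only [affRow]; ring
    obtain ⟨c, c1, c2, c3⟩ := exists_smul_lineEq hDpos (P₀ := P₀) (P₁ := P₁)
      (by rw [← hE, hf₀.1, hf₀.2.1, hf₀.2.2, hD₁, hD₂, hD₃]; ring)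
      (by rw [← hE, hf₁.1, hf₁.2.1, hf₁.2.2, hD₁, hD₂, hD₃]; ring)
    refine ⟨c, fun Y => ?_⟩
    rw [hE, c1, c2, c3, ← hD₁, ← hD₂, ← hD₃]; ring
  -- the Lorentz form of an image
  have hQ : ∀ Y : HPlane, G ^ 2 * (affRow N 2 Y.1 ^ 2 * (1 - (g Y).1.1 ^ 2 - (g Y).1.2 ^ 2)) =
      G ^ 2 * (1 - Y.1.1 ^ 2 - Y.1.2 ^ 2) +
        (1 - c ^ 2) * (D₁ * Y.1.1 + D₂ * Y.1.2 + D₃) ^ 2 := by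
    intro Y
    have h1 := hD (affRow N 0 Y.1) (affRow N 1 Y.1) (affRow N 2 Y.1)
    have h2 := hD Y.1.1 Y.1.2 1
    rw [htan₀, htan₁, hc, (hN Y).2.1, (hN Y).2.2] at h1
    linear_combination h1 - h2
  -- a point of the circle off the line
  obtain ⟨Z, hZ, hZ₀, hZ₁⟩ := exists_third_asymptotic P₀ P₁
  have hZD : 0 < (D₁ * Z.1 + D₂ * Z.2 + D₃) ^ 2 := by
    have e := hD Z.1 Z.2 1
    have e1 := one_sub_inner_pos_of_asymptotic hP₀ hZ hZ₀
    have e2 := one_sub_inner_pos_of_asymptotic hP₁ hZ hZ₁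
    have e3 : (1:ℝ) ^ 2 - Z.1 ^ 2 - Z.2 ^ 2 = 0 := by
      have : Z.1 ^ 2 + Z.2 ^ 2 = 1 := hZ
      linarith
    rw [e3, mul_one, mul_zero, sub_zero] at e
    rw [e]
    positivity
  have hnn : ∀ Y : HPlane, 0 ≤ 1 - Y.1.1 ^ 2 - Y.1.2 ^ 2 := by
    intro Y
    have : Y.1.1 ^ 2 + Y.1.2 ^ 2 ≤ 1 := Y.2
    linarith
  have hZ0 : 1 - Z.1 ^ 2 - Z.2 ^ 2 = 0 := by
    have : Z.1 ^ 2 + Z.2 ^ 2 = 1 := hZ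
    linarith
  have hc1 : c ^ 2 ≤ 1 := by
    have h1 := hQ ⟨Z, le_of_eq hZ⟩
    simp only at h1
    rw [hZ0, mul_zero, zero_add] at h1
    have h2 := hnn (g ⟨Z, le_of_eq hZ⟩)
    have h3 : 0 ≤ (1 - c ^ 2) * (D₁ * Z.1 + D₂ * Z.2 + D₃) ^ 2 := by
      rw [← h1]; positivity
    have := nonneg_of_mul_nonneg_left h3 hZD
    linarith
  have hc2 : 1 ≤ c ^ 2 := by
    obtain ⟨Y, hY⟩ := g.surjective ⟨Z, le_of_eq hZ⟩
    have h1 := hQ Y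
    have h4 := hc Y.1
    rw [(hN Y).2.1, (hN Y).2.2] at h4
    rw [hY] at h1 h4
    simp only at h1 h4
    rw [hZ0, mul_zero, mul_zero] at h1
    have h2 := hnn Y
    have h5 : 0 < (D₁ * Y.1.1 + D₂ * Y.1.2 + D₃) ^ 2 := by
      have h6 : (affRow N 2 Y.1) ^ 2 * (D₁ * Z.1 + D₂ * Z.2 + D₃) ^ 2 =
        c ^ 2 * (D₁ * Y.1.1 + D₂ * Y.1.2 + D₃) ^ 2 := by
        rw [← mul_pow, ← mul_pow, ← h4]; ring
      have h7 : 0 < (affRow N 2 Y.1) ^ 2 * (D₁ * Z.1 + D₂ * Z.2 + D₃) ^ 2 := by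
        have := hN.pos hP₀ hf₀ Y
        positivity
      rw [h6] at h7
      exact lt_of_le_of_ne (sq_nonneg _) fun h0 => by
        rw [← h0, mul_zero] at h7
        exact lt_irrefl _ h7
    have h6 : 0 ≤ (c ^ 2 - 1) * (D₁ * Y.1.1 + D₂ * Y.1.2 + D₃) ^ 2 := by
      have h8 : 0 ≤ G ^ 2 * (1 - Y.1.1 ^ 2 - Y.1.2 ^ 2) := by positivity
      linarith
    have := nonneg_of_mul_nonneg_left h6 h5
    linarith
  refine ⟨affRow N 2 X.1, (hN X).1, ?_, ?_⟩
  · rw [← htan₀ X.1, (hN X).2.1, (hN X).2.2]; ring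
  · have h1 := hQ X
    rw [le_antisymm hc1 hc2, sub_self, zero_mul, add_zero] at h1
    exact mul_left_cancel₀ (by positivity) h1

theorem horoRel_of_mem_horocyclicGroup {P₀ : ℝ × ℝ} (hP₀ : IsAsymptotic P₀)
    {g : Equiv.Perm HPlane} (hg : g ∈ horocyclicGroup P₀) (X : HPlane) :
    HoroRel P₀ X.1 (g X).1 := by
  induction hg using Subgroup.closure_induction generalizing X with
  | mem g hg =>
    obtain ⟨hg, L, hL, hPL, hfix⟩ := hg
    exact horoRel_of_fixes_line hP₀ hg hL hPL hfix X
  | one => exact ⟨1, one_ne_zero, by simp, by simp⟩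
  | mul g h _ _ ihg ihh =>
    obtain ⟨ω, hω, e1, e2⟩ := ihh X
    obtain ⟨ω', hω', e1', e2'⟩ := ihg (h X)
    refine ⟨ω * ω', mul_ne_zero hω hω', ?_, ?_⟩
    · rw [← e1, ← e1', Equiv.Perm.mul_apply]; ring
    · rw [← e2, ← e2', Equiv.Perm.mul_apply]; ring
  | inv g _ ih =>
    obtain ⟨ω, hω, e1, e2⟩ := ih (g⁻¹ X)
    rw [show g (g⁻¹ X) = X from g.apply_symm_apply X] at e1 e2
    refine ⟨ω⁻¹, inv_ne_zero hω, ?_, ?_⟩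
    · rw [← e1]; field_simp
    · rw [← e2]; field_simp

/-- Two ordinary points on which the invariant of the horocyclic group agrees are exchanged by one
reflection, along the difference of the representing vectors that are normalized against
`(P₀, 1)`. -/
theorem exists_mem_horocyclicGroup {P₀ : ℝ × ℝ} (hP₀ : IsAsymptotic P₀) {E X : HPlane}
    (hE : IsOrdinary E.1) (hX : IsOrdinary X.1)
    (h : (1 - P₀.1 * X.1.1 - P₀.2 * X.1.2) ^ 2 * (1 - E.1.1 ^ 2 - E.1.2 ^ 2) =
      (1 - P₀.1 * E.1.1 - P₀.2 * E.1.2) ^ 2 * (1 - X.1.1 ^ 2 - X.1.2 ^ 2)) :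
    ∃ g ∈ horocyclicGroup P₀, g E = X := by
  rcases eq_or_ne E X with rfl | hne
  · exact ⟨1, one_mem _, rfl⟩
  have hl' := (lorentz_cauchy_schwarz hX (le_of_eq hP₀)).1
  have he' := (lorentz_cauchy_schwarz hE (le_of_eq hP₀)).1
  have hXE' := (lorentz_cauchy_schwarz hX (le_of_lt hE)).1
  have hne' : ¬ (X.1.1 = E.1.1 ∧ X.1.2 = E.1.2) := fun hc =>
    hne (Subtype.ext (Prod.ext hc.1.symm hc.2.symm))
  obtain ⟨l, hl⟩ : ∃ l, l = 1 - P₀.1 * X.1.1 - P₀.2 * X.1.2 := ⟨_, rfl⟩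
  obtain ⟨e, he⟩ : ∃ e, e = 1 - P₀.1 * E.1.1 - P₀.2 * E.1.2 := ⟨_, rfl⟩
  have hlpos : 0 < l := by linarith
  have hepos : 0 < e := by linarith
  rw [← hl, ← he] at h
  obtain ⟨z₁, hz₁⟩ : ∃ z₁, z₁ = e * X.1.1 - l * E.1.1 := ⟨_, rfl⟩
  obtain ⟨z₂, hz₂⟩ : ∃ z₂, z₂ = e * X.1.2 - l * E.1.2 := ⟨_, rfl⟩
  obtain ⟨z₃, hz₃⟩ : ∃ z₃, z₃ = e - l := ⟨_, rfl⟩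
  have hzP : z₁ * P₀.1 + z₂ * P₀.2 = z₃ := by rw [hz₁, hz₂, hz₃, hl, he]; ring
  have hP₀' : P₀.1 ^ 2 + P₀.2 ^ 2 = 1 := hP₀
  have hNsq : z₁ ^ 2 + z₂ ^ 2 - z₃ ^ 2 = (z₁ * P₀.2 - z₂ * P₀.1) ^ 2 := by
    rw [← hzP]; linear_combination (-(z₁ ^ 2 + z₂ ^ 2)) * hP₀'
  have hNeq : z₁ ^ 2 + z₂ ^ 2 - z₃ ^ 2 = 2 * l * (e * (1 - X.1.1 * E.1.1 - X.1.2 * E.1.2) -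
      l * (1 - E.1.1 ^ 2 - E.1.2 ^ 2)) := by
    rw [hz₁, hz₂, hz₃]; linear_combination h
  have hpos : 0 < z₁ ^ 2 + z₂ ^ 2 - z₃ ^ 2 := by
    rw [hNsq]
    refine lt_of_le_of_ne (sq_nonneg _) fun h0 => hne' ?_
    have hd : z₁ * P₀.2 - z₂ * P₀.1 = 0 := by simpa using h0.symm
    have e1 : z₁ = z₃ * P₀.1 := by linear_combination P₀.1 * hzP + P₀.2 * hd - z₁ * hP₀'
    have e2 : z₂ = z₃ * P₀.2 := by linear_combination P₀.2 * hzP - P₀.1 * hd - z₂ * hP₀'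
    have f1 : e * X.1.1 = l * E.1.1 + z₃ * P₀.1 := by linarith
    have f2 : e * X.1.2 = l * E.1.2 + z₃ * P₀.2 := by linarith
    have f3 : e = l + z₃ := by linarith
    have f4 : 2 * (l * e) * z₃ = 0 := by
      have : e ^ 2 * (1 - X.1.1 ^ 2 - X.1.2 ^ 2) = (l + z₃) ^ 2 - (l * E.1.1 + z₃ * P₀.1) ^ 2 -
        (l * E.1.2 + z₃ * P₀.2) ^ 2 := by rw [← f1, ← f2, ← f3]; ring
      rw [← h] at this
      linear_combination -this + 2 * l * z₃ * he + z₃ ^ 2 * hP₀'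
    have f5 : z₃ = 0 := (mul_eq_zero.mp f4).resolve_left (by positivity)
    rw [f5] at f1 f2 f3
    rw [add_zero] at f3
    rw [f3] at f1 f2
    constructor
    · apply mul_left_cancel₀ hlpos.ne'; linarith
    · apply mul_left_cancel₀ hlpos.ne'; linarith
  obtain ⟨g, hg, hgfix, hgE⟩ := exists_reflection rfl hpos
  refine ⟨g, Subgroup.subset_closure ⟨hg, _, isClosedHLine_of_spacelike (by linarith),
    ⟨hzP, le_of_eq hP₀⟩, fun p => ?_⟩, ?_⟩
  · rw [hgfix]
    exact ⟨fun hp => ⟨hp, p.2⟩, fun hp => hp.1⟩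
  · have hs : (z₁ ^ 2 + z₂ ^ 2 - z₃ ^ 2) * (-1 / (2 * l)) = z₁ * E.1.1 + z₂ * E.1.2 - z₃ := by
      rw [hNeq, hz₁, hz₂, hz₃]
      field_simp
      ring
    obtain ⟨h1, h2⟩ := hgE E _ hs
    have h3 : 1 - 2 * (-1 / (2 * l)) * z₃ = e / l := by rw [hz₃]; field_simp; ring
    apply Subtype.ext
    rw [h2, h3, hz₁, hz₂]
    ext
    · simp only; field_simp; ring
    · simp only; field_simp; ring

/-- The horocyclic group preserves `(1 - P₀ ⬝ X)² / (1 - |X|²)`, and its orbits are the level sets. -/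
theorem horocycle_eq {P₀ : ℝ × ℝ} (hP₀ : IsAsymptotic P₀) {E : HPlane} (hE : IsOrdinary E.1) :
    horocycle P₀ E = {X | IsOrdinary X ∧
      (1 - P₀.1 * X.1 - P₀.2 * X.2) ^ 2 * (1 - E.1.1 ^ 2 - E.1.2 ^ 2) =
        (1 - P₀.1 * E.1.1 - P₀.2 * E.1.2) ^ 2 * (1 - X.1 ^ 2 - X.2 ^ 2)} := by
  ext X
  constructor
  · rintro ⟨g, hg, rfl⟩
    obtain ⟨ω, hω, e1, e2⟩ := horoRel_of_mem_horocyclicGroup hP₀ hg E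
    refine ⟨?_, ?_⟩
    · have h1 : 0 < 1 - E.1.1 ^ 2 - E.1.2 ^ 2 := by unfold IsOrdinary at hE; linarith
      rw [← e2] at h1
      have h2 := pos_of_mul_pos_right h1 (sq_nonneg ω)
      unfold IsOrdinary
      linarith
    · rw [← e1, ← e2]; ring
  · rintro ⟨hX, h⟩
    obtain ⟨g, hg, hgE⟩ := exists_mem_horocyclicGroup hP₀ (X := ⟨X, le_of_lt hX⟩) hE hX h
    exact ⟨g, hg, by rw [hgE]⟩

/-- The horodisk as the hull of its horocycle: a point of the disk other than `P₀` lies on the chord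
of the horocycle that is perpendicular to the direction of `P₀`. -/
theorem convexHull_horocycle_union {P₀ : ℝ × ℝ} (hP₀ : IsAsymptotic P₀) {k : ℝ} (hk : 0 < k) :
    convexHull ℝ {X : ℝ × ℝ | IsOrdinary X ∧
      (1 - P₀.1 * X.1 - P₀.2 * X.2) ^ 2 = k * (1 - X.1 ^ 2 - X.2 ^ 2)} ∪ {P₀} =
    {X | (1 - P₀.1 * X.1 - P₀.2 * X.2) ^ 2 ≤ k * (1 - X.1 ^ 2 - X.2 ^ 2)} := by
  have hP₀' : P₀.1 ^ 2 + P₀.2 ^ 2 = 1 := hP₀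
  apply Set.Subset.antisymm
  · apply Set.union_subset
    · apply convexHull_min
      · rintro X ⟨-, h⟩
        exact le_of_eq h
      · intro X hX Y hY a b ha hb hab
        simp only [Set.mem_ofPred_eq, Prod.fst_add, Prod.snd_add, Prod.smul_fst, Prod.smul_snd,
          smul_eq_mul] at *
        have h1 := mul_le_mul_of_nonneg_left hX ha
        have h2 := mul_le_mul_of_nonneg_left hY hb
        have h3 : 0 ≤ a * b * ((P₀.1 * (X.1 - Y.1) + P₀.2 * (X.2 - Y.2)) ^ 2 +
            k * ((X.1 - Y.1) ^ 2 + (X.2 - Y.2) ^ 2)) := by positivity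
        obtain rfl : b = 1 - a := by linarith
        nlinarith
    · rintro X rfl
      simp only [Set.mem_ofPred_eq]
      have e1 : 1 - X.1 * X.1 - X.2 * X.2 = 0 := by linarith
      have e2 : 1 - X.1 ^ 2 - X.2 ^ 2 = 0 := by linarith
      rw [e1, e2]; simp
  · intro X hX
    simp only [Set.mem_ofPred_eq] at hX
    obtain ⟨s, hs⟩ : ∃ s, s = 1 - P₀.1 * X.1 - P₀.2 * X.2 := ⟨_, rfl⟩
    obtain ⟨τ, hτ⟩ : ∃ τ, τ = -P₀.2 * X.1 + P₀.1 * X.2 := ⟨_, rfl⟩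
    have hX1 : X.1 = (1 - s) * P₀.1 - τ * P₀.2 := by
      rw [hs, hτ]; linear_combination (-X.1) * hP₀'
    have hX2 : X.2 = (1 - s) * P₀.2 + τ * P₀.1 := by
      rw [hs, hτ]; linear_combination (-X.2) * hP₀'
    have hform : ∀ σ : ℝ, 1 - ((1 - s) * P₀.1 - σ * P₀.2) ^ 2 - ((1 - s) * P₀.2 + σ * P₀.1) ^ 2 =
        2 * s - s ^ 2 - σ ^ 2 := by
      intro σ; linear_combination (-((1 - s) ^ 2 + σ ^ 2)) * hP₀'
    rw [← hs, hX1, hX2, hform] at hX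
    have hs0 : 0 ≤ s := by nlinarith [sq_nonneg s, sq_nonneg τ]
    rcases eq_or_lt_of_le hs0 with hs1 | hs1
    · right
      have hτ0 : τ = 0 := by
        rw [← hs1] at hX
        have : τ ^ 2 ≤ 0 := by nlinarith [sq_nonneg τ]
        simpa using le_antisymm this (sq_nonneg τ)
      rw [← hs1, hτ0] at hX1 hX2
      exact Prod.ext (by linarith) (by linarith)
    · left
      -- `± ρ` are the parameters of the end points of the chord
      obtain ⟨ρ, hρ0, hρ⟩ : ∃ ρ, 0 ≤ ρ ∧ k * ρ ^ 2 = 2 * k * s - (1 + k) * s ^ 2 := by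
        have h0 : 0 ≤ 2 * k * s - (1 + k) * s ^ 2 := by nlinarith [sq_nonneg τ]
        refine ⟨√((2 * k * s - (1 + k) * s ^ 2) / k), Real.sqrt_nonneg _, ?_⟩
        rw [Real.sq_sqrt (by positivity)]
        field_simp
      have hτρ : |τ| ≤ ρ := by
        apply abs_le_of_sq_le_sq _ hρ0
        apply le_of_mul_le_mul_left _ hk
        linarith
      obtain ⟨hl, hr⟩ := abs_le.mp hτρ
      have hend : ∀ σ : ℝ, σ ^ 2 = ρ ^ 2 →
          ((1 - s) * P₀.1 - σ * P₀.2, (1 - s) * P₀.2 + σ * P₀.1) ∈ {X : ℝ × ℝ | IsOrdinary X ∧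
            (1 - P₀.1 * X.1 - P₀.2 * X.2) ^ 2 = k * (1 - X.1 ^ 2 - X.2 ^ 2)} := by
        intro σ hσ
        have e1 := hform σ
        have e2 : k * (2 * s - s ^ 2 - σ ^ 2) = s ^ 2 := by rw [hσ]; linarith
        have e3 : 0 < k * (2 * s - s ^ 2 - σ ^ 2) := by rw [e2]; positivity
        have e4 := (mul_pos_iff_of_pos_left hk).mp e3
        refine ⟨?_, ?_⟩
        · simp only [IsOrdinary]; linarith
        · simp only
          rw [e1, e2]
          have : 1 - P₀.1 * ((1 - s) * P₀.1 - σ * P₀.2) - P₀.2 * ((1 - s) * P₀.2 + σ * P₀.1) = s := by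
            linear_combination (-(1 - s)) * hP₀'
          rw [this]
      have hm1 := subset_convexHull ℝ _ (hend ρ rfl)
      have hm2 := subset_convexHull ℝ _ (hend (-ρ) (by ring))
      rcases eq_or_lt_of_le hρ0 with hz | hz
      · have hτ0 : τ = 0 := by
          rw [← hz] at hl hr
          linarith
        have : X = ((1 - s) * P₀.1 - ρ * P₀.2, (1 - s) * P₀.2 + ρ * P₀.1) := by
          ext
          · rw [hX1, hτ0, ← hz]
          · rw [hX2, hτ0, ← hz]
        rw [this]
        exact hm1
      · have hcomb := convex_convexHull ℝ {X : ℝ × ℝ | IsOrdinary X ∧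
            (1 - P₀.1 * X.1 - P₀.2 * X.2) ^ 2 = k * (1 - X.1 ^ 2 - X.2 ^ 2)} hm1 hm2
          (a := (ρ + τ) / (2 * ρ)) (b := (ρ - τ) / (2 * ρ))
          (div_nonneg (by linarith) (by linarith)) (div_nonneg (by linarith) (by linarith))
          (by field_simp; ring)
        convert hcomb using 1
        ext
        · simp only [Prod.fst_add, Prod.smul_fst, smul_eq_mul]
          rw [hX1]; field_simp; ring
        · simp only [Prod.snd_add, Prod.smul_snd, smul_eq_mul]
          rw [hX2]; field_simp; ring

/-- An `h`-horodisk is described as an `h`-disk is, with the center moved to the absolute. -/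
theorem isHHorodisk_iff {S : Set (ℝ × ℝ)} {P₀ : ℝ × ℝ} : IsHHorodisk S P₀ ↔
    IsAsymptotic P₀ ∧ ∃ k : ℝ, 0 < k ∧
      S = {X | (1 - P₀.1 * X.1 - P₀.2 * X.2) ^ 2 ≤ k * (1 - X.1 ^ 2 - X.2 ^ 2)} := by
  unfold IsHHorodisk
  refine and_congr_right fun hP₀ => ?_
  have heq : ∀ (E : HPlane) (k : ℝ), IsOrdinary E.1 →
      (1 - P₀.1 * E.1.1 - P₀.2 * E.1.2) ^ 2 = k * (1 - E.1.1 ^ 2 - E.1.2 ^ 2) →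
      horocycle P₀ E = {X : ℝ × ℝ | IsOrdinary X ∧
        (1 - P₀.1 * X.1 - P₀.2 * X.2) ^ 2 = k * (1 - X.1 ^ 2 - X.2 ^ 2)} := by
    intro E k hE hk
    have hE' : 1 - E.1.1 ^ 2 - E.1.2 ^ 2 ≠ 0 := by unfold IsOrdinary at hE; linarith
    rw [horocycle_eq hP₀ hE, hk]
    ext X
    refine and_congr_right fun _ => ?_
    rw [show k * (1 - E.1.1 ^ 2 - E.1.2 ^ 2) * (1 - X.1 ^ 2 - X.2 ^ 2) =
      k * (1 - X.1 ^ 2 - X.2 ^ 2) * (1 - E.1.1 ^ 2 - E.1.2 ^ 2) by ring]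
    exact mul_left_inj' hE'
  constructor
  · rintro ⟨E, hE, rfl⟩
    have hE' : 0 < 1 - E.1.1 ^ 2 - E.1.2 ^ 2 := by unfold IsOrdinary at hE; linarith
    have hl := (lorentz_cauchy_schwarz hE (le_of_eq hP₀)).1
    have hk : 0 < (1 - P₀.1 * E.1.1 - P₀.2 * E.1.2) ^ 2 / (1 - E.1.1 ^ 2 - E.1.2 ^ 2) := by
      apply div_pos _ hE'
      apply pow_pos
      linarith
    refine ⟨_, hk, ?_⟩
    rw [← convexHull_horocycle_union hP₀ hk, heq E _ hE (div_mul_cancel₀ _ hE'.ne').symm]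
  · rintro ⟨k, hk, rfl⟩
    have hP₀' : P₀.1 ^ 2 + P₀.2 ^ 2 = 1 := hP₀
    -- the point of the horocycle on the diameter through `P₀`
    obtain ⟨s, hs⟩ : ∃ s, s * (1 + k) = 2 * k := ⟨_, div_mul_cancel₀ _ (by positivity)⟩
    have hs0 : 0 < s := pos_of_mul_pos_left (by rw [hs]; positivity) (by positivity : 0 ≤ 1 + k)
    have hs2 : k * (2 * s - s ^ 2) = s ^ 2 := by linear_combination (-s) * hs
    have hord : IsOrdinary ((1 - s) * P₀.1, (1 - s) * P₀.2) := by
      have h1 : 0 < 2 * s - s ^ 2 :=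
        (mul_pos_iff_of_pos_left hk).mp (by rw [hs2]; positivity)
      simp only [IsOrdinary]
      have : ((1 - s) * P₀.1) ^ 2 + ((1 - s) * P₀.2) ^ 2 = (1 - s) ^ 2 := by
        linear_combination (1 - s) ^ 2 * hP₀'
      rw [this]
      linarith
    refine ⟨⟨_, le_of_lt hord⟩, hord, ?_⟩
    rw [heq _ k hord, convexHull_horocycle_union hP₀ hk]
    have e1 : 1 - P₀.1 * ((1 - s) * P₀.1) - P₀.2 * ((1 - s) * P₀.2) = s := by
      linear_combination (-(1 - s)) * hP₀'
    have e2 : 1 - ((1 - s) * P₀.1) ^ 2 - ((1 - s) * P₀.2) ^ 2 = 2 * s - s ^ 2 := by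
      linear_combination (-(1 - s) ^ 2) * hP₀'
    simp only
    rw [e1, e2, hs2]

/-! ### Normal operators -/

theorem mem_segment_iff {P Q X : ℝ × ℝ} : X ∈ segment ℝ P Q ↔
    ∃ σ : ℝ, 0 ≤ σ ∧ σ ≤ 1 ∧ X = (P.1 + σ * (Q.1 - P.1), P.2 + σ * (Q.2 - P.2)) := by
  rw [segment_eq_image']
  constructor
  · rintro ⟨σ, ⟨h0, h1⟩, rfl⟩
    exact ⟨σ, h0, h1, by ext <;> simp⟩
  · rintro ⟨σ, h0, h1, rfl⟩
    exact ⟨σ, ⟨h0, h1⟩, by ext <;> simp⟩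

theorem segment_eq_closedLine {P Q : ℝ × ℝ} (hP : IsAsymptotic P) (hQ : IsAsymptotic Q)
    (hPQ : P ≠ Q) : segment ℝ P Q = closedLine P Q := by
  have hG := one_sub_inner_pos_of_asymptotic hP hQ hPQ
  ext X
  simp only [closedLine, Set.mem_ofPred_eq, mem_segment_iff, mem_affineSpan_pair_iff, baseSet]
  have hn : ∀ σ : ℝ, 1 - ((P.1 + σ * (Q.1 - P.1)) ^ 2 + (P.2 + σ * (Q.2 - P.2)) ^ 2) =
      2 * (1 - P.1 * Q.1 - P.2 * Q.2) * (σ * (1 - σ)) := by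
    intro σ
    unfold IsAsymptotic at hP hQ
    linear_combination -(1 - σ) ^ 2 * hP - σ ^ 2 * hQ
  constructor
  · rintro ⟨σ, h0, h1, rfl⟩
    refine ⟨⟨σ, rfl⟩, ?_⟩
    have := hn σ
    have h2 : 0 ≤ 2 * (1 - P.1 * Q.1 - P.2 * Q.2) * (σ * (1 - σ)) :=
      mul_nonneg (by linarith) (mul_nonneg h0 (by linarith))
    simp only
    linarith
  · rintro ⟨⟨σ, rfl⟩, h⟩
    have h1 := hn σ
    have h2 : 0 ≤ σ * (1 - σ) := by
      apply nonneg_of_mul_nonneg_right (a := 2 * (1 - P.1 * Q.1 - P.2 * Q.2)) _ (by linarith)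
      simp only at h
      linarith
    exact ⟨σ, by nlinarith, by nlinarith, rfl⟩

theorem segment_eq_closedHalfLine {P Q : ℝ × ℝ} (hP : IsOrdinary P) (hQ : IsAsymptotic Q) :
    segment ℝ P Q = {p | (∃ t : ℝ, 0 ≤ t ∧ p = P + t • (Q - P)) ∧ p ∈ baseSet .BCK} := by
  unfold IsOrdinary at hP
  unfold IsAsymptotic at hQ
  ext X
  simp only [Set.mem_ofPred_eq, mem_segment_iff, baseSet]
  have hn : ∀ σ : ℝ, 1 - ((P.1 + σ * (Q.1 - P.1)) ^ 2 + (P.2 + σ * (Q.2 - P.2)) ^ 2) =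
      (1 - σ) * (1 - (P.1 ^ 2 + P.2 ^ 2) + σ * ((P.1 - Q.1) ^ 2 + (P.2 - Q.2) ^ 2)) := by
    intro σ
    linear_combination -σ * hQ
  have hpos : ∀ σ : ℝ, 0 ≤ σ →
      0 < 1 - (P.1 ^ 2 + P.2 ^ 2) + σ * ((P.1 - Q.1) ^ 2 + (P.2 - Q.2) ^ 2) := by
    intro σ hσ
    have : 0 < 1 - (P.1 ^ 2 + P.2 ^ 2) := by linarith
    positivity
  constructor
  · rintro ⟨σ, h0, h1, rfl⟩
    refine ⟨⟨σ, h0, by ext <;> simp⟩, ?_⟩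
    have := hn σ
    have h2 := mul_nonneg (sub_nonneg.mpr h1) (hpos σ h0).le
    simp only
    linarith
  · rintro ⟨⟨σ, h0, rfl⟩, h⟩
    have e : P + σ • (Q - P) = (P.1 + σ * (Q.1 - P.1), P.2 + σ * (Q.2 - P.2)) := by
      ext <;> simp
    rw [e] at h
    refine ⟨σ, h0, ?_, e⟩
    have h1 := hn σ
    simp only at h
    have h2 : 0 ≤ 1 - σ := by
      apply nonneg_of_mul_nonneg_left _ (hpos σ h0)
      linarith
    linarith

/-! ### Special forms of the quadric -/

theorem rangeForm_swap (a₁ b₁ a₂ b₂ s u v w : ℝ) :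
    rangeForm a₁ b₁ a₂ b₂ s u v w = rangeForm a₂ b₂ a₁ b₁ s u v w := by
  unfold rangeForm
  ring

/-- The linear form attached to an eigenvalue, in `BCK` coordinates: up to a factor it is the polar
of the eigenpoint with respect to the absolute. -/
theorem polar_iota (μ : ℂ) (X : ℝ × ℝ) :
    1 + X.2 - 2 * μ.re * X.1 + (μ.re ^ 2 + μ.im ^ 2) * (1 - X.2) =
      (‖μ‖ ^ 2 + 1) * (1 - (iota .BCK μ).1 * X.1 - (iota .BCK μ).2 * X.2) := by
  have h : 0 < μ.re ^ 2 + μ.im ^ 2 + 1 := by positivity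
  simp only [iota, sq_norm_eq]
  field_simp
  ring

theorem one_sub_sq_iota (μ : ℂ) : (‖μ‖ ^ 2 + 1) ^ 2 *
    (1 - (iota .BCK μ).1 ^ 2 - (iota .BCK μ).2 ^ 2) = 4 * μ.im ^ 2 := by
  have h : 0 < μ.re ^ 2 + μ.im ^ 2 + 1 := by positivity
  simp only [iota, sq_norm_eq]
  field_simp
  ring

/-- If the eigenvalues are equal or conjugate, the form is in the pencil spanned by the absolute
and the squared polar of the eigenpoint. -/
theorem rangeForm_nonpos_iff_of_conj {μ₁ μ₂ : ℂ} (h : μ₂ = μ₁ ∨ μ₂ = conj μ₁) {s : ℝ} (hs : 0 < s)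
    (X : ℝ × ℝ) : rangeForm μ₁.re μ₁.im μ₂.re μ₂.im s X.1 (1 + X.2) (1 - X.2) ≤ 0 ↔
      (1 - (iota .BCK μ₁).1 * X.1 - (iota .BCK μ₁).2 * X.2) ^ 2 ≤
        (s + 4 * μ₁.im ^ 2) / (‖μ₁‖ ^ 2 + 1) ^ 2 * (1 - X.1 ^ 2 - X.2 ^ 2) := by
  have hre : μ₂.re = μ₁.re := by rcases h with rfl | rfl <;> simp
  have him : μ₂.im ^ 2 = μ₁.im ^ 2 := by rcases h with rfl | rfl <;> simp
  have e : rangeForm μ₁.re μ₁.im μ₂.re μ₂.im s X.1 (1 + X.2) (1 - X.2) =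
      s * ((1 + X.2 - 2 * μ₁.re * X.1 + (μ₁.re ^ 2 + μ₁.im ^ 2) * (1 - X.2)) ^ 2 -
        (s + 4 * μ₁.im ^ 2) * (1 - X.1 ^ 2 - X.2 ^ 2)) := by
    unfold rangeForm
    rw [hre, him]
    ring
  have hN : 0 < (‖μ₁‖ ^ 2 + 1) ^ 2 := by positivity
  rw [e, polar_iota, mul_pow, div_mul_eq_mul_div, le_div_iff₀ hN]
  constructor
  · intro h
    have := nonpos_of_mul_nonpos_right h hs
    linarith
  · intro h
    exact mul_nonpos_of_nonneg_of_nonpos hs.le (by linarith)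

/-- If both eigenvalues are real, the form is in the pencil spanned by the absolute and the product
of the tangents at the two eigenpoints. -/
theorem rangeForm_nonpos_iff_of_real {μ₁ μ₂ : ℂ} (h₁ : μ₁.im = 0) (h₂ : μ₂.im = 0) (hne : μ₁ ≠ μ₂)
    {s : ℝ} (hs : 0 < s) (X : ℝ × ℝ) :
    rangeForm μ₁.re μ₁.im μ₂.re μ₂.im s X.1 (1 + X.2) (1 - X.2) ≤ 0 ↔
      2 * ((1 - X.1 * (iota .BCK μ₁).1 - X.2 * (iota .BCK μ₁).2) *
        (1 - X.1 * (iota .BCK μ₂).1 - X.2 * (iota .BCK μ₂).2)) ≤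
      (1 + s / (μ₁.re - μ₂.re) ^ 2) * ((1 - (iota .BCK μ₁).1 * (iota .BCK μ₂).1 -
        (iota .BCK μ₁).2 * (iota .BCK μ₂).2) * (1 - X.1 ^ 2 - X.2 ^ 2)) := by
  have hδ : 0 < (μ₁.re - μ₂.re) ^ 2 := by
    have : μ₁.re - μ₂.re ≠ 0 := fun h =>
      hne (Complex.ext (sub_eq_zero.mp h) (by rw [h₁, h₂]))
    positivity
  have p₁ := polar_iota μ₁ X
  have p₂ := polar_iota μ₂ X
  have p₁₂ : (‖μ₂‖ ^ 2 + 1) * ((‖μ₁‖ ^ 2 + 1) * (1 - (iota .BCK μ₁).1 * (iota .BCK μ₂).1 -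
      (iota .BCK μ₁).2 * (iota .BCK μ₂).2)) = 2 * (μ₁.re - μ₂.re) ^ 2 := by
    have h : 0 < μ₂.re ^ 2 + 1 := by positivity
    rw [← polar_iota]
    simp only [iota, sq_norm_eq, h₁, h₂]
    field_simp
    ring
  have e : rangeForm μ₁.re μ₁.im μ₂.re μ₂.im s X.1 (1 + X.2) (1 - X.2) =
      ((μ₁.re - μ₂.re) ^ 2 + s) *
      ((1 + X.2 - 2 * μ₁.re * X.1 + (μ₁.re ^ 2 + μ₁.im ^ 2) * (1 - X.2)) *
        (1 + X.2 - 2 * μ₂.re * X.1 + (μ₂.re ^ 2 + μ₂.im ^ 2) * (1 - X.2)) -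
        ((μ₁.re - μ₂.re) ^ 2 + s) * (1 - X.1 ^ 2 - X.2 ^ 2)) := by
    unfold rangeForm
    rw [h₁, h₂]
    ring
  have hN : 0 < (‖μ₁‖ ^ 2 + 1) * (‖μ₂‖ ^ 2 + 1) := by positivity
  have hδs : 0 < (μ₁.re - μ₂.re) ^ 2 + s := by positivity
  have key : (‖μ₁‖ ^ 2 + 1) * (‖μ₂‖ ^ 2 + 1) *
      ((1 + s / (μ₁.re - μ₂.re) ^ 2) * ((1 - (iota .BCK μ₁).1 * (iota .BCK μ₂).1 -
        (iota .BCK μ₁).2 * (iota .BCK μ₂).2) * (1 - X.1 ^ 2 - X.2 ^ 2)) -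
      2 * ((1 - X.1 * (iota .BCK μ₁).1 - X.2 * (iota .BCK μ₁).2) *
        (1 - X.1 * (iota .BCK μ₂).1 - X.2 * (iota .BCK μ₂).2))) =
      -2 * ((1 + X.2 - 2 * μ₁.re * X.1 + (μ₁.re ^ 2 + μ₁.im ^ 2) * (1 - X.2)) *
        (1 + X.2 - 2 * μ₂.re * X.1 + (μ₂.re ^ 2 + μ₂.im ^ 2) * (1 - X.2)) -
        ((μ₁.re - μ₂.re) ^ 2 + s) * (1 - X.1 ^ 2 - X.2 ^ 2)) := by
    have hs' : (1 + s / (μ₁.re - μ₂.re) ^ 2) * (μ₁.re - μ₂.re) ^ 2 = (μ₁.re - μ₂.re) ^ 2 + s := by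
      rw [add_mul, one_mul, div_mul_cancel₀ _ (by positivity)]
    rw [p₁, p₂]
    linear_combination ((1 + s / (μ₁.re - μ₂.re) ^ 2) * (1 - X.1 ^ 2 - X.2 ^ 2)) * p₁₂ +
      2 * (1 - X.1 ^ 2 - X.2 ^ 2) * hs'
  rw [e, ← sub_nonneg (b := 2 * _)]
  constructor
  · intro h
    have h' := nonpos_of_mul_nonpos_right h hδs
    refine nonneg_of_mul_nonneg_right (a := (‖μ₁‖ ^ 2 + 1) * (‖μ₂‖ ^ 2 + 1)) ?_ hN
    rw [key]
    linarith
  · intro h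
    have h' := mul_nonneg hN.le h
    rw [key] at h'
    exact mul_nonpos_of_nonneg_of_nonpos hδs.le (by linarith)

section

variable {H : Type*} [NormedAddCommGroup H] [InnerProductSpace ℂ H]

theorem sq_add_sq_le_of_rangeForm {A : H →ₗ[ℂ] H} {a₁ b₁ a₂ b₂ s : ℝ}
    (hS : ∀ p : ℝ × ℝ, p ∈ conformalRange A .BCK ↔
      rangeForm a₁ b₁ a₂ b₂ s p.1 (1 + p.2) (1 - p.2) ≤ 0) (p : ℝ × ℝ)
    (hp : rangeForm a₁ b₁ a₂ b₂ s p.1 (1 + p.2) (1 - p.2) ≤ 0) : p.1 ^ 2 + p.2 ^ 2 ≤ 1 :=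
  conformalRange_subset_baseSet A .BCK ((hS p).mpr hp)

theorem exists_real_eigenvalue_of_asymptotic {A : H →ₗ[ℂ] H} {p : ℝ × ℝ}
    (hp : p ∈ conformalRange A .BCK) (has : IsAsymptotic p) :
    ∃ c : ℝ, Module.End.HasEigenvalue A (c : ℂ) ∧ p = iota .BCK c := by
  obtain ⟨c, hc, hu, hv⟩ := (mem_conformalRange_BCK.mp hp).exists_real_eigenvalue (by
    unfold IsAsymptotic at has
    linarith)
  refine ⟨c, hc, ?_⟩
  have h0 : 0 < c ^ 2 + 1 := by positivity
  have h1 : 1 - p.2 = 2 / (c ^ 2 + 1) := by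
    rw [eq_div_iff h0.ne']; linarith
  have e2 : p.2 = 1 - 2 / (c ^ 2 + 1) := by linarith
  ext
  · rw [hu, h1]; simp [iota]; ring
  · rw [e2]; simp [iota]; field_simp; ring

end

section

variable {H : Type*} [NormedAddCommGroup H] [InnerProductSpace ℂ H] [FiniteDimensional ℂ H]

open Polynomial in
theorem conformalRange_eq_segment (hH : Module.finrank ℂ H = 2) {A : H →ₗ[ℂ] H} {μ₁ μ₂ : ℂ}
    (hA : LinearMap.charpoly A = (X - C μ₁) * (X - C μ₂)) (hn : IsStarNormal A) :
    conformalRange A .BCK = segment ℝ (iota .BCK μ₁) (iota .BCK μ₂) := by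
  obtain ⟨b, t, h0, h1⟩ := exists_triangular_basis hH hA
  obtain rfl := (isStarNormal_iff_of_triangular b h0 h1).mp hn
  ext p
  rw [mem_conformalRange_BCK, attains_iff b h0 h1, mem_segment_iff]
  have hp₁ : 0 < ‖μ₁‖ ^ 2 + 1 := by positivity
  have hp₂ : 0 < ‖μ₂‖ ^ 2 + 1 := by positivity
  -- an eigenpoint enters with the weight of the component of the vector, scaled to `BCK`
  constructor
  · rintro ⟨x, y, z, hx, hy, -, hz, hu, hv, hw⟩
    obtain rfl : z = 0 := by simpa using hz
    simp at hu hv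
    have hsum : (‖μ₁‖ ^ 2 + 1) * x + (‖μ₂‖ ^ 2 + 1) * y = 2 := by linarith
    have hy' : 0 ≤ (‖μ₂‖ ^ 2 + 1) * y := by positivity
    have hx' : 0 ≤ (‖μ₁‖ ^ 2 + 1) * x := by positivity
    refine ⟨(‖μ₂‖ ^ 2 + 1) * y / 2, by linarith, by linarith, ?_⟩
    have hxe : x = (2 - (‖μ₂‖ ^ 2 + 1) * y) / (‖μ₁‖ ^ 2 + 1) := by
      rw [eq_div_iff hp₁.ne']; linarith
    have hp2 : p.2 = 1 - (x + y) := by linarith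
    ext
    · simp only [iota]
      rw [hu, hxe]
      field_simp
      ring
    · simp only [iota]
      rw [hp2, hxe]
      field_simp
      ring
  · rintro ⟨σ, hσ0, hσ1, rfl⟩
    refine ⟨2 * (1 - σ) / (‖μ₁‖ ^ 2 + 1), 2 * σ / (‖μ₂‖ ^ 2 + 1), 0, ?_, ?_, ?_, ?_, ?_, ?_, ?_⟩
    · exact div_nonneg (by linarith) hp₁.le
    · exact div_nonneg (by linarith) hp₂.le
    · rcases hσ0.eq_or_lt with h | h
      · rw [← h]; simp; positivity
      · have h1 : 0 < 2 * σ / (‖μ₂‖ ^ 2 + 1) := by positivity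
        have h2 : 0 ≤ 2 * (1 - σ) / (‖μ₁‖ ^ 2 + 1) := div_nonneg (by linarith) hp₁.le
        linarith
    · simp
    · simp only [iota, Complex.zero_re]
      field_simp
      ring
    · simp [iota]
      field_simp
      ring
    · simp only [iota]
      field_simp
      ring

/-! ### Non-normal operators -/

open Polynomial in
theorem exists_rangeForm (hH : Module.finrank ℂ H = 2) {A : H →ₗ[ℂ] H} {μ₁ μ₂ : ℂ}
    (hA : LinearMap.charpoly A = (X - C μ₁) * (X - C μ₂)) (hn : ¬ IsStarNormal A) :
    ∃ s : ℝ, 0 < s ∧ ∀ p : ℝ × ℝ, p ∈ conformalRange A .BCK ↔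
      rangeForm μ₁.re μ₁.im μ₂.re μ₂.im s p.1 (1 + p.2) (1 - p.2) ≤ 0 := by
  obtain ⟨b, t, h0, h1⟩ := exists_triangular_basis hH hA
  have ht : t ≠ 0 := fun h => hn ((isStarNormal_iff_of_triangular b h0 h1).mpr h)
  exact ⟨‖t‖ ^ 2, by positivity, fun p => mem_conformalRange_BCK_iff_rangeForm b h0 h1 ht⟩

open Polynomial in
theorem iota_left_mem_interior (hH : Module.finrank ℂ H = 2) {A : H →ₗ[ℂ] H} {μ₁ μ₂ : ℂ}
    (hA : LinearMap.charpoly A = (X - C μ₁) * (X - C μ₂)) (hn : ¬ IsStarNormal A)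
    (hμ : μ₁.im ≠ 0) (m : HModel) : iota m μ₁ ∈ interior (conformalRange A m) := by
  obtain ⟨s, hs, hS⟩ := exists_rangeForm hH hA hn
  apply iota_mem_interior hμ
  rw [mem_interior]
  refine ⟨{p | rangeForm μ₁.re μ₁.im μ₂.re μ₂.im s p.1 (1 + p.2) (1 - p.2) < 0}, ?_, ?_, ?_⟩
  · intro p hp
    exact (hS p).mpr (le_of_lt hp)
  · unfold rangeForm
    exact isOpen_lt (by fun_prop) (by fun_prop)
  · exact rangeForm_iota_left_neg μ₂ hμ hs

open Polynomial in
theorem isEllipticalDisk_conformalRange (hH : Module.finrank ℂ H = 2) {A : H →ₗ[ℂ] H} {μ₁ μ₂ : ℂ}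
    (hA : LinearMap.charpoly A = (X - C μ₁) * (X - C μ₂)) (hn : ¬ IsStarNormal A)
    (hμ : μ₁.im ≠ 0) : IsEllipticalDisk (conformalRange A .BCK) := by
  obtain ⟨s, hs, hS⟩ := exists_rangeForm hH hA hn
  have hb := sq_add_sq_le_of_rangeForm hS
  have hneg := rangeForm_iota_left_neg μ₂ hμ hs
  obtain ⟨A', B, C, D, E, F, hF⟩ := rangeForm_eq_quadFun μ₁.re μ₁.im μ₂.re μ₂.im s
  have : conformalRange A .BCK = {q | quadFun A' B C D E F q ≤ 0} := by
    ext p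
    rw [hS, hF]
    rfl
  rw [this]
  rw [hF] at hneg
  exact isEllipticalDisk_quadFun hneg fun q hq => hb q (by rw [hF]; exact hq)

open Polynomial in
/-- If the conformal range of a non-normal operator is an `h`-disk or `h`-horodisk centered at `P`,
every non-real eigenvalue has `P` as its eigenpoint. -/
theorem center_eq_iota_of_eq (hH : Module.finrank ℂ H = 2) {A : H →ₗ[ℂ] H} {μ₁ μ₂ : ℂ}
    (hA : LinearMap.charpoly A = (X - C μ₁) * (X - C μ₂)) (hn : ¬ IsStarNormal A)
    (hμ : μ₁.im ≠ 0) {P : ℝ × ℝ} {c : ℝ} (hc : 0 < c)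
    (h : conformalRange A .BCK =
      {X | (1 - P.1 * X.1 - P.2 * X.2) ^ 2 ≤ c * (1 - X.1 ^ 2 - X.2 ^ 2)}) :
    P = iota .BCK μ₁ := by
  obtain ⟨s, hs, hS⟩ := exists_rangeForm hH hA hn
  refine center_eq_iota (μ₂ := μ₂) hμ hs hc (sq_add_sq_le_of_rangeForm hS) fun X => ?_
  rw [← hS, h]
  rfl

open Polynomial in
theorem eq_or_eq_of_hasEigenvalue {A : H →ₗ[ℂ] H} {μ₁ μ₂ c : ℂ}
    (hA : LinearMap.charpoly A = (X - C μ₁) * (X - C μ₂)) (hc : Module.End.HasEigenvalue A c) :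
    c = μ₁ ∨ c = μ₂ := by
  rw [Module.End.hasEigenvalue_iff_isRoot_charpoly, hA] at hc
  simpa [sub_eq_zero] using hc

end

/-! ### The spectral types and the ten cases -/

theorem exists_isOfType (μ₁ μ₂ : ℂ) :
    ∃ τ : SpectralType, IsOfType τ μ₁ μ₂ ∨ IsOfType τ μ₂ μ₁ := by
  by_cases h₁ : μ₁.im = 0 <;> by_cases h₂ : μ₂.im = 0
  · by_cases h : μ₁ = μ₂
    · exact ⟨.realDouble, Or.inl ⟨h₁, h.symm⟩⟩
    · exact ⟨.realDistinct, Or.inl ⟨h₁, h₂, h⟩⟩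
  · exact ⟨.nonrealAndReal, Or.inr ⟨h₂, h₁⟩⟩
  · exact ⟨.nonrealAndReal, Or.inl ⟨h₁, h₂⟩⟩
  · by_cases h : μ₂ = μ₁ ∨ μ₂ = conj μ₁
    · exact ⟨.nonrealEqualOrConjugate, Or.inl ⟨h₁, h⟩⟩
    · push Not at h
      refine ⟨.nonrealGeneric, Or.inl ⟨h₁, h₂, h.1.symm, fun hc => h.2 ?_⟩⟩
      rw [hc, Complex.conj_conj]

theorem IsOfType.unique {τ τ' : SpectralType} {μ₁ μ₂ : ℂ} (h : IsOfType τ μ₁ μ₂)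
    (h' : IsOfType τ' μ₁ μ₂ ∨ IsOfType τ' μ₂ μ₁) : τ' = τ := by
  have hconj : ∀ z w : ℂ, z = conj w → z.im = -w.im := by rintro z w rfl; simp
  have hconj' : ∀ z w : ℂ, z = conj w ↔ w = conj z := fun z w =>
    ⟨fun h => by rw [h, Complex.conj_conj], fun h => by rw [h, Complex.conj_conj]⟩
  have h1 := hconj μ₁ μ₂
  have h2 := hconj μ₂ μ₁
  have h3 := hconj' μ₁ μ₂
  have h4 : μ₁ = μ₂ → μ₁.im = μ₂.im := fun h => by rw [h]
  have h5 : ∀ x : ℝ, x = 0 → -x = 0 := by simp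
  have h6 : ∀ x : ℝ, -x = 0 → x = 0 := by simp
  cases τ <;> cases τ' <;> simp only [IsOfType] at h h' <;> first
    | rfl
    | (exfalso; grind)

open Polynomial in
theorem eq_and_eq_or_of_mul_eq {μ₁ μ₂ ν₁ ν₂ : ℂ}
    (h : (X - C μ₁) * (X - C μ₂) = (X - C ν₁) * (X - C ν₂)) :
    (ν₁ = μ₁ ∧ ν₂ = μ₂) ∨ (ν₁ = μ₂ ∧ ν₂ = μ₁) := by
  have h0 := congrArg (eval μ₁) h
  have h1 := congrArg (eval 0) h
  have h2 := congrArg (eval 1) h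
  simp at h0 h1 h2
  have hsum : μ₁ + μ₂ = ν₁ + ν₂ := by linear_combination h1 - h2
  rcases h0 with h0 | h0
  · left
    have : ν₁ = μ₁ := (sub_eq_zero.mp h0).symm
    exact ⟨this, by rw [this] at hsum; exact (add_left_cancel hsum).symm⟩
  · right
    have : ν₂ = μ₁ := (sub_eq_zero.mp h0).symm
    refine ⟨?_, this⟩
    rw [this] at hsum
    linear_combination -hsum

section

variable {H : Type*} [NormedAddCommGroup H] [InnerProductSpace ℂ H] [FiniteDimensional ℂ H]

open Polynomial in
theorem existsUnique_spectralType (hH : Module.finrank ℂ H = 2) (A : H →ₗ[ℂ] H) :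
    ∃! τ : SpectralType, ∃ μ₁ μ₂ : ℂ, HasSpectralType A τ μ₁ μ₂ := by
  obtain ⟨μ₁, μ₂, hA⟩ : ∃ μ₁ μ₂ : ℂ, LinearMap.charpoly A = (X - C μ₁) * (X - C μ₂) := by
    have h1 := (IsAlgClosed.splits (LinearMap.charpoly A)).eq_prod_roots_of_monic
      (LinearMap.charpoly_monic A)
    have h2 : (LinearMap.charpoly A).roots.card = 2 := by
      rw [← (IsAlgClosed.splits (LinearMap.charpoly A)).natDegree_eq_card_roots,
        LinearMap.charpoly_natDegree, hH]
    obtain ⟨μ₁, μ₂, h3⟩ := Multiset.card_eq_two.mp h2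
    refine ⟨μ₁, μ₂, ?_⟩
    rw [h1, h3]
    simp
  have hA' : LinearMap.charpoly A = (X - C μ₂) * (X - C μ₁) := by rw [hA, mul_comm]
  obtain ⟨τ, hτ⟩ := exists_isOfType μ₁ μ₂
  refine ⟨τ, ?_, ?_⟩
  · rcases hτ with h | h
    · exact ⟨μ₁, μ₂, hA, h⟩
    · exact ⟨μ₂, μ₁, hA', h⟩
  · rintro τ' ⟨ν₁, ν₂, hB, hν⟩
    rcases eq_and_eq_or_of_mul_eq (hA.symm.trans hB) with ⟨rfl, rfl⟩ | ⟨rfl, rfl⟩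
    · rcases hτ with h | h
      · exact h.unique (Or.inl hν)
      · exact h.unique (Or.inr hν)
    · rcases hτ with h | h
      · exact h.unique (Or.inr hν)
      · exact h.unique (Or.inl hν)

open Polynomial in
theorem isHDisk_conformalRange (hH : Module.finrank ℂ H = 2) {A : H →ₗ[ℂ] H} {μ₁ μ₂ : ℂ}
    (hA : LinearMap.charpoly A = (X - C μ₁) * (X - C μ₂)) (hn : ¬ IsStarNormal A)
    (h₁ : μ₁.im ≠ 0) (h : μ₂ = μ₁ ∨ μ₂ = conj μ₁) : IsHDisk (conformalRange A .BCK) := by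
  obtain ⟨s, hs, hS⟩ := exists_rangeForm hH hA hn
  rw [isHDisk_iff]
  refine ⟨iota .BCK μ₁, (s + 4 * μ₁.im ^ 2) / (‖μ₁‖ ^ 2 + 1) ^ 2, isOrdinary_iota h₁, ?_, ?_⟩
  · rw [lt_div_iff₀ (by positivity)]
    linarith [one_sub_sq_iota μ₁]
  · ext X
    rw [hS, rangeForm_nonpos_iff_of_conj h hs]
    rfl

open Polynomial in
theorem isHHorodisk_conformalRange (hH : Module.finrank ℂ H = 2) {A : H →ₗ[ℂ] H} {μ : ℂ}
    (hA : LinearMap.charpoly A = (X - C μ) * (X - C μ)) (hn : ¬ IsStarNormal A)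
    (h₁ : μ.im = 0) : IsHHorodisk (conformalRange A .BCK) (iota .BCK μ) := by
  obtain ⟨s, hs, hS⟩ := exists_rangeForm hH hA hn
  rw [isHHorodisk_iff]
  refine ⟨isAsymptotic_iota h₁, (s + 4 * μ.im ^ 2) / (‖μ‖ ^ 2 + 1) ^ 2, by positivity, ?_⟩
  ext X
  rw [hS, rangeForm_nonpos_iff_of_conj (Or.inl rfl) hs]
  rfl

open Polynomial in
theorem isHDistanceBand_conformalRange (hH : Module.finrank ℂ H = 2) {A : H →ₗ[ℂ] H} {μ₁ μ₂ : ℂ}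
    (hA : LinearMap.charpoly A = (X - C μ₁) * (X - C μ₂)) (hn : ¬ IsStarNormal A)
    (h₁ : μ₁.im = 0) (h₂ : μ₂.im = 0) (hne : μ₁ ≠ μ₂) :
    IsHDistanceBand (conformalRange A .BCK) (iota .BCK μ₁) (iota .BCK μ₂) := by
  obtain ⟨s, hs, hS⟩ := exists_rangeForm hH hA hn
  have hδ : μ₁.re - μ₂.re ≠ 0 := fun h =>
    hne (Complex.ext (sub_eq_zero.mp h) (by rw [h₁, h₂]))
  refine isHDistanceBand_of_eq (isAsymptotic_iota h₁) (isAsymptotic_iota h₂) ?_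
    (c := 1 + s / (μ₁.re - μ₂.re) ^ 2) ?_ ?_ (conformalRange_subset_baseSet A .BCK)
  · rw [Ne, iota_BCK_eq_iff, Complex.conj_eq_iff_im.mpr h₂, or_self]
    exact hne
  · have : 0 < s / (μ₁.re - μ₂.re) ^ 2 := by positivity
    linarith
  · ext X
    rw [hS, rangeForm_nonpos_iff_of_real h₁ h₂ hne hs]
    rfl

open Polynomial in
theorem isProperHEllipticalDisk_conformalRange (hH : Module.finrank ℂ H = 2) {A : H →ₗ[ℂ] H}
    {μ₁ μ₂ : ℂ} (hA : LinearMap.charpoly A = (X - C μ₁) * (X - C μ₂)) (hn : ¬ IsStarNormal A)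
    (h₁ : μ₁.im ≠ 0) (h₂ : μ₂.im ≠ 0) (hne : μ₁ ≠ μ₂) (hne' : μ₁ ≠ conj μ₂) :
    IsProperHEllipticalDisk (conformalRange A .BCK) := by
  refine ⟨isEllipticalDisk_conformalRange hH hA hn h₁, fun p hp => ?_, fun hd => ?_⟩
  · refine lt_of_le_of_ne (conformalRange_subset_baseSet A .BCK hp) fun has => ?_
    obtain ⟨c, hc, -⟩ := exists_real_eigenvalue_of_asymptotic hp has
    rcases eq_or_eq_of_hasEigenvalue hA hc with rfl | rfl
    · exact h₁ (Complex.ofReal_im c)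
    · exact h₂ (Complex.ofReal_im c)
  · obtain ⟨P, c, hP, hc, hS⟩ := isHDisk_iff.mp hd
    have hc0 : 0 < c := lt_trans (by unfold IsOrdinary at hP; linarith) hc
    have e₁ := center_eq_iota_of_eq hH hA hn h₁ hc0 hS
    have e₂ := center_eq_iota_of_eq hH (hA.trans (mul_comm _ _)) hn h₂ hc0 hS
    rcases iota_BCK_eq_iff.mp (e₁.symm.trans e₂) with h | h
    · exact hne h
    · exact hne' h

open Polynomial in
theorem isHEllipticParabolicDisk_conformalRange (hH : Module.finrank ℂ H = 2) {A : H →ₗ[ℂ] H}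
    {μ₁ μ₂ : ℂ} (hA : LinearMap.charpoly A = (X - C μ₁) * (X - C μ₂)) (hn : ¬ IsStarNormal A)
    (h₁ : μ₁.im ≠ 0) (h₂ : μ₂.im = 0) :
    IsHEllipticParabolicDisk (conformalRange A .BCK) (iota .BCK μ₂) := by
  refine ⟨isEllipticalDisk_conformalRange hH hA hn h₁, conformalRange_subset_baseSet A .BCK,
    ?_, fun hd => ?_⟩
  · ext p
    constructor
    · rintro ⟨hp, has⟩
      obtain ⟨c, hc, rfl⟩ := exists_real_eigenvalue_of_asymptotic hp has
      rcases eq_or_eq_of_hasEigenvalue hA hc with rfl | rfl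
      · exact absurd (Complex.ofReal_im c) h₁
      · rfl
    · rintro rfl
      refine ⟨?_, isAsymptotic_iota h₂⟩
      obtain ⟨s, hs, hS⟩ := exists_rangeForm hH hA hn
      rw [hS, rangeForm_swap, rangeForm_iota_left, neg_nonpos]
      positivity
  · obtain ⟨has, k, hk, hS⟩ := isHHorodisk_iff.mp hd
    have e := center_eq_iota_of_eq hH hA hn h₁ hk hS
    have hord := isOrdinary_iota h₁
    rw [← e] at hord
    unfold IsOrdinary at hord
    unfold IsAsymptotic at has
    linarith

end

end ConformalRange

end

theorem mainTheorem1 {H : Type*} [NormedAddCommGroup H] [InnerProductSpace ℂ H]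
    [FiniteDimensional ℂ H] (hH : Module.finrank ℂ H = 2) (A : H →ₗ[ℂ] H) :
    -- exactly one of the five spectral types occurs (so ten cases, with normality)
    (∃! τ : ConformalRange.SpectralType, ∃ μ₁ μ₂ : ℂ, ConformalRange.HasSpectralType A τ μ₁ μ₂) ∧
    -- in each model, for every listing of the eigenvalues
    ∀ (m : ConformalRange.HModel) (μ₁ μ₂ : ℂ),
      ConformalRange.conformalRange A m ⊆ ConformalRange.baseSet m ∧
      -- (i)
      (ConformalRange.HasSpectralType A .nonrealEqualOrConjugate μ₁ μ₂ → IsStarNormal A →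
        ConformalRange.conformalRange A m = {ConformalRange.iota m μ₁} ∧
        ConformalRange.IsOrdinary (ConformalRange.toBCK m (ConformalRange.iota m μ₁))) ∧
      -- (ii)
      (ConformalRange.HasSpectralType A .nonrealGeneric μ₁ μ₂ → IsStarNormal A →
        ConformalRange.IsHSegmentConnecting
          (ConformalRange.toBCK m '' ConformalRange.conformalRange A m)
          (ConformalRange.toBCK m (ConformalRange.iota m μ₁))
          (ConformalRange.toBCK m (ConformalRange.iota m μ₂))) ∧
      -- (iii)
      (ConformalRange.HasSpectralType A .realDistinct μ₁ μ₂ → IsStarNormal A →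
        ConformalRange.IsClosedHLineConnecting
          (ConformalRange.toBCK m '' ConformalRange.conformalRange A m)
          (ConformalRange.toBCK m (ConformalRange.iota m μ₁))
          (ConformalRange.toBCK m (ConformalRange.iota m μ₂))) ∧
      -- (iv)
      (ConformalRange.HasSpectralType A .nonrealAndReal μ₁ μ₂ → IsStarNormal A →
        ConformalRange.IsClosedHHalfLine
          (ConformalRange.toBCK m '' ConformalRange.conformalRange A m)
          (ConformalRange.toBCK m (ConformalRange.iota m μ₁))
          (ConformalRange.toBCK m (ConformalRange.iota m μ₂))) ∧
      -- (v)
      (ConformalRange.HasSpectralType A .realDouble μ₁ μ₂ → IsStarNormal A →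
        ConformalRange.conformalRange A m = {ConformalRange.iota m μ₁} ∧
        ConformalRange.IsAsymptotic (ConformalRange.toBCK m (ConformalRange.iota m μ₁))) ∧
      -- (vi)
      (ConformalRange.HasSpectralType A .nonrealEqualOrConjugate μ₁ μ₂ → ¬ IsStarNormal A →
        ConformalRange.IsHDisk (ConformalRange.toBCK m '' ConformalRange.conformalRange A m) ∧
        ConformalRange.iota m μ₁ ∈ interior (ConformalRange.conformalRange A m)) ∧
      -- (vii)
      (ConformalRange.HasSpectralType A .nonrealGeneric μ₁ μ₂ → ¬ IsStarNormal A →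
        ConformalRange.IsProperHEllipticalDisk
          (ConformalRange.toBCK m '' ConformalRange.conformalRange A m) ∧
        ConformalRange.iota m μ₁ ∈ interior (ConformalRange.conformalRange A m) ∧
        ConformalRange.iota m μ₂ ∈ interior (ConformalRange.conformalRange A m)) ∧
      -- (viii)
      (ConformalRange.HasSpectralType A .realDistinct μ₁ μ₂ → ¬ IsStarNormal A →
        ConformalRange.IsHDistanceBand
          (ConformalRange.toBCK m '' ConformalRange.conformalRange A m)
          (ConformalRange.toBCK m (ConformalRange.iota m μ₁))
          (ConformalRange.toBCK m (ConformalRange.iota m μ₂))) ∧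
      -- (ix)
      (ConformalRange.HasSpectralType A .nonrealAndReal μ₁ μ₂ → ¬ IsStarNormal A →
        ConformalRange.IsHEllipticParabolicDisk
          (ConformalRange.toBCK m '' ConformalRange.conformalRange A m)
          (ConformalRange.toBCK m (ConformalRange.iota m μ₂)) ∧
        ConformalRange.iota m μ₁ ∈ interior (ConformalRange.conformalRange A m)) ∧
      -- (x)
      (ConformalRange.HasSpectralType A .realDouble μ₁ μ₂ → ¬ IsStarNormal A →
        ConformalRange.IsHHorodisk
          (ConformalRange.toBCK m '' ConformalRange.conformalRange A m)
          (ConformalRange.toBCK m (ConformalRange.iota m μ₁))) := by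
  refine ⟨ConformalRange.existsUnique_spectralType hH A, fun m μ₁ μ₂ => ?_⟩
  simp only [ConformalRange.toBCK_image_conformalRange, ConformalRange.toBCK_iota]
  refine ⟨ConformalRange.conformalRange_subset_baseSet A m, ?_, ?_, ?_, ?_, ?_, ?_, ?_, ?_, ?_, ?_⟩
  · rintro ⟨hA, h₁, h⟩ hn
    have hι : ConformalRange.iota .BCK μ₁ = ConformalRange.iota .BCK μ₂ := by
      rw [eq_comm, ConformalRange.iota_BCK_eq_iff]
      exact h
    refine ⟨ConformalRange.conformalRange_eq_singleton ?_ m, ConformalRange.isOrdinary_iota h₁⟩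
    rw [ConformalRange.conformalRange_eq_segment hH hA hn, ← hι, segment_same]
  · rintro ⟨hA, h₁, h₂, hne, hne'⟩ hn
    refine ⟨ConformalRange.isOrdinary_iota h₁, ConformalRange.isOrdinary_iota h₂, ?_,
      ConformalRange.conformalRange_eq_segment hH hA hn⟩
    rw [Ne, ConformalRange.iota_BCK_eq_iff]
    exact not_or.mpr ⟨hne, hne'⟩
  · rintro ⟨hA, h₁, h₂, hne⟩ hn
    have hι : ConformalRange.iota .BCK μ₁ ≠ ConformalRange.iota .BCK μ₂ := by
      rw [Ne, ConformalRange.iota_BCK_eq_iff, Complex.conj_eq_iff_im.mpr h₂, or_self]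
      exact hne
    refine ⟨ConformalRange.isAsymptotic_iota h₁, ConformalRange.isAsymptotic_iota h₂, hι, ?_⟩
    rw [ConformalRange.conformalRange_eq_segment hH hA hn]
    exact ConformalRange.segment_eq_closedLine (ConformalRange.isAsymptotic_iota h₁)
      (ConformalRange.isAsymptotic_iota h₂) hι
  · rintro ⟨hA, h₁, h₂⟩ hn
    refine ⟨ConformalRange.isOrdinary_iota h₁, ConformalRange.isAsymptotic_iota h₂, ?_⟩
    rw [ConformalRange.conformalRange_eq_segment hH hA hn]
    exact ConformalRange.segment_eq_closedHalfLine (ConformalRange.isOrdinary_iota h₁)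
      (ConformalRange.isAsymptotic_iota h₂)
  · rintro ⟨hA, h₁, rfl⟩ hn
    refine ⟨ConformalRange.conformalRange_eq_singleton ?_ m, ConformalRange.isAsymptotic_iota h₁⟩
    rw [ConformalRange.conformalRange_eq_segment hH hA hn, segment_same]
  · rintro ⟨hA, h₁, h⟩ hn
    exact ⟨ConformalRange.isHDisk_conformalRange hH hA hn h₁ h,
      ConformalRange.iota_left_mem_interior hH hA hn h₁ m⟩
  · rintro ⟨hA, h₁, h₂, hne, hne'⟩ hn
    exact ⟨ConformalRange.isProperHEllipticalDisk_conformalRange hH hA hn h₁ h₂ hne hne',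
      ConformalRange.iota_left_mem_interior hH hA hn h₁ m,
      ConformalRange.iota_left_mem_interior hH (hA.trans (mul_comm _ _)) hn h₂ m⟩
  · rintro ⟨hA, h₁, h₂, hne⟩ hn
    exact ConformalRange.isHDistanceBand_conformalRange hH hA hn h₁ h₂ hne
  · rintro ⟨hA, h₁, h₂⟩ hn
    exact ⟨ConformalRange.isHEllipticParabolicDisk_conformalRange hH hA hn h₁ h₂,
      ConformalRange.iota_left_mem_interior hH hA hn h₁ m⟩
  · rintro ⟨hA, h₁, rfl⟩ hn
    exact ConformalRange.isHHorodisk_conformalRange hH hA hn h₁
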